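/- Let $K$ be a finite simplicial complex of dimension $d\ge 3$, and let $\mathrm{sd}^{\ell}K$ denote its $\ell$-th iterated barycentric subdivision. A *discrete Morse strategy*, run on a finite simplicial complex $L$, repeats the following step until no face is left: if the current complex has dimension $k$ and has free $(k-1)$-faces (nonempty faces of dimension $k-1$ properly contained in exactly one face), it selects one of them and deletes it together with the unique face that properly contains it; if there are none, it selects a $k$-face, declares it *critical*, and deletes it. The strategy `random` makes each of these selections uniformly at random among the available faces, independently of the past. The strategies `random-lex-first` and `random-lex-last` first label the vertices of $L$ with $1,\dots,n$ ($n$ the number of vertices) uniformly at random, and then at each step select the lexicographically smallest, respectively largest, available face, where a face is read as the increasing list of its vertex labels. Let $\mathbb{E}_1(L),\mathbb{E}_2(L),\mathbb{E}_3(L)$ be the expected total number of critical faces found on $L$ by `random`, `random-lex-first` and `random-lex-last`, respectively. Then, for each $i\in\{1,2,3\}$, $$\log \mathbb{E}_i(\mathrm{sd}^{\ell}K)=\varTheta(\ell)\qquad(\ell\to\infty),$$ that is, there are constants $c,C>0$ such that $c\,\ell\le \log\mathbb{E}_i(\mathrm{sd}^{\ell}K)\le C\,\ell$ for all sufficiently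 large $\ell$. -/

import Mathlib

universe u

/-- A finite abstract simplicial complex: a finite vertex set `V` together with a family of
nonempty subsets of `V` (the faces) that contains every singleton and every nonempty subset of
each of its members. -/
structure FinSimplicialComplex where
  /-- the vertex set -/
  V : Type u
  /-- the vertex set is finite -/
  finite_V : Finite V
  /-- the complex itself -/
  complex : AbstractSimplicialComplex V

namespace FinSimplicialComplex

attribute [instance] FinSimplicialComplex.finite_V

/-- The finite set of all (nonempty) faces of `K`. -/
noncomputable def faceFinset (K : FinSimplicialComplex.{u}) : Finset (Finset K.V) :=
  (Set.toFinite K.complex.faces).toFinset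

/-- The dimension of `K`: the maximal number of vertices of a face, minus one
(so that the empty complex has dimension `-1`). -/
noncomputable def dim (K : FinSimplicialComplex.{u}) : ℤ :=
  (K.faceFinset.sup Finset.card : ℕ) - 1

/-- The barycentric subdivision `sd K`: its vertices are the faces of `K`, its faces are the
nonempty chains of faces of `K` with respect to inclusion. -/
def sd (K : FinSimplicialComplex.{u}) : FinSimplicialComplex.{u} where
  V := {σ : Finset K.V // σ ∈ K.complex.faces}
  finite_V := inferInstance
  complex :=
    { faces := {c | c.Nonempty ∧ ∀ σ ∈ c, ∀ τ ∈ c, σ.1 ⊆ τ.1 ∨ τ.1 ⊆ σ.1}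
      isRelLowerSet_faces := fun _ hc =>
        ⟨hc.1, fun _ hts ht => ⟨ht, fun σ hσ τ hτ => hc.2 σ (hts hσ) τ (hts hτ)⟩⟩
      singleton_mem := fun v => by
        refine ⟨Finset.singleton_nonempty v, fun σ hσ τ hτ => Or.inl ?_⟩
        rw [Finset.mem_singleton.mp hσ, Finset.mem_singleton.mp hτ] }

end FinSimplicialComplex

namespace DiscreteMorse

variable {V : Type u}

/-- The faces of maximal dimension of a complex with face set `S`. -/
def topFaces (S : Finset (Finset V)) : Finset (Finset V) :=
  S.filter fun τ => τ.card = S.sup Finset.card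

open Classical in
/-- The free faces of codimension one of a complex with face set `S`: the faces of dimension
`dim S - 1` that are properly contained in exactly one face. (The empty set is not a face, so a
complex of dimension `0` has no such free face.) -/
noncomputable def freeFaces (S : Finset (Finset V)) : Finset (Finset V) :=
  S.filter fun σ => σ.card + 1 = S.sup Finset.card ∧ ∃! τ, τ ∈ S ∧ σ ⊂ τ

open Classical in
/-- The elementary collapse at a free face `σ`: delete `σ` and the unique face that properly
contains it, that is, all the faces that contain `σ`. -/
noncomputable def collapse (S : Finset (Finset V)) (σ : Finset V) : Finset (Finset V) :=
  S.filter fun τ => ¬ σ ⊆ τ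

theorem topFaces_nonempty {S : Finset (Finset V)} (hS : S.Nonempty) : (topFaces S).Nonempty := by
  obtain ⟨τ, hτ, h⟩ := Finset.exists_mem_eq_sup S hS Finset.card
  exact ⟨τ, Finset.mem_filter.mpr ⟨hτ, h.symm⟩⟩

open Classical in
theorem collapse_card_lt {S : Finset (Finset V)} {σ : Finset V} (h : σ ∈ S) :
    (collapse S σ).card < S.card :=
  Finset.card_lt_card (Finset.filter_ssubset.mpr ⟨σ, h, fun hn => hn (Finset.Subset.refl σ)⟩)

/-- A (possibly random) rule that selects one member of any nonempty finite family of faces. -/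
abbrev Selector (V : Type u) : Type u :=
  (F : Finset (Finset V)) → F.Nonempty → PMF {σ : Finset V // σ ∈ F}

/-- Select a member of the family uniformly at random. -/
noncomputable def selectUniform : Selector V := fun _ hF =>
  haveI := hF.to_subtype
  PMF.uniformOfFintype _

/-- The increasing list of the labels of the vertices of a face. -/
def labelList {n : ℕ} (label : V ≃ Fin n) (σ : Finset V) : List (Fin n) :=
  (σ.map label.toEmbedding).sort

/-- Select the lexicographically smallest face, where a face is read as the increasing list of
the labels of its vertices. -/
noncomputable def selectLexFirst {n : ℕ} (label : V ≃ Fin n) : Selector V := fun F hF =>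
  have h := F.exists_min_image (labelList label) hF
  PMF.pure ⟨h.choose, h.choose_spec.1⟩

/-- Select the lexicographically largest face, where a face is read as the increasing list of
the labels of its vertices. -/
noncomputable def selectLexLast {n : ℕ} (label : V ≃ Fin n) : Selector V := fun F hF =>
  have h := F.exists_max_image (labelList label) hF
  PMF.pure ⟨h.choose, h.choose_spec.1⟩

open Classical in
/-- The discrete Morse algorithm, started on a complex with face set `S`, all choices being made
by the rule `sel`. As long as faces are left: if there are free faces of codimension one, select
one of them and perform the elementary collapse at it; otherwise select a face of maximal
dimension, declare it critical and delete it. The output is the (random) set of critical faces. -/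
noncomputable def run (sel : Selector V) (S : Finset (Finset V)) : PMF (Finset (Finset V)) :=
  if hS : S.Nonempty then
    if hF : (freeFaces S).Nonempty then
      (sel (freeFaces S) hF).bind fun σ => run sel (collapse S σ.1)
    else
      (sel (topFaces S) (topFaces_nonempty hS)).bind fun τ =>
        (run sel (S.erase τ.1)).map (insert τ.1)
  else
    PMF.pure ∅
termination_by S.card
decreasing_by
  · exact collapse_card_lt (Finset.mem_filter.mp σ.2).1
  · exact Finset.card_erase_lt_of_mem (Finset.mem_filter.mp τ.2).1

/-- The three randomized discrete Morse strategies. -/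
inductive Strategy where
  | random
  | randomLexFirst
  | randomLexLast

/-- A uniformly random labelling of the vertices of `K` by `0, …, n - 1`, where `n` is the number
of vertices. -/
noncomputable def randomLabelling (K : FinSimplicialComplex.{u}) :
    PMF (K.V ≃ Fin (Nat.card K.V)) :=
  haveI : Nonempty (K.V ≃ Fin (Nat.card K.V)) := ⟨Finite.equivFin K.V⟩
  haveI := Fintype.ofFinite (K.V ≃ Fin (Nat.card K.V))
  PMF.uniformOfFintype _

/-- The law of the set of critical faces found by a strategy on `K`. The strategy `random` makes
every choice uniformly at random; `randomLexFirst` and `randomLexLast` first label the vertices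
uniformly at random and then always choose the lexicographically smallest, respectively largest,
face. -/
noncomputable def criticalFaces (K : FinSimplicialComplex.{u}) :
    Strategy → PMF (Finset (Finset K.V))
  | .random => run selectUniform K.faceFinset
  | .randomLexFirst =>
      (randomLabelling K).bind fun label => run (selectLexFirst label) K.faceFinset
  | .randomLexLast =>
      (randomLabelling K).bind fun label => run (selectLexLast label) K.faceFinset

/-- The law of the number of critical faces found by a strategy on `K`. -/
noncomputable def criticalCount (s : Strategy) (K : FinSimplicialComplex.{u}) : PMF ℕ :=
  (criticalFaces K s).map Finset.card

/-- The expected number of critical faces found by a strategy on `K`. -/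
noncomputable def expectedCritical (s : Strategy) (K : FinSimplicialComplex.{u}) : ℝ :=
  ∫ n, (n : ℝ) ∂(criticalCount s K).toMeasure

end DiscreteMorse

/-! Upper bound. A run finds at most as many critical faces as there are faces, and one subdivision
multiplies the number of faces by at most a constant depending on `d` (`card_faceFinset_sd_le`).

Lower bound. The number of `d`-faces at least doubles with each subdivision, so it suffices that
every `d`-face of a complex contributes, on average, at least a constant `p > 0` of critical faces
to its fourth subdivision. The local obstruction is a trap (`IsTrap`), in the spirit of Bing's house
with two rooms: facets `D` inside one simplex, a set `H` of interior walls such that no ridge lies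
in exactly one member of `H`, and a disjoint set `A` of interior walls through which `D` stays
connected. If a member of `H` is free, one of its two facets is gone and the other is not, so
connectedness yields a free member of `A`. If the strategy prefers `A` whenever it matters, `H`
survives until the dimension has dropped to `d - 1`. From then on no collapse touches `H`, so its
first face to be deleted is declared critical (`pow_le_run_hits`).

Construction. The facets of the second subdivision of a `d`-simplex are pairs `(π, ρ)` of
permutations: `π` orders the vertices of the simplex, and `ρ` orders the flag of initial segments of
`π`. The position in `ρ` of the barycenter, which is the flag member `Fin.last d`, splits them into
a core (position 0), a layer of tiles around it (position 1) and the outside. Let `h` be the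
position of vertex 0 in `π`. The core has two rooms, told apart by `sign π * (-1) ^ h`, except that
`h = 0` belongs to room 1 and `h = d` to room 2. Moving vertex 0 does not change the room, so room 1
can be left through the tile at vertex 0 and room 2 through the tile at the opposite wall; all other
tiles are closed to the outside. For `d ≥ 3` there is always a transposition that stays in a tile
and switches the room below it, so every tile is accessible from a room and the complement of the
barrier is connected (`reach_base`). No ridge lies in a single member of the barrier, because
colours read around a ridge cannot change exactly once (`exists_change`, `square_inner`,
`square_outer`).

Chance. A uniform choice prefers `A` with probability bounded below. For the two lexicographic
rules, two further subdivisions (`IsTrap.lift`) produce vertices that distinguish `A` from `H`, so a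
favourable order of the labels of boundedly many vertices suffices. Traps in distinct facets have
disjoint barriers, so their contributions add up (`sum_hits_le_expectedCritical`). -/

namespace FinSimplicialComplex

/-! ### Ordered facets, and facets of the barycentric subdivision as flags -/

/-- All faces of `K` have at most `d + 1` vertices. -/
def DimLE (d : ℕ) (K : FinSimplicialComplex.{u}) : Prop :=
  ∀ σ ∈ K.complex.faces, σ.card ≤ d + 1

/-- A face with `d + 1` vertices, together with an ordering of its vertices. -/
@[ext]
structure OrdFacet (K : FinSimplicialComplex.{u}) (d : ℕ) where
  /-- the list of vertices -/
  toEmb : Fin (d + 1) ↪ K.V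
  /-- the vertices span a face -/
  mem : Finset.univ.map toEmb ∈ K.complex.faces

theorem mem_faces_of_subset {K : FinSimplicialComplex.{u}} {σ τ : Finset K.V}
    (hσ : σ ∈ K.complex.faces) (h : τ ⊆ σ) (hτ : τ.Nonempty) : τ ∈ K.complex.faces :=
  (K.complex.isRelLowerSet_faces hσ).2 h hτ

theorem nonempty_of_mem_faces {K : FinSimplicialComplex.{u}} {σ : Finset K.V}
    (hσ : σ ∈ K.complex.faces) : σ.Nonempty :=
  (K.complex.isRelLowerSet_faces hσ).1

theorem mem_faceFinset {K : FinSimplicialComplex.{u}} {σ : Finset K.V} :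
    σ ∈ K.faceFinset ↔ σ ∈ K.complex.faces := by
  simp [faceFinset]

/-- The transposition of the positions `k` and `k + 1`. -/
def adjSwap {d : ℕ} (k : Fin d) : Equiv.Perm (Fin (d + 1)) := Equiv.swap k.castSucc k.succ

namespace OrdFacet

variable {K : FinSimplicialComplex.{u}} {d : ℕ}

instance : CoeFun (OrdFacet K d) fun _ => Fin (d + 1) → K.V := ⟨fun f => f.toEmb⟩

theorem inj (f : OrdFacet K d) {i j : Fin (d + 1)} (h : f i = f j) : i = j := f.toEmb.injective h

theorem ext_apply {f g : OrdFacet K d} (h : ∀ i, f i = g i) : f = g :=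
  OrdFacet.ext (DFunLike.ext _ _ h)

/-- The underlying face. -/
def face (f : OrdFacet K d) : Finset K.V := Finset.univ.map f.toEmb

theorem face_mem (f : OrdFacet K d) : f.face ∈ K.complex.faces := f.mem

theorem card_face (f : OrdFacet K d) : f.face.card = d + 1 := by simp [face]

theorem mem_face {f : OrdFacet K d} {v : K.V} : v ∈ f.face ↔ ∃ i, f i = v := by simp [face]

theorem apply_mem_face (f : OrdFacet K d) (i : Fin (d + 1)) : f i ∈ f.face := mem_face.2 ⟨i, rfl⟩

/-- The set of the first `n` vertices. -/
def initial (f : OrdFacet K d) (n : ℕ) : Finset K.V :=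
  (Finset.univ.filter fun i : Fin (d + 1) => i.val < n).map f.toEmb

theorem mem_initial {f : OrdFacet K d} {n : ℕ} {v : K.V} :
    v ∈ f.initial n ↔ ∃ i : Fin (d + 1), i.val < n ∧ f i = v := by
  simp [initial]

theorem apply_mem_initial {f : OrdFacet K d} {n : ℕ} {i : Fin (d + 1)} :
    f i ∈ f.initial n ↔ i.val < n := by
  rw [mem_initial]
  exact ⟨fun ⟨j, hj, h⟩ => f.inj h ▸ hj, fun h => ⟨i, h, rfl⟩⟩

theorem card_initial (f : OrdFacet K d) {n : ℕ} (hn : n ≤ d + 1) : (f.initial n).card = n := by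
  rw [initial, Finset.card_map, Fin.card_filter_val_lt, min_eq_right hn]

theorem initial_subset_face (f : OrdFacet K d) (n : ℕ) : f.initial n ⊆ f.face :=
  Finset.map_subset_map.2 (Finset.filter_subset _ _)

theorem initial_mono (f : OrdFacet K d) {m n : ℕ} (h : m ≤ n) : f.initial m ⊆ f.initial n := by
  intro v hv
  obtain ⟨i, hi, rfl⟩ := mem_initial.1 hv
  exact apply_mem_initial.2 (hi.trans_le h)

theorem initial_succ_mem (f : OrdFacet K d) (i : Fin (d + 1)) :
    f.initial (i.val + 1) ∈ K.complex.faces :=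
  mem_faces_of_subset f.mem (f.initial_subset_face _)
    ⟨f i, apply_mem_initial.2 (Nat.lt_succ_self _)⟩

theorem initial_last (f : OrdFacet K d) : f.initial (d + 1) = f.face := by
  ext v
  rw [mem_initial, mem_face]
  exact ⟨fun ⟨i, _, h⟩ => ⟨i, h⟩, fun ⟨i, h⟩ => ⟨i, i.2, h⟩⟩

theorem eq_of_initial_eq {f g : OrdFacet K d} {i : Fin (d + 1)}
    (h₀ : f.initial i.val = g.initial i.val) (h₁ : f.initial (i.val + 1) = g.initial (i.val + 1)) :
    f i = g i := by
  have h : f i ∈ g.initial (i.val + 1) := h₁ ▸ apply_mem_initial.2 (Nat.lt_succ_self _)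
  obtain ⟨j, hj, hji⟩ := mem_initial.1 h
  rcases Nat.lt_succ_iff_lt_or_eq.1 hj with hlt | heq
  · have : f i ∈ f.initial i.val := by
      rw [h₀, ← hji]
      exact apply_mem_initial.2 hlt
    exact absurd (apply_mem_initial.1 this) (lt_irrefl _)
  · rw [← hji, Fin.ext heq]

theorem initial_eq_of_agree {f g : OrdFacet K d} {n : ℕ} (h : ∀ i : Fin (d + 1), i.val < n → f i = g i) :
    f.initial n = g.initial n := by
  ext v
  rw [mem_initial, mem_initial]
  exact ⟨fun ⟨i, hi, hv⟩ => ⟨i, hi, h i hi ▸ hv⟩, fun ⟨i, hi, hv⟩ => ⟨i, hi, (h i hi).symm ▸ hv⟩⟩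

/-- Reorder the vertices. -/
def perm (f : OrdFacet K d) (π : Equiv.Perm (Fin (d + 1))) : OrdFacet K d where
  toEmb := π.toEmbedding.trans f.toEmb
  mem := by
    rw [← Finset.map_map, Finset.map_univ_equiv]
    exact f.mem

@[simp] theorem perm_apply (f : OrdFacet K d) (π : Equiv.Perm (Fin (d + 1))) (i : Fin (d + 1)) :
    f.perm π i = f (π i) := rfl

@[simp] theorem perm_face (f : OrdFacet K d) (π : Equiv.Perm (Fin (d + 1))) :
    (f.perm π).face = f.face := by
  ext v
  rw [mem_face, mem_face]
  exact ⟨fun ⟨i, h⟩ => ⟨π i, h⟩, fun ⟨i, h⟩ => ⟨π.symm i, by simpa using h⟩⟩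

theorem adjSwap_lt_iff {k : Fin d} {n : ℕ} (hn : n ≠ k.val + 1) (i : Fin (d + 1)) :
    (adjSwap k i).val < n ↔ i.val < n := by
  rw [adjSwap, Equiv.swap_apply_def]
  split_ifs with h₁ h₂ <;> simp_all [Fin.ext_iff] <;> omega

theorem adjSwap_adjSwap (k : Fin d) (i : Fin (d + 1)) : adjSwap k (adjSwap k i) = i := by
  simp [adjSwap]

theorem initial_perm_adjSwap (f : OrdFacet K d) {k : Fin d} {n : ℕ} (hn : n ≠ k.val + 1) :
    (f.perm (adjSwap k)).initial n = f.initial n := by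
  ext v
  rw [mem_initial, mem_initial]
  constructor
  · rintro ⟨i, hi, h⟩
    exact ⟨adjSwap k i, (adjSwap_lt_iff hn i).2 hi, h⟩
  · rintro ⟨i, hi, h⟩
    exact ⟨adjSwap k i, (adjSwap_lt_iff hn i).2 hi, by simpa [adjSwap_adjSwap] using h⟩

/-- The face spanned by all vertices but the `k`-th. -/
def wall (f : OrdFacet K d) (k : Fin (d + 1)) : Finset K.V := (Finset.univ.erase k).map f.toEmb

theorem mem_wall {f : OrdFacet K d} {k : Fin (d + 1)} {v : K.V} :
    v ∈ f.wall k ↔ ∃ i, i ≠ k ∧ f i = v := by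
  simp [wall]

theorem apply_mem_wall {f : OrdFacet K d} {k i : Fin (d + 1)} : f i ∈ f.wall k ↔ i ≠ k := by
  rw [mem_wall]
  exact ⟨fun ⟨j, hj, h⟩ => f.inj h ▸ hj, fun h => ⟨i, h, rfl⟩⟩

theorem card_wall (f : OrdFacet K d) (k : Fin (d + 1)) : (f.wall k).card = d := by
  simp [wall]

theorem wall_subset_face (f : OrdFacet K d) (k : Fin (d + 1)) : f.wall k ⊆ f.face :=
  Finset.map_subset_map.2 (Finset.subset_univ _)

theorem wall_injective (f : OrdFacet K d) {k l : Fin (d + 1)} (h : f.wall k = f.wall l) :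
    k = l := by
  by_contra hne
  exact apply_mem_wall.1 (h ▸ apply_mem_wall.2 (Ne.symm hne) : f l ∈ f.wall l) rfl

theorem wall_last (f : OrdFacet K d) : f.wall (Fin.last d) = f.initial d := by
  ext v
  rw [mem_wall, mem_initial]
  refine exists_congr fun i => and_congr_left fun _ => ?_
  rw [Ne, Fin.ext_iff, Fin.val_last]
  omega

theorem wall_eq_of_agree {f g : OrdFacet K d} {k : Fin (d + 1)} (h : ∀ i, i ≠ k → f i = g i) :
    f.wall k = g.wall k := by
  ext v
  rw [mem_wall, mem_wall]
  exact ⟨fun ⟨i, hi, hv⟩ => ⟨i, hi, h i hi ▸ hv⟩, fun ⟨i, hi, hv⟩ => ⟨i, hi, (h i hi).symm ▸ hv⟩⟩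

theorem eq_wall_of_subset {f : OrdFacet K d} {σ : Finset K.V} (h : σ ⊆ f.face) (hc : σ.card = d) :
    ∃ k, σ = f.wall k := by
  have : ∃ v ∈ f.face, v ∉ σ := by
    by_contra! hcon
    have := Finset.card_le_card (show f.face ⊆ σ from hcon)
    rw [card_face] at this
    omega
  obtain ⟨v, hv, hvσ⟩ := this
  obtain ⟨k, rfl⟩ := mem_face.1 hv
  refine ⟨k, Finset.eq_of_subset_of_card_le (fun w hw => ?_) (by rw [card_wall, hc])⟩
  obtain ⟨i, rfl⟩ := mem_face.1 (h hw)
  exact apply_mem_wall.2 fun hik => hvσ (hik ▸ hw)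

/-- A subset of a facet of codimension one with one more vertex removed. -/
theorem exists_ne_of_subset_wall {f : OrdFacet K d} {k : Fin (d + 1)} {σ : Finset K.V}
    (h : σ ⊆ f.wall k) (hc : σ.card + 1 = d) :
    ∃ l, l ≠ k ∧ ∀ v, v ∈ σ ↔ ∃ i, i ≠ k ∧ i ≠ l ∧ f i = v := by
  have : ∃ v ∈ f.wall k, v ∉ σ := by
    by_contra! hcon
    have := Finset.card_le_card (show f.wall k ⊆ σ from hcon)
    rw [card_wall] at this
    omega
  obtain ⟨v, hv, hvσ⟩ := this
  obtain ⟨l, hl, rfl⟩ := mem_wall.1 hv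
  have hsub : σ ⊆ ((Finset.univ.erase k).erase l).map f.toEmb := fun w hw => by
    obtain ⟨i, hi, rfl⟩ := mem_wall.1 (h hw)
    exact Finset.mem_map_of_mem _
      (by simpa [hi] using fun hil : i = l => hvσ (hil ▸ hw))
  have heq : σ = ((Finset.univ.erase k).erase l).map f.toEmb := by
    refine Finset.eq_of_subset_of_card_le hsub ?_
    rw [Finset.card_map, Finset.card_erase_of_mem (by simpa using hl),
      Finset.card_erase_of_mem (Finset.mem_univ _), Finset.card_univ, Fintype.card_fin]
    omega
  refine ⟨l, hl, fun w => ?_⟩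
  rw [heq]
  simp [and_left_comm, and_assoc]

/-- Two orderings that agree up to the last vertex and span the same face are equal. -/
theorem eq_of_agree_of_face_eq {f g : OrdFacet K d} (h : ∀ i, i ≠ Fin.last d → f i = g i)
    (hF : f.face = g.face) : f = g := by
  refine ext_apply fun i => ?_
  by_cases hi : i = Fin.last d
  · subst hi
    refine eq_of_initial_eq ?_ ?_
    · rw [Fin.val_last, ← wall_last, ← wall_last]
      exact wall_eq_of_agree h
    · rw [Fin.val_last, initial_last, initial_last, hF]
  · exact h i hi

theorem exists_extend {s : Finset (Fin (d + 1))} {f : Fin (d + 1) → K.V} {σ : Finset K.V}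
    (hσ : σ ∈ K.complex.faces) (hc : σ.card = d + 1) (hf : Set.InjOn f s)
    (hfs : ∀ i ∈ s, f i ∈ σ) : ∃ g : OrdFacet K d, g.face = σ ∧ ∀ i ∈ s, g i = f i := by
  classical
  obtain ⟨e, he⟩ := Finset.exists_equiv_extend_of_card_eq (t := σ) (s := s) (f := f)
    (by simpa using hc.symm) (by simpa [Finset.image_subset_iff] using hfs) hf
  have hmap : Finset.univ.map (e.toEmbedding.trans (Function.Embedding.subtype _)) = σ := by
    ext v
    simp only [Finset.mem_map, Finset.mem_univ, true_and, Function.Embedding.trans_apply]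
    exact ⟨fun ⟨i, hi⟩ => hi ▸ (e i).2, fun hv => ⟨e.symm ⟨v, hv⟩, by simp⟩⟩
  have hmem : Finset.univ.map (e.toEmbedding.trans (Function.Embedding.subtype _)) ∈
      K.complex.faces := by rwa [hmap]
  exact ⟨⟨_, hmem⟩, hmap, he⟩

theorem exists_face_eq {σ : Finset K.V} (hσ : σ ∈ K.complex.faces) (hc : σ.card = d + 1) :
    ∃ g : OrdFacet K d, g.face = σ := by
  have hne : σ.Nonempty := Finset.card_pos.1 (by omega)
  obtain ⟨g, hg, -⟩ := exists_extend (s := ∅) (f := fun _ => hne.choose) hσ hc (by simp) (by simp)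
  exact ⟨g, hg⟩

theorem exists_wall_last_eq {σ τ : Finset K.V} (hσ : σ ∈ K.complex.faces) (hc : σ.card = d + 1)
    (hτ : τ ⊆ σ) (hcτ : τ.card = d) : ∃ g : OrdFacet K d, g.face = σ ∧ g.wall (Fin.last d) = τ := by
  obtain ⟨g, rfl⟩ := exists_face_eq hσ hc
  obtain ⟨k, rfl⟩ := eq_wall_of_subset hτ hcτ
  refine ⟨g.perm (Equiv.swap k (Fin.last d)), perm_face _ _, ?_⟩
  refine Finset.eq_of_subset_of_card_le (fun v hv => ?_) (by rw [card_wall, card_wall])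
  obtain ⟨i, hi, rfl⟩ := mem_wall.1 hv
  rw [perm_apply, apply_mem_wall]
  exact fun h => hi ((Equiv.swap k (Fin.last d)).injective
    (h.trans (Equiv.swap_apply_right k (Fin.last d)).symm))

/-- The facet of the barycentric subdivision given by the initial segments of an ordering. -/
def flag (f : OrdFacet K d) : OrdFacet K.sd d where
  toEmb :=
    { toFun := fun i => ⟨f.initial (i.val + 1), f.initial_succ_mem i⟩
      inj' := fun i j h => by
        have := congrArg Finset.card (Subtype.ext_iff.1 h)
        rw [card_initial _ (by omega), card_initial _ (by omega)] at this
        exact Fin.ext (by omega) }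
  mem := by
    refine ⟨Finset.univ_nonempty.map, fun σ hσ τ hτ => ?_⟩
    obtain ⟨i, -, rfl⟩ := Finset.mem_map.1 hσ
    obtain ⟨j, -, rfl⟩ := Finset.mem_map.1 hτ
    rcases le_total i.val j.val with h | h
    · exact Or.inl (f.initial_mono (by omega))
    · exact Or.inr (f.initial_mono (by omega))

theorem flag_apply_val (f : OrdFacet K d) (i : Fin (d + 1)) :
    (f.flag i).1 = f.initial (i.val + 1) := rfl

theorem card_flag_apply (f : OrdFacet K d) (i : Fin (d + 1)) : (f.flag i).1.card = i.val + 1 :=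
  f.card_initial (by omega)

theorem flag_apply_eq_iff {f g : OrdFacet K d} {i j : Fin (d + 1)} :
    f.flag i = g.flag j ↔ i = j ∧ f.initial (i.val + 1) = g.initial (i.val + 1) := by
  constructor
  · intro h
    have hc := congrArg (fun v => v.1.card) h
    simp only [card_flag_apply] at hc
    have hij : i = j := Fin.ext (by omega)
    subst hij
    exact ⟨rfl, congrArg Subtype.val h⟩
  · rintro ⟨rfl, h⟩
    exact Subtype.ext h

theorem flag_apply_mem_face {f g : OrdFacet K d} {i : Fin (d + 1)} :
    f.flag i ∈ g.flag.face ↔ f.initial (i.val + 1) = g.initial (i.val + 1) := by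
  rw [mem_face]
  constructor
  · rintro ⟨j, hj⟩
    exact (flag_apply_eq_iff.1 hj.symm).2
  · exact fun h => ⟨i, (flag_apply_eq_iff.2 ⟨rfl, h⟩).symm⟩

theorem flag_injective {f g : OrdFacet K d} (h : f.flag.face = g.flag.face) : f = g := by
  have key : ∀ n ≤ d + 1, f.initial n = g.initial n := by
    intro n hn
    rcases n with _ | n
    · simp [initial]
    · exact flag_apply_mem_face.1 (h ▸ apply_mem_face f.flag ⟨n, by omega⟩)
  exact ext_apply fun i => eq_of_initial_eq (key _ (by omega)) (key _ (by omega))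

end OrdFacet

open OrdFacet

variable {K : FinSimplicialComplex.{u}} {d : ℕ}

theorem sd_eq_of_card_eq {c : Finset K.sd.V} (hc : c ∈ K.sd.complex.faces) {σ τ : K.sd.V}
    (hσ : σ ∈ c) (hτ : τ ∈ c) (h : σ.1.card = τ.1.card) : σ = τ := by
  rcases hc.2 σ hσ τ hτ with h' | h'
  · exact Subtype.ext (Finset.eq_of_subset_of_card_le h' h.ge)
  · exact Subtype.ext (Finset.eq_of_subset_of_card_le h' h.le).symm

theorem sd_injOn_card {c : Finset K.sd.V} (hc : c ∈ K.sd.complex.faces) :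
    Set.InjOn (fun σ : K.sd.V => σ.1.card) c :=
  fun _ hσ _ hτ h => sd_eq_of_card_eq hc hσ hτ h

theorem sd_card_pos (σ : K.sd.V) : 0 < σ.1.card :=
  Finset.card_pos.2 (nonempty_of_mem_faces σ.2)

theorem sd_image_card_subset (hK : K.DimLE d) (c : Finset K.sd.V) :
    c.image (fun σ : K.sd.V => σ.1.card) ⊆ Finset.Icc 1 (d + 1) := by
  intro n hn
  obtain ⟨σ, -, rfl⟩ := Finset.mem_image.1 hn
  exact Finset.mem_Icc.2 ⟨sd_card_pos σ, hK _ σ.2⟩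

theorem DimLE.sd (hK : K.DimLE d) : K.sd.DimLE d := by
  intro c hc
  rw [← Finset.card_image_of_injOn (sd_injOn_card hc)]
  exact (Finset.card_le_card (sd_image_card_subset hK c)).trans (by simp)

/-- The members of a chain have distinct cardinalities between 1 and `d + 1`. A chain with `d + 1`
members therefore realises all of them, and each member adds one vertex to the previous one; these
new vertices, in order, form the ordered facet. -/
theorem DimLE.exists_flag (hK : K.DimLE d) {c : Finset K.sd.V} (hc : c ∈ K.sd.complex.faces)
    (hcard : c.card = d + 1) : ∃ f : OrdFacet K d, f.flag.face = c := by
  have himg : c.image (fun σ : K.sd.V => σ.1.card) = Finset.Icc 1 (d + 1) := by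
    refine Finset.eq_of_subset_of_card_le (sd_image_card_subset hK c) ?_
    rw [Finset.card_image_of_injOn (sd_injOn_card hc), hcard]
    simp
  have hex : ∀ i : Fin (d + 1), ∃ σ ∈ c, σ.1.card = i.val + 1 := fun i => by
    have : i.val + 1 ∈ c.image (fun σ : K.sd.V => σ.1.card) := by
      rw [himg]
      exact Finset.mem_Icc.2 ⟨by omega, by omega⟩
    simpa using this
  choose x hxc hxcard using hex
  have hmono : ∀ i j : Fin (d + 1), i ≤ j → (x i).1 ⊆ (x j).1 := by
    intro i j hij
    rcases hc.2 _ (hxc i) _ (hxc j) with h | h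
    · exact h
    · rw [Finset.eq_of_subset_of_card_le h (by rw [hxcard, hxcard]; simpa using hij)]
  have hnew : ∀ i : Fin (d + 1), ∃ v ∈ (x i).1, ∀ j < i, v ∉ (x j).1 := by
    intro i
    by_cases hi : i.val = 0
    · obtain ⟨v, hv⟩ := nonempty_of_mem_faces (x i).2
      exact ⟨v, hv, fun j hj => absurd hj (by simp [Fin.lt_def, hi])⟩
    · have hlt : i.val - 1 < d + 1 := by omega
      obtain ⟨v, hv, hv'⟩ := Finset.exists_mem_notMem_of_card_lt_card
        (s := (x ⟨i.val - 1, hlt⟩).1) (t := (x i).1) (by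
          rw [hxcard, hxcard]
          dsimp only
          omega)
      refine ⟨v, hv, fun j hj h => hv' (hmono j _ ?_ h)⟩
      simp only [Fin.lt_def, Fin.le_def] at hj ⊢
      omega
  choose f hf hfn using hnew
  have hinj : Function.Injective f := by
    intro i j hij
    rcases lt_trichotomy i j with h | h | h
    · exact absurd (hij ▸ hf i) (hfn j i h)
    · exact h
    · exact absurd (hij ▸ hf j) (hfn i j h)
  have hsub : Finset.univ.map ⟨f, hinj⟩ ⊆ (x (Fin.last d)).1 := by
    intro v hv
    obtain ⟨i, -, rfl⟩ := Finset.mem_map.1 hv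
    exact hmono i _ (Fin.le_last i) (hf i)
  let F : OrdFacet K d := ⟨⟨f, hinj⟩, mem_faces_of_subset (x (Fin.last d)).2 hsub
    Finset.univ_nonempty.map⟩
  have hinit : ∀ i : Fin (d + 1), F.initial (i.val + 1) = (x i).1 := by
    intro i
    refine Finset.eq_of_subset_of_card_le (fun v hv => ?_) ?_
    · obtain ⟨j, hj, rfl⟩ := mem_initial.1 hv
      exact hmono j i (Fin.le_def.2 (by omega)) (hf j)
    · rw [hxcard, F.card_initial (by omega)]
  refine ⟨F, Finset.eq_of_subset_of_card_le (fun v hv => ?_) ?_⟩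
  · obtain ⟨i, rfl⟩ := mem_face.1 hv
    have : F.flag i = x i := Subtype.ext (hinit i)
    exact this ▸ hxc i
  · rw [hcard, card_face]

/-- A facet of the subdivision that contains a flag without its `k`-th member, `k < d`, is one
of two. -/
theorem eq_or_eq_of_wall_castSucc_subset (hK : K.DimLE d) (f : OrdFacet K d) (k : Fin d)
    {c : Finset K.sd.V} (hc : c ∈ K.sd.complex.faces) (hcard : c.card = d + 1)
    (h : f.flag.wall k.castSucc ⊆ c) :
    c = f.flag.face ∨ c = (f.perm (adjSwap k)).flag.face := by
  obtain ⟨g, rfl⟩ := hK.exists_flag hc hcard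
  have key : ∀ n ≤ d + 1, n ≠ k.val + 1 → f.initial n = g.initial n := by
    intro n hn hnk
    rcases n with _ | n
    · simp [initial]
    · have hn' : (⟨n, by omega⟩ : Fin (d + 1)) ≠ k.castSucc := fun h' =>
        hnk (congrArg (fun i => i.val + 1) h')
      exact flag_apply_mem_face.1 (h (apply_mem_wall.2 hn'))
  have hout : ∀ i : Fin (d + 1), i ≠ k.castSucc → i ≠ k.succ → f i = g i := by
    intro i h₁ h₂
    rw [Ne, Fin.ext_iff] at h₁ h₂
    simp only [Fin.val_castSucc, Fin.val_succ] at h₁ h₂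
    exact eq_of_initial_eq (key _ (by omega) (by omega)) (key _ (by omega) (by omega))
  have hin : ∀ i : Fin (d + 1), (i = k.castSucc ∨ i = k.succ) → g i = f k.castSucc ∨ g i = f k.succ := by
    intro i hi
    have h₁ : g i ∈ f.initial (k.val + 2) := by
      rw [key _ (by omega) (by omega), apply_mem_initial]
      rcases hi with rfl | rfl <;> simp
    have h₂ : g i ∉ f.initial k.val := by
      rw [key _ (by omega) (by omega), apply_mem_initial]
      rcases hi with rfl | rfl <;> simp
    obtain ⟨j, hj, hji⟩ := mem_initial.1 h₁
    rw [← hji, apply_mem_initial] at h₂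
    have : j = k.castSucc ∨ j = k.succ := by
      simp only [Fin.ext_iff, Fin.val_castSucc, Fin.val_succ]
      omega
    rcases this with rfl | rfl
    · exact Or.inl hji.symm
    · exact Or.inr hji.symm
  have hne : k.castSucc ≠ k.succ := (Fin.castSucc_lt_succ).ne
  rcases hin k.castSucc (Or.inl rfl) with h₁ | h₁
  · left
    have h₂ : g k.succ = f k.succ := by
      rcases hin k.succ (Or.inr rfl) with h₂ | h₂
      · exact absurd (g.inj (h₂.trans h₁.symm)).symm hne
      · exact h₂
    congr 2
    refine ext_apply fun i => ?_
    by_cases hi₁ : i = k.castSucc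
    · rw [hi₁, h₁]
    · by_cases hi₂ : i = k.succ
      · rw [hi₂, h₂]
      · exact (hout i hi₁ hi₂).symm
  · right
    have h₂ : g k.succ = f k.castSucc := by
      rcases hin k.succ (Or.inr rfl) with h₂ | h₂
      · exact h₂
      · exact absurd (g.inj (h₂.trans h₁.symm)).symm hne
    congr 2
    refine ext_apply fun i => ?_
    rw [perm_apply]
    by_cases hi₁ : i = k.castSucc
    · rw [hi₁, h₁, adjSwap, Equiv.swap_apply_left]
    · by_cases hi₂ : i = k.succ
      · rw [hi₂, h₂, adjSwap, Equiv.swap_apply_right]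
      · rw [adjSwap, Equiv.swap_apply_of_ne_of_ne hi₁ hi₂]
        exact (hout i hi₁ hi₂).symm

/-- A flag without its top member determines the first `d` vertices and leaves the last one free.
Such a wall lies on the boundary of the subdivided facet, so the number of facets around it depends
on `K`. -/
theorem exists_agree_of_wall_last_subset (hK : K.DimLE d) (f : OrdFacet K d)
    {c : Finset K.sd.V} (hc : c ∈ K.sd.complex.faces) (hcard : c.card = d + 1)
    (h : f.flag.wall (Fin.last d) ⊆ c) :
    ∃ g : OrdFacet K d, c = g.flag.face ∧ ∀ i, i ≠ Fin.last d → g i = f i := by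
  obtain ⟨g, rfl⟩ := hK.exists_flag hc hcard
  refine ⟨g, rfl, fun i hi => ?_⟩
  have key : ∀ n ≤ d, f.initial n = g.initial n := by
    intro n hn
    rcases n with _ | n
    · simp [initial]
    · have hn' : (⟨n, by omega⟩ : Fin (d + 1)) ≠ Fin.last d := fun h' => by
        have := congrArg Fin.val h'
        simp only [Fin.val_last] at this
        omega
      exact flag_apply_mem_face.1 (h (apply_mem_wall.2 hn'))
  rw [Ne, Fin.ext_iff, Fin.val_last] at hi
  exact (eq_of_initial_eq (key _ (by omega)) (key _ (by omega))).symm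

theorem flag_wall_castSucc_perm (f : OrdFacet K d) (k : Fin d) :
    (f.perm (adjSwap k)).flag.wall k.castSucc = f.flag.wall k.castSucc := by
  refine wall_eq_of_agree fun i hi => flag_apply_eq_iff.2 ⟨rfl, initial_perm_adjSwap f ?_⟩
  rw [Ne, Fin.ext_iff, Fin.val_castSucc] at hi
  omega

theorem flag_wall_last_eq {f g : OrdFacet K d} (h : ∀ i, i ≠ Fin.last d → f i = g i) :
    f.flag.wall (Fin.last d) = g.flag.wall (Fin.last d) := by
  refine wall_eq_of_agree fun i hi => flag_apply_eq_iff.2 ⟨rfl, initial_eq_of_agree ?_⟩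
  intro j hj
  refine h j fun hjl => ?_
  rw [Ne, Fin.ext_iff, Fin.val_last] at hi
  rw [hjl, Fin.val_last] at hj
  omega

theorem adjSwap_apply_of_ne {k : Fin d} {i : Fin (d + 1)} (h₁ : i ≠ k.castSucc) (h₂ : i ≠ k.succ) :
    adjSwap k i = i := Equiv.swap_apply_of_ne_of_ne h₁ h₂

theorem flag_perm_adjSwap_apply_ne (f : OrdFacet K d) (k : Fin d) :
    (f.perm (adjSwap k)).initial (k.val + 1) ≠ f.initial (k.val + 1) := by
  intro h
  have h₁ : f k.succ ∈ (f.perm (adjSwap k)).initial (k.val + 1) :=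
    mem_initial.2 ⟨k.castSucc, by simp, by simp [adjSwap]⟩
  rw [h, apply_mem_initial] at h₁
  simp at h₁

end FinSimplicialComplex

/-! ### Relations between adjacent transpositions -/

namespace FinSimplicialComplex

open OrdFacet Relation

theorem adjSwap_mul_self {d : ℕ} (k : Fin d) : adjSwap k * adjSwap k = 1 :=
  Equiv.swap_mul_self _ _

theorem adjSwap_castSucc {d : ℕ} (k : Fin d) : adjSwap k k.castSucc = k.succ :=
  Equiv.swap_apply_left _ _

theorem adjSwap_succ {d : ℕ} (k : Fin d) : adjSwap k k.succ = k.castSucc :=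
  Equiv.swap_apply_right _ _

theorem adjSwap_ne_one {d : ℕ} (k : Fin d) : adjSwap k ≠ 1 := fun h => by
  have := congrArg (fun e => (e k.castSucc).val) h
  simp [adjSwap_castSucc] at this

theorem adjSwap_comm {d : ℕ} {k l : Fin d} (h : k.val + 1 < l.val) :
    adjSwap k * adjSwap l = adjSwap l * adjSwap k := by
  refine Equiv.Perm.Disjoint.commute fun i => ?_
  by_cases hi : i.val ≤ k.val + 1
  · right
    refine adjSwap_apply_of_ne ?_ ?_ <;> rw [Ne, Fin.ext_iff] <;> simp <;> omega
  · left
    refine adjSwap_apply_of_ne ?_ ?_ <;> rw [Ne, Fin.ext_iff] <;> simp <;> omega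

theorem adjSwap_braid {d : ℕ} {k l : Fin d} (h : k.val + 1 = l.val) :
    adjSwap k * adjSwap l * adjSwap k = adjSwap l * adjSwap k * adjSwap l := by
  have hkl : k.succ = l.castSucc := Fin.ext (by simpa using h)
  have h₁ : k.castSucc ≠ l.castSucc := by rw [Ne, Fin.ext_iff]; simp; omega
  have h₂ : k.castSucc ≠ l.succ := by rw [Ne, Fin.ext_iff]; simp; omega
  have h₃ : l.castSucc ≠ l.succ := by rw [Ne, Fin.ext_iff]; simp
  unfold adjSwap
  rw [hkl, Equiv.swap_mul_swap_mul_swap h₁ h₂, Equiv.swap_comm k.castSucc l.castSucc,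
    Equiv.swap_comm l.castSucc l.succ, Equiv.swap_mul_swap_mul_swap h₃.symm h₂.symm,
    Equiv.swap_comm]

theorem perm_induction_adjSwap {d : ℕ} {P : Equiv.Perm (Fin (d + 1)) → Prop} (h1 : P 1)
    (hs : ∀ π k, P π → P (π * adjSwap k)) (π : Equiv.Perm (Fin (d + 1))) : P π := by
  have hπ : π ∈ Submonoid.closure (Set.range fun i : Fin d => Equiv.swap i.castSucc i.succ) := by
    rw [Equiv.Perm.mclosure_swap_castSucc_succ]
    trivial
  induction hπ using Submonoid.closure_induction_right with
  | one => exact h1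
  | mul_right x _ y hy hx =>
    obtain ⟨k, rfl⟩ := hy
    exact hs x k hx

variable {K : FinSimplicialComplex.{u}} {d : ℕ}

namespace OrdFacet

theorem exists_perm_eq {f g : OrdFacet K d} (h : f.face = g.face) : ∃ π, f.perm π = g := by
  have hex : ∀ i, ∃ j, f j = g i := fun i => mem_face.1 (h ▸ apply_mem_face g i)
  choose p hp using hex
  have hinj : Function.Injective p := fun i j hij => g.inj (by rw [← hp, ← hp, hij])
  exact ⟨Equiv.ofBijective p (Finite.injective_iff_bijective.1 hinj), ext_apply hp⟩

theorem perm_adjSwap_ne (f : OrdFacet K d) (k : Fin d) : f.perm (adjSwap k) ≠ f := fun h =>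
  flag_perm_adjSwap_apply_ne f k (by rw [h])

theorem perm_wall (f : OrdFacet K d) (π : Equiv.Perm (Fin (d + 1))) (k : Fin (d + 1)) :
    (f.perm π).wall k = f.wall (π k) := by
  refine Finset.eq_of_subset_of_card_le (fun v hv => ?_) (by rw [card_wall, card_wall])
  obtain ⟨i, hi, rfl⟩ := mem_wall.1 hv
  exact apply_mem_wall.2 fun h => hi (π.injective h)

/-- Replace the last vertex. -/
theorem exists_replace_last (f : OrdFacet K d) {σ : Finset K.V} (hσ : σ ∈ K.complex.faces)
    (hc : σ.card = d + 1) (h : f.wall (Fin.last d) ⊆ σ) :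
    ∃ g : OrdFacet K d, g.face = σ ∧ ∀ i, i ≠ Fin.last d → g i = f i := by
  obtain ⟨g, hg, hgf⟩ := exists_extend (s := Finset.univ.erase (Fin.last d)) (f := f) hσ hc
    f.toEmb.injective.injOn (fun i hi => h (apply_mem_wall.2 (Finset.ne_of_mem_erase hi)))
  exact ⟨g, hg, fun i hi => hgf i (by simpa using hi)⟩

end OrdFacet

/-! ### Traps and their barycentric subdivision -/

/-- Two members of `D` that contain a common member of `A`. -/
def Crosses {V : Type u} (D A : Set (Finset V)) (F F' : Finset V) : Prop :=
  F ∈ D ∧ F' ∈ D ∧ ∃ a ∈ A, a ⊆ F ∧ a ⊆ F'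

/-- A barrier `H` made of faces of codimension one that has no free faces, inside a region `D`
of facets that stays connected through the faces in `A` when the barrier is removed. -/
structure IsTrap (d : ℕ) (K : FinSimplicialComplex.{u}) (D H A : Set (Finset K.V)) : Prop where
  mem_D : ∀ F ∈ D, F ∈ K.complex.faces ∧ F.card = d + 1
  thin : ∀ h, h ∈ H ∨ h ∈ A → h.card = d ∧ ∃ F ∈ D, ∃ F' ∈ D, F ≠ F' ∧ h ⊆ F ∧ h ⊆ F' ∧
    ∀ G ∈ K.complex.faces, G.card = d + 1 → h ⊆ G → G = F ∨ G = F'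
  conn : ∀ F ∈ D, ∀ F' ∈ D, ReflTransGen (Crosses D A) F F'
  ridge : ∀ h ∈ H, ∀ r, r ⊆ h → r.card + 1 = d → ∃ h' ∈ H, h' ≠ h ∧ r ⊆ h'
  disj : ∀ h ∈ H, h ∉ A
  nonempty : H.Nonempty

theorem IsTrap.exists_other {D H A : Set (Finset K.V)} (hT : IsTrap d K D H A) {h : Finset K.V}
    (hh : h ∈ H ∨ h ∈ A) {F : Finset K.V} (hF : F ∈ D) (hhF : h ⊆ F) :
    ∃ F' ∈ D, F' ≠ F ∧ h ⊆ F' ∧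
      ∀ G ∈ K.complex.faces, G.card = d + 1 → h ⊆ G → G = F ∨ G = F' := by
  obtain ⟨-, F₁, hF₁, F₂, hF₂, hne, h₁, h₂, hG⟩ := hT.thin h hh
  rcases hG F (hT.mem_D F hF).1 (hT.mem_D F hF).2 hhF with rfl | rfl
  · exact ⟨F₂, hF₂, hne.symm, h₂, hG⟩
  · exact ⟨F₁, hF₁, hne, h₁, fun G hG₁ hG₂ hG₃ => (hG G hG₁ hG₂ hG₃).symm⟩

/-- The facets of the subdivision inside members of `D`. -/
def liftD (d : ℕ) (D : Set (Finset K.V)) : Set (Finset K.sd.V) :=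
  {c | ∃ g : OrdFacet K d, g.face ∈ D ∧ g.flag.face = c}

/-- The subdivision of a barrier. -/
def liftH (d : ℕ) (D H : Set (Finset K.V)) : Set (Finset K.sd.V) :=
  {c | ∃ g : OrdFacet K d, g.face ∈ D ∧ g.wall (Fin.last d) ∈ H ∧ g.flag.wall (Fin.last d) = c}

/-- The passages of the subdivision that avoid the barycenters of the members of `B`. -/
def liftA (d : ℕ) (D A B : Set (Finset K.V)) : Set (Finset K.sd.V) :=
  {c | (∃ (g : OrdFacet K d) (k : Fin d), g.face ∈ D ∧
      (g.wall (Fin.last d) ∉ B ∨ k.val + 1 = d) ∧ g.flag.wall k.castSucc = c) ∨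
    ∃ g : OrdFacet K d, g.face ∈ D ∧ g.wall (Fin.last d) ∈ A ∧ g.flag.wall (Fin.last d) = c}

section lift

variable {D H A B : Set (Finset K.V)}

theorem crosses_perm_adjSwap {g : OrdFacet K d} (hg : g.face ∈ D) {k : Fin d}
    (h : g.wall (Fin.last d) ∉ B ∨ k.val + 1 = d) :
    Crosses (liftD d D) (liftA d D A B) g.flag.face (g.perm (adjSwap k)).flag.face :=
  ⟨⟨g, hg, rfl⟩, ⟨_, by rwa [perm_face], rfl⟩, _, Or.inl ⟨g, k, hg, h, rfl⟩,
    wall_subset_face _ _, flag_wall_castSucc_perm g k ▸ wall_subset_face _ _⟩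

/-- The direct crossing is forbidden only if the wall contains the barycenter of a member of `B`.
Then one goes the other way round the ridge that also omits this barycenter: the relation between
the transpositions of positions `k` and `d - 1` (commutation or braid relation) replaces the direct
step by three or five others. -/
theorem reaches_perm_adjSwap (hB : ∀ F ∈ D, ∀ b ∈ B, ∀ b' ∈ B, b ⊆ F → b' ⊆ F → b = b')
    {g : OrdFacet K d} (hg : g.face ∈ D) (k : Fin d) :
    ReflTransGen (Crosses (liftD d D) (liftA d D A B))
      g.flag.face (g.perm (adjSwap k)).flag.face := by
  by_cases h : g.wall (Fin.last d) ∉ B ∨ k.val + 1 = d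
  · exact ReflTransGen.single (crosses_perm_adjSwap hg h)
  · push Not at h
    obtain ⟨hgB, hkd⟩ := h
    -- Once the last vertex has been exchanged, the first `d` vertices span a different wall of the
    -- same facet, which is not in `B` because a facet contains at most one member of `B`.
    have good : ∀ π : Equiv.Perm (Fin (d + 1)), π (Fin.last d) ≠ Fin.last d →
        (g.perm π).wall (Fin.last d) ∉ B := by
      intro π hπ hmem
      rw [perm_wall] at hmem
      exact hπ (wall_injective g (hB _ hg _ hmem _ hgB (wall_subset_face _ _)
        (wall_subset_face _ _)))
    have step : ∀ (π : Equiv.Perm (Fin (d + 1))) (l : Fin d),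
        (π (Fin.last d) ≠ Fin.last d ∨ l.val + 1 = d) →
        Crosses (liftD d D) (liftA d D A B) (g.perm π).flag.face
          (g.perm (π * adjSwap l)).flag.face := fun π l hl =>
      crosses_perm_adjSwap (by rwa [perm_face]) (hl.imp_left (good π))
    have hlt : d - 1 < d := by omega
    set m : Fin d := ⟨d - 1, hlt⟩ with hm
    have hmd : m.val + 1 = d := by simp [hm]; omega
    have hmlast : m.succ = Fin.last d := Fin.ext (by simp [hmd])
    have hsm : adjSwap m (Fin.last d) = m.castSucc := by rw [← hmlast, adjSwap_succ]
    have hmne : m.castSucc ≠ Fin.last d := Fin.castSucc_lt_last m |>.ne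
    have hsk : adjSwap k (Fin.last d) = Fin.last d := by
      refine adjSwap_apply_of_ne ?_ ?_ <;> rw [Ne, Fin.ext_iff] <;> simp <;> omega
    have h1 := step 1 m (Or.inr hmd)
    have h2 := step (1 * adjSwap m) k (Or.inl (by simp [hsm]))
    have h3 := step (1 * adjSwap m * adjSwap k) m (Or.inr hmd)
    by_cases hk2 : k.val + 1 < m.val
    · have : (1 * adjSwap m * adjSwap k * adjSwap m : Equiv.Perm (Fin (d + 1))) = adjSwap k := by
        rw [one_mul, ← adjSwap_comm hk2, mul_assoc, adjSwap_mul_self, mul_one]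
      rw [this] at h3
      exact ((ReflTransGen.single h1).tail h2).tail h3
    · have hk1 : k.val + 1 = m.val := by omega
      have hkm : k.succ = m.castSucc := Fin.ext (by simpa using hk1)
      have h4 := step (1 * adjSwap m * adjSwap k * adjSwap m) k (Or.inl (by
        simp only [one_mul, Equiv.Perm.mul_apply, hsm]
        rw [← hkm, adjSwap_succ, adjSwap_apply_of_ne]
        · exact (Fin.castSucc_lt_last k).ne
        · rw [Ne, Fin.ext_iff]; simp; omega
        · rw [Ne, Fin.ext_iff]; simp; omega))
      have h5 := step (1 * adjSwap m * adjSwap k * adjSwap m * adjSwap k) m (Or.inr hmd)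
      have : (1 * adjSwap m * adjSwap k * adjSwap m * adjSwap k * adjSwap m :
          Equiv.Perm (Fin (d + 1))) = adjSwap k := by
        rw [one_mul, ← adjSwap_braid hk1, mul_assoc (adjSwap k * adjSwap m), adjSwap_mul_self,
          mul_one, mul_assoc, adjSwap_mul_self, mul_one]
      rw [this] at h5
      exact ((((ReflTransGen.single h1).tail h2).tail h3).tail h4).tail h5

theorem reaches_perm (hB : ∀ F ∈ D, ∀ b ∈ B, ∀ b' ∈ B, b ⊆ F → b' ⊆ F → b = b')
    {g : OrdFacet K d} (hg : g.face ∈ D) (π : Equiv.Perm (Fin (d + 1))) :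
    ReflTransGen (Crosses (liftD d D) (liftA d D A B)) g.flag.face (g.perm π).flag.face := by
  induction π using perm_induction_adjSwap with
  | h1 => exact ReflTransGen.refl
  | hs π k ih => exact ih.trans (reaches_perm_adjSwap hB (by rwa [perm_face]) k)

/-- A path in `D` through `A` lifts step by step: inside a facet all orderings are connected, and a
member of `A` is crossed by an ordering that lists its vertices first and exchanges only the last
vertex. -/
theorem IsTrap.lift_conn (hT : IsTrap d K D H A)
    (hB : ∀ F ∈ D, ∀ b ∈ B, ∀ b' ∈ B, b ⊆ F → b' ⊆ F → b = b') {g g' : OrdFacet K d}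
    (hg : g.face ∈ D) (hg' : g'.face ∈ D) :
    ReflTransGen (Crosses (liftD d D) (liftA d D A B)) g.flag.face g'.flag.face := by
  have key : ∀ F, ReflTransGen (Crosses D A) g.face F → ∀ g' : OrdFacet K d, g'.face = F →
      ReflTransGen (Crosses (liftD d D) (liftA d D A B)) g.flag.face g'.flag.face := by
    intro F hF
    induction hF with
    | refl =>
      intro g' hg'
      obtain ⟨π, rfl⟩ := exists_perm_eq hg'.symm
      exact reaches_perm hB hg π
    | @tail F₁ F₂ _ hcross ih =>
      intro g' hg'
      obtain ⟨h₁, h₂, a, ha, ha₁, ha₂⟩ := hcross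
      obtain ⟨g₁, hg₁, hw⟩ := exists_wall_last_eq (hT.mem_D _ h₁).1 (hT.mem_D _ h₁).2 ha₁
        (hT.thin a (Or.inr ha)).1
      obtain ⟨g₂, hg₂, hagree⟩ := g₁.exists_replace_last (hT.mem_D _ h₂).1 (hT.mem_D _ h₂).2
        (hw ▸ ha₂)
      have hc : Crosses (liftD d D) (liftA d D A B) g₁.flag.face g₂.flag.face :=
        ⟨⟨g₁, hg₁ ▸ h₁, rfl⟩, ⟨g₂, hg₂ ▸ h₂, rfl⟩, g₁.flag.wall (Fin.last d),
          Or.inr ⟨g₁, hg₁ ▸ h₁, hw ▸ ha, rfl⟩, wall_subset_face _ _,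
          flag_wall_last_eq hagree ▸ wall_subset_face _ _⟩
      obtain ⟨π, rfl⟩ := exists_perm_eq (hg₂.trans hg'.symm)
      exact ((ih g₁ hg₁).tail hc).trans (reaches_perm hB (hg₂ ▸ h₂) π)
  exact key _ (hT.conn _ hg _ hg') g' rfl

theorem IsTrap.lift_thin_last (hT : IsTrap d K D H A) (hK : K.DimLE d) {g : OrdFacet K d}
    (hg : g.face ∈ D) (hw : g.wall (Fin.last d) ∈ H ∨ g.wall (Fin.last d) ∈ A) :
    ∃ g' : OrdFacet K d, g'.face ∈ D ∧ g ≠ g' ∧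
      g.flag.wall (Fin.last d) = g'.flag.wall (Fin.last d) ∧
      ∀ c ∈ K.sd.complex.faces, c.card = d + 1 → g.flag.wall (Fin.last d) ⊆ c →
        c = g.flag.face ∨ c = g'.flag.face := by
  obtain ⟨F', hF', hne, hsub, hG⟩ := hT.exists_other hw hg (wall_subset_face _ _)
  obtain ⟨g', hg', hagree⟩ := g.exists_replace_last (hT.mem_D _ hF').1 (hT.mem_D _ hF').2 hsub
  refine ⟨g', hg' ▸ hF', fun h => hne (by rw [← hg', h]),
    (flag_wall_last_eq hagree).symm, fun c hc hcard hcs => ?_⟩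
  obtain ⟨g'', rfl, hagree'⟩ := exists_agree_of_wall_last_subset hK g hc hcard hcs
  have hsub' : g.wall (Fin.last d) ⊆ g''.face :=
    wall_eq_of_agree hagree' ▸ wall_subset_face _ _
  rcases hG _ g''.face_mem g''.card_face hsub' with h | h
  · exact Or.inl (by rw [eq_of_agree_of_face_eq hagree' h])
  · exact Or.inr (by
      rw [eq_of_agree_of_face_eq (fun i hi => (hagree' i hi).trans (hagree i hi).symm)
        (h.trans hg'.symm)])

/-- The ridge omits one further flag member. If that is the barycenter of the old wall, the ridge
lies over an old ridge, and another member of `H` through it comes from the old trap. Otherwise an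
exchange of two vertices within the old wall gives another piece of the same subdivided wall. -/
theorem IsTrap.lift_ridge (hT : IsTrap d K D H A) {g : OrdFacet K d} (hg : g.face ∈ D)
    (hw : g.wall (Fin.last d) ∈ H) {r : Finset K.sd.V} (hr : r ⊆ g.flag.wall (Fin.last d))
    (hc : r.card + 1 = d) : ∃ h' ∈ liftH d D H, h' ≠ g.flag.wall (Fin.last d) ∧ r ⊆ h' := by
  obtain ⟨l, hl, hmem⟩ := exists_ne_of_subset_wall hr hc
  obtain ⟨k, rfl⟩ := Fin.exists_castSucc_eq.2 hl
  by_cases hk : k.val + 1 = d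
  · have hr₀ : (g.initial k.val) ⊆ g.wall (Fin.last d) := by
      rw [wall_last]
      exact g.initial_mono (by omega)
    obtain ⟨h₂, hh₂, hne, hsub⟩ := hT.ridge _ hw _ hr₀ (by rw [card_initial _ (by omega)]; exact hk)
    obtain ⟨hcard, F₂, hF₂, -, -, -, hhF, -⟩ := hT.thin h₂ (Or.inl hh₂)
    obtain ⟨hF₂f, hF₂c⟩ := hT.mem_D _ hF₂
    obtain ⟨v, hv, hvh⟩ := Finset.exists_mem_notMem_of_card_lt_card (s := h₂) (t := F₂) (by omega)
    -- Order `F₂` so that the vertices of the old ridge keep their places and the vertex outside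
    -- `h₂` comes last; then the first `d` vertices span `h₂`.
    obtain ⟨g₂, hg₂, hext⟩ := exists_extend (d := d)
      (s := Finset.univ.filter fun i => i.val < k.val ∨ i = Fin.last d)
      (f := fun i => if i = Fin.last d then v else g i) hF₂f hF₂c
      (by
        intro i hi j hj hij
        simp only [Finset.coe_filter, Finset.mem_univ, true_and, Set.mem_ofPred_eq] at hi hj
        dsimp only at hij
        split_ifs at hij with h₁ h₂ h₂
        · rw [h₁, h₂]
        · exact absurd (hsub (apply_mem_initial.2 (hj.resolve_right h₂))) (hij ▸ hvh)
        · exact absurd (hsub (apply_mem_initial.2 (hi.resolve_right h₁))) (hij ▸ hvh)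
        · exact g.inj hij)
      (by
        intro i hi
        simp only [Finset.mem_filter, Finset.mem_univ, true_and] at hi
        split_ifs with h₁
        · exact hv
        · exact hhF (hsub (apply_mem_initial.2 (hi.resolve_right h₁))))
    have hlast : g₂ (Fin.last d) = v := by
      rw [hext _ (by simp), if_pos rfl]
    have hagree : ∀ i : Fin (d + 1), i.val < k.val → g i = g₂ i := by
      intro i hi
      rw [hext i (by simp [hi]), if_neg]
      rw [Fin.ext_iff, Fin.val_last]
      omega
    have hw₂ : g₂.wall (Fin.last d) = h₂ := by
      refine (Finset.eq_of_subset_of_card_le (fun w hw' => ?_) (by rw [card_wall, hcard])).symm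
      obtain ⟨i, rfl⟩ := mem_face.1 (hg₂ ▸ hhF hw')
      refine apply_mem_wall.2 fun hi => hvh ?_
      rwa [hi, hlast] at hw'
    refine ⟨_, ⟨g₂, hg₂ ▸ hF₂, hw₂ ▸ hh₂, rfl⟩, fun heq => hne ?_, fun w hw' => ?_⟩
    · have hkl : k.castSucc ≠ Fin.last d := hl
      have h₁ : g₂.flag k.castSucc ∈ g.flag.face :=
        wall_subset_face _ _ (heq ▸ apply_mem_wall.2 hkl)
      rw [flag_apply_mem_face, Fin.val_castSucc, hk, ← wall_last, ← wall_last, hw₂] at h₁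
      exact h₁
    · obtain ⟨i, hi₁, hi₂, rfl⟩ := (hmem w).1 hw'
      refine mem_wall.2 ⟨i, hi₁, (flag_apply_eq_iff.2 ⟨rfl, initial_eq_of_agree fun j hj => ?_⟩).symm⟩
      refine hagree j ?_
      rw [Ne, Fin.ext_iff] at hi₁ hi₂
      simp only [Fin.val_last, Fin.val_castSucc] at hi₁ hi₂
      omega
  · have hsk : adjSwap k (Fin.last d) = Fin.last d := by
      refine adjSwap_apply_of_ne ?_ ?_ <;> rw [Ne, Fin.ext_iff] <;> simp <;> omega
    refine ⟨_, ⟨g.perm (adjSwap k), by rwa [perm_face], by rwa [perm_wall, hsk], rfl⟩,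
      fun heq => ?_, fun w hw' => ?_⟩
    · have h₁ : (g.perm (adjSwap k)).flag k.castSucc ∈ g.flag.face :=
        wall_subset_face _ _ (heq ▸ apply_mem_wall.2 hl)
      exact flag_perm_adjSwap_apply_ne g k (flag_apply_mem_face.1 h₁)
    · obtain ⟨i, hi₁, hi₂, rfl⟩ := (hmem w).1 hw'
      refine mem_wall.2 ⟨i, hi₁, flag_apply_eq_iff.2 ⟨rfl, initial_perm_adjSwap g ?_⟩⟩
      rw [Ne, Fin.ext_iff] at hi₂
      simpa using hi₂

/-- In a wall of a flag that is omitted at the end, the only missing cardinality is `d + 1`. -/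
theorem wall_last_ne_wall_castSucc (g g' : OrdFacet K d) (k : Fin d) :
    g.flag.wall (Fin.last d) ≠ g'.flag.wall k.castSucc := fun h => by
  have h₁ : g'.flag (Fin.last d) ∈ g.flag.wall (Fin.last d) :=
    h ▸ apply_mem_wall.2 (Fin.castSucc_lt_last k).ne'
  obtain ⟨i, hi, hi'⟩ := mem_wall.1 h₁
  exact hi (flag_apply_eq_iff.1 hi').1

theorem wall_last_eq_of_flag_wall_last_eq {g g' : OrdFacet K d} (hd : d ≠ 0)
    (h : g.flag.wall (Fin.last d) = g'.flag.wall (Fin.last d)) :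
    g.wall (Fin.last d) = g'.wall (Fin.last d) := by
  have hlt : d - 1 < d := by omega
  have hne : (⟨d - 1, by omega⟩ : Fin (d + 1)) ≠ Fin.last d := by
    rw [Ne, Fin.ext_iff, Fin.val_last]
    dsimp only
    omega
  have h₁ := flag_apply_mem_face.1
    (wall_subset_face _ _ (h ▸ apply_mem_wall.2 hne : g.flag _ ∈ g'.flag.wall (Fin.last d)))
  dsimp only at h₁
  rw [Nat.sub_add_cancel (by omega)] at h₁
  rw [wall_last, wall_last, h₁]

/-- The set `B` lists faces whose barycenters the new passages avoid. With `B = ∅` nothing is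
excluded. Taking for `B` an already subdivided barrier separates passages and barrier by their
vertices; the hypothesis `hB` then comes from `liftH_unique`, which is why two subdivisions are
used. -/
theorem IsTrap.lift (hT : IsTrap d K D H A) (hK : K.DimLE d) (hd : d ≠ 0)
    (hB : ∀ F ∈ D, ∀ b ∈ B, ∀ b' ∈ B, b ⊆ F → b' ⊆ F → b = b') :
    IsTrap d K.sd (liftD d D) (liftH d D H) (liftA d D A B) where
  mem_D := by
    rintro _ ⟨g, -, rfl⟩
    exact ⟨g.flag.face_mem, g.flag.card_face⟩
  thin := by
    rintro _ (⟨g, hg, hw, rfl⟩ | ⟨g, k, hg, -, rfl⟩ | ⟨g, hg, hw, rfl⟩)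
    · obtain ⟨g', hg', hne, hwall, hc⟩ := hT.lift_thin_last hK hg (Or.inl hw)
      exact ⟨card_wall _ _, _, ⟨g, hg, rfl⟩, _, ⟨g', hg', rfl⟩, fun h => hne (flag_injective h),
        wall_subset_face _ _, hwall ▸ wall_subset_face _ _, hc⟩
    · exact ⟨card_wall _ _, _, ⟨g, hg, rfl⟩, _, ⟨g.perm (adjSwap k), by rwa [perm_face], rfl⟩,
        fun h => perm_adjSwap_ne g k (flag_injective h).symm, wall_subset_face _ _,
        flag_wall_castSucc_perm g k ▸ wall_subset_face _ _,
        fun c hc hcard hs => eq_or_eq_of_wall_castSucc_subset hK g k hc hcard hs⟩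
    · obtain ⟨g', hg', hne, hwall, hc⟩ := hT.lift_thin_last hK hg (Or.inr hw)
      exact ⟨card_wall _ _, _, ⟨g, hg, rfl⟩, _, ⟨g', hg', rfl⟩, fun h => hne (flag_injective h),
        wall_subset_face _ _, hwall ▸ wall_subset_face _ _, hc⟩
  conn := by
    rintro _ ⟨g, hg, rfl⟩ _ ⟨g', hg', rfl⟩
    exact hT.lift_conn hB hg hg'
  ridge := by
    rintro _ ⟨g, hg, hw, rfl⟩ r hr hc
    exact hT.lift_ridge hg hw hr hc
  disj := by
    rintro _ ⟨g, hg, hw, rfl⟩ (⟨g', k, hg', -, h⟩ | ⟨g', hg', hw', h⟩)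
    · exact wall_last_ne_wall_castSucc g g' k h.symm
    · exact hT.disj _ hw (wall_last_eq_of_flag_wall_last_eq hd h ▸ hw')
  nonempty := by
    obtain ⟨h, hh⟩ := hT.nonempty
    obtain ⟨hcard, F, hF, -, -, -, hhF, -⟩ := hT.thin h (Or.inl hh)
    obtain ⟨g, hg, hw⟩ := exists_wall_last_eq (hT.mem_D _ hF).1 (hT.mem_D _ hF).2 hhF hcard
    exact ⟨_, g, hg ▸ hF, hw ▸ hh, rfl⟩

/-- A facet of the subdivision contains at most one member of a subdivided barrier. -/
theorem liftH_unique {F : Finset K.sd.V} (hF : F ∈ liftD d D) {b b' : Finset K.sd.V}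
    (hb : b ∈ liftH d D H) (hb' : b' ∈ liftH d D H) (hbF : b ⊆ F) (hbF' : b' ⊆ F) : b = b' := by
  obtain ⟨g, -, rfl⟩ := hF
  have key : ∀ b ∈ liftH d D H, b ⊆ g.flag.face → b = g.flag.wall (Fin.last d) := by
    rintro _ ⟨g', -, -, rfl⟩ hsub
    refine Finset.eq_of_subset_of_card_le (fun v hv => ?_) (by rw [card_wall, card_wall])
    obtain ⟨i, rfl⟩ := mem_face.1 (hsub hv)
    obtain ⟨j, hj, hij⟩ := mem_wall.1 hv
    exact apply_mem_wall.2 ((flag_apply_eq_iff.1 hij).1 ▸ hj)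
  rw [key b hb hbF, key b' hb' hbF']

end lift

end FinSimplicialComplex

/-! ### Chambers of the second subdivision of a simplex, their colours and the barrier -/

namespace FinSimplicialComplex

open OrdFacet Relation

/-- The position of a value in a permutation. -/
def posn {d : ℕ} (σ : Equiv.Perm (Fin (d + 1))) (x : Fin (d + 1)) : ℕ := (σ⁻¹ x).val

section posn

variable {d : ℕ}

theorem posn_eq_iff {σ : Equiv.Perm (Fin (d + 1))} {x i : Fin (d + 1)} :
    posn σ x = i.val ↔ σ i = x := by
  rw [posn, ← Fin.ext_iff, Equiv.Perm.inv_eq_iff_eq, eq_comm]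

theorem posn_le (σ : Equiv.Perm (Fin (d + 1))) (x : Fin (d + 1)) : posn σ x ≤ d := by
  have := (σ⁻¹ x).2
  unfold posn
  omega

theorem adjSwap_val (k : Fin d) (i : Fin (d + 1)) :
    (adjSwap k i).val = if i.val = k.val then k.val + 1 else
      if i.val = k.val + 1 then k.val else i.val := by
  rw [adjSwap, Equiv.swap_apply_def]
  simp only [Fin.ext_iff, Fin.val_castSucc, Fin.val_succ]
  split_ifs <;> simp

theorem adjSwap_inv (k : Fin d) : (adjSwap k)⁻¹ = adjSwap k := Equiv.swap_inv _ _

theorem posn_mul_adjSwap (σ : Equiv.Perm (Fin (d + 1))) (k : Fin d) (x : Fin (d + 1)) :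
    posn (σ * adjSwap k) x = if posn σ x = k.val then k.val + 1 else
      if posn σ x = k.val + 1 then k.val else posn σ x := by
  unfold posn
  rw [mul_inv_rev, adjSwap_inv, Equiv.Perm.mul_apply, adjSwap_val]

theorem sign_mul_adjSwap (σ : Equiv.Perm (Fin (d + 1))) (k : Fin d) :
    Equiv.Perm.sign (σ * adjSwap k) = - Equiv.Perm.sign σ := by
  rw [map_mul, adjSwap, Equiv.Perm.sign_swap (Fin.castSucc_lt_succ).ne, mul_neg_one]

theorem mul_adjSwap_mul_adjSwap (σ : Equiv.Perm (Fin (d + 1))) (k : Fin d) :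
    σ * adjSwap k * adjSwap k = σ := by
  rw [mul_assoc, adjSwap_mul_self, mul_one]

end posn

/-- A function on the dihedral cycle through `σ` generated by two adjacent transpositions that
changes along one edge changes along another one. -/
theorem exists_change {d : ℕ} {α : Type*} (col : Equiv.Perm (Fin (d + 1)) → α)
    (σ : Equiv.Perm (Fin (d + 1))) {k l : Fin d} (hkl : k ≠ l)
    (h : col σ ≠ col (σ * adjSwap k)) :
    ∃ (g : Equiv.Perm (Fin (d + 1))) (t : Fin d),
      (∀ n, n ≠ k.val + 1 → n ≠ l.val + 1 → ∀ i, (g i).val < n ↔ i.val < n) ∧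
      col (σ * g) ≠ col (σ * g * adjSwap t) ∧
      (t = l ∨ t = k ∧ ∃ i : Fin (d + 1), i.val < l.val + 1 ∧ ¬ (g i).val < l.val + 1) := by
  by_contra hex
  have hcon : ∀ (g : Equiv.Perm (Fin (d + 1))) (t : Fin d),
      (∀ n, n ≠ k.val + 1 → n ≠ l.val + 1 → ∀ i, (g i).val < n ↔ i.val < n) →
      (t = l ∨ t = k ∧ ∃ i : Fin (d + 1), i.val < l.val + 1 ∧ ¬ (g i).val < l.val + 1) →
      col (σ * g) = col (σ * g * adjSwap t) := fun g t hg ht => by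
    by_contra hne
    exact hex ⟨g, t, hg, hne, ht⟩
  have pk : ∀ g : Equiv.Perm (Fin (d + 1)), (∀ n, n ≠ k.val + 1 → n ≠ l.val + 1 → ∀ i, (g i).val < n ↔ i.val < n) →
      ∀ n, n ≠ k.val + 1 → n ≠ l.val + 1 → ∀ i, ((g * adjSwap k) i).val < n ↔ i.val < n :=
    fun g hg n h₁ h₂ i => (hg n h₁ h₂ _).trans (adjSwap_lt_iff h₁ i)
  have pl : ∀ g : Equiv.Perm (Fin (d + 1)), (∀ n, n ≠ k.val + 1 → n ≠ l.val + 1 → ∀ i, (g i).val < n ↔ i.val < n) →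
      ∀ n, n ≠ k.val + 1 → n ≠ l.val + 1 → ∀ i, ((g * adjSwap l) i).val < n ↔ i.val < n :=
    fun g hg n h₁ h₂ i => (hg n h₁ h₂ _).trans (adjSwap_lt_iff h₂ i)
  have p0 : ∀ n, n ≠ k.val + 1 → n ≠ l.val + 1 → ∀ i, ((1 : Equiv.Perm (Fin (d + 1))) i).val < n ↔ i.val < n :=
    fun _ _ _ _ => Iff.rfl
  have p1 := pl _ p0
  have p2 := pk _ p1
  have p3 := pl _ p2
  have p4 := pk _ p3
  -- Suppose that the colour changes along no other edge of the cycle. Then it is constant along the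
  -- long way round from `σ` to `σ * adjSwap k`, whose three or five edges are `c1`, ..., `c5`,
  -- contrary to `h`.
  have c1 := hcon 1 l p0 (Or.inl rfl)
  have c2 := hcon _ k p1 (Or.inr ⟨rfl, l.castSucc, by simp, by simp [adjSwap_val]⟩)
  have c3 := hcon _ l p2 (Or.inl rfl)
  rw [mul_one] at c1
  rw [one_mul] at c2 c3
  rw [← mul_assoc] at c3
  have hc : col σ = col (σ * adjSwap l * adjSwap k * adjSwap l) := c1.trans (c2.trans c3)
  by_cases hfar : k.val + 1 < l.val ∨ l.val + 1 < k.val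
  · have hcomm : adjSwap l * adjSwap k = adjSwap k * adjSwap l := by
      rcases hfar with hf | hf
      · exact (adjSwap_comm hf).symm
      · exact adjSwap_comm hf
    rw [mul_assoc σ, hcomm, ← mul_assoc, mul_adjSwap_mul_adjSwap] at hc
    exact h hc
  · have hne : k.val ≠ l.val := fun h' => hkl (Fin.ext h')
    have hbr : adjSwap l * adjSwap k * adjSwap l = adjSwap k * adjSwap l * adjSwap k := by
      rcases Nat.lt_or_gt_of_ne hne with hf | hf
      · exact (adjSwap_braid (by omega)).symm
      · exact adjSwap_braid (by omega)
    have c4 := hcon _ k p3 (Or.inr ⟨rfl, by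
      rcases Nat.lt_or_gt_of_ne hne with hf | hf
      · refine ⟨k.castSucc, by simp; omega, ?_⟩
        simp only [one_mul, Equiv.Perm.mul_apply, adjSwap_val, Fin.val_castSucc]
        split_ifs <;> omega
      · refine ⟨l.castSucc, by simp, ?_⟩
        simp only [one_mul, Equiv.Perm.mul_apply, adjSwap_val, Fin.val_castSucc]
        split_ifs <;> omega⟩)
    have c5 := hcon _ l p4 (Or.inl rfl)
    rw [one_mul] at c4 c5
    simp only [← mul_assoc] at c4 c5
    refine h (hc.trans (c4.trans (c5.trans ?_)))
    congr 1
    calc σ * adjSwap l * adjSwap k * adjSwap l * adjSwap k * adjSwap l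
        = σ * (adjSwap l * adjSwap k * adjSwap l) * adjSwap k * adjSwap l := by
          simp only [mul_assoc]
      _ = σ * adjSwap k := by
          rw [hbr, ← mul_assoc, ← mul_assoc, mul_adjSwap_mul_adjSwap, mul_adjSwap_mul_adjSwap]

section coloring

variable (d : ℕ)

/-- The pairs of permutations that index the facets of the second subdivision of a simplex. -/
abbrev Chamber : Type := Equiv.Perm (Fin (d + 1)) × Equiv.Perm (Fin (d + 1))

variable {d}

/-- The colour of the chambers around the barycenter. -/
def coreColor (π : Equiv.Perm (Fin (d + 1))) : ℕ :=
  if posn π 0 = 0 then 1 else if posn π 0 = d then 2 else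
    if Equiv.Perm.sign π * (-1) ^ posn π 0 = 1 then 1 else 2

/-- The colour of the chambers in the first layer around the core. -/
def tileColor (d h a : ℕ) : ℕ :=
  if h ≤ a then (if a = 0 then 1 else 2) else if a + 1 = d then 2 else 1

/-- The colour of the chambers away from the core. -/
def outerColor (d h : ℕ) : ℕ := if h = 0 then 1 else if h = d then 2 else 0

/-- The colour of a chamber. -/
def color (P : Chamber d) : ℕ :=
  if posn P.2 (Fin.last d) = 0 then coreColor P.1 else
    if posn P.2 (Fin.last d) = 1 then tileColor d (posn P.1 0) (P.2 0).val else
      outerColor d (posn P.1 0)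

/-- Whether two adjacent chambers are separated by the barrier. -/
def Barrier (P P' : Chamber d) : Prop :=
  color P ≠ color P' ∧ (P.1 = P'.1 ∨ posn P.2 (Fin.last d) = 0 ∧ posn P'.2 (Fin.last d) = 0)

theorem Barrier.symm {P P' : Chamber d} (h : Barrier P P') : Barrier P' P :=
  ⟨h.1.symm, h.2.imp Eq.symm And.symm⟩

/-- `ChamberAdj P k P'`: the chambers `P` and `P'` share their `k`-th wall. -/
inductive ChamberAdj : Chamber d → Fin (d + 1) → Chamber d → Prop
  | inner (π ρ : Equiv.Perm (Fin (d + 1))) (k : Fin d) :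
      ChamberAdj (π, ρ) k.castSucc (π, ρ * adjSwap k)
  | outer (π ρ : Equiv.Perm (Fin (d + 1))) (i : Fin d) (h : ρ (Fin.last d) = i.castSucc) :
      ChamberAdj (π, ρ) (Fin.last d) (π * adjSwap i, ρ)

theorem ChamberAdj.symm {P P' : Chamber d} {k : Fin (d + 1)} (h : ChamberAdj P k P') :
    ChamberAdj P' k P := by
  cases h with
  | inner π ρ k =>
    have := ChamberAdj.inner π (ρ * adjSwap k) k
    rwa [mul_adjSwap_mul_adjSwap] at this
  | outer π ρ i h =>
    have := ChamberAdj.outer (π * adjSwap i) ρ i h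
    rwa [mul_adjSwap_mul_adjSwap] at this

theorem ChamberAdj.ne {P P' : Chamber d} {k : Fin (d + 1)} (h : ChamberAdj P k P') : P ≠ P' := by
  cases h with
  | inner π ρ k => exact fun h => adjSwap_ne_one k (by simpa using congrArg Prod.snd h)
  | outer π ρ i h => exact fun h => adjSwap_ne_one i (by simpa using congrArg Prod.fst h)

theorem coreColor_eq_one_or (π : Equiv.Perm (Fin (d + 1))) : coreColor π = 1 ∨ coreColor π = 2 := by
  unfold coreColor
  split_ifs <;> simp

theorem tileColor_eq_one_or (h a : ℕ) : tileColor d h a = 1 ∨ tileColor d h a = 2 := by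
  unfold tileColor
  split_ifs <;> simp

theorem tileColor_mul_adjSwap (π : Equiv.Perm (Fin (d + 1))) {i : Fin d} {a : ℕ} (ha : a ≠ i.val) :
    tileColor d (posn (π * adjSwap i) 0) a = tileColor d (posn π 0) a := by
  have : posn (π * adjSwap i) 0 ≤ a ↔ posn π 0 ≤ a := by
    rw [posn_mul_adjSwap]
    split_ifs <;> omega
  simp only [tileColor, this]

/-- This dictates the choice of `tileColor`. A tile at a face of positive dimension that contains
vertex 0 meets the outside at `h = 0`, of colour 1, so it gets colour 2; a tile at a face of
codimension at least two that avoids vertex 0 meets the outside at `h = d`, of colour 2, so it gets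
colour 1. Only two doors stay open, and the condition on the right is not affected by exchanges at
positions `i ≠ a`, which keep the tile. -/
theorem tileColor_eq_outerColor_iff {h a : ℕ} (ha : a < d) (hh : h ≤ d) :
    tileColor d h a = outerColor d h ↔ a = 0 ∧ h = 0 ∨ a + 1 = d ∧ h = d := by
  unfold tileColor outerColor
  grind

theorem val_ne_of_apply_last {ρ : Equiv.Perm (Fin (d + 1))} {i : Fin d}
    (h : ρ (Fin.last d) = i.castSucc) : (ρ 0).val ≠ i.val := by
  intro h'
  have : ρ 0 = ρ (Fin.last d) := by
    rw [h]
    exact Fin.ext h'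
  have := congrArg Fin.val (ρ.injective this)
  simp at this
  omega

theorem val_lt_of_posn_ne {ρ : Equiv.Perm (Fin (d + 1))} (h : posn ρ (Fin.last d) ≠ 0) :
    (ρ 0).val < d := by
  by_contra h'
  refine h ?_
  have : ρ 0 = Fin.last d := Fin.ext (by rw [Fin.val_last]; omega)
  exact posn_eq_iff.2 this

theorem apply_zero_mul_adjSwap {ρ : Equiv.Perm (Fin (d + 1))} {k : Fin d} (hk : k.val ≠ 0) :
    (ρ * adjSwap k) 0 = ρ 0 := by
  rw [Equiv.Perm.mul_apply, adjSwap_apply_of_ne]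
  · rw [Ne, Fin.ext_iff]; simpa using Ne.symm hk
  · rw [Ne, Fin.ext_iff]; simp

theorem apply_last_mul_adjSwap {ρ : Equiv.Perm (Fin (d + 1))} {k : Fin d} (hk : k.val + 1 < d) :
    (ρ * adjSwap k) (Fin.last d) = ρ (Fin.last d) := by
  rw [Equiv.Perm.mul_apply, adjSwap_apply_of_ne] <;> rw [Ne, Fin.ext_iff] <;> simp <;> omega

/-- The colours of the two chambers at a wall `k < d` can differ only in the following two ways. -/
theorem color_mul_adjSwap_ne {π ρ : Equiv.Perm (Fin (d + 1))} {k : Fin d}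
    (h : color (π, ρ) ≠ color (π, ρ * adjSwap k)) :
    (k.val = 0 ∧ (posn ρ (Fin.last d) = 0 ∧ posn (ρ * adjSwap k) (Fin.last d) = 1 ∨
      posn ρ (Fin.last d) = 1 ∧ posn (ρ * adjSwap k) (Fin.last d) = 0)) ∨
    (k.val = 1 ∧ (ρ * adjSwap k) 0 = ρ 0 ∧
      (posn ρ (Fin.last d) = 1 ∧ posn (ρ * adjSwap k) (Fin.last d) = 2 ∨
      posn ρ (Fin.last d) = 2 ∧ posn (ρ * adjSwap k) (Fin.last d) = 1)) := by
  have hj := posn_mul_adjSwap ρ k (Fin.last d)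
  by_cases hk : k.val = 0
  · left
    refine ⟨hk, ?_⟩
    by_contra hcon
    have h₁ : posn ρ (Fin.last d) ≠ 0 := by
      intro h₀
      rw [h₀, if_pos hk.symm] at hj
      omega
    have h₂ : posn ρ (Fin.last d) ≠ 1 := by
      intro h₀
      rw [h₀, if_neg (by omega), if_pos (by omega)] at hj
      omega
    rw [if_neg (by omega), if_neg (by omega)] at hj
    simp only [color, hj, if_neg h₁, if_neg h₂] at h
    exact h rfl
  · have h0 := apply_zero_mul_adjSwap (ρ := ρ) hk
    right
    by_contra hcon
    refine h ?_
    simp only [color, h0]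
    split_ifs at hj <;> split_ifs <;> first | rfl | omega

/-- Four chambers surround the ridge. Between core and layer, either the core colours of `π` and `π
* adjSwap i` differ, which gives a barrier inside the core, or they agree and the opposite wall
separates the same two colours, since the tile colour is unchanged. Between layer and outside,
whether the colours agree is invariant under the exchange. -/
theorem square_inner {π ρ : Equiv.Perm (Fin (d + 1))} {m i : Fin d} (hm : m.val + 1 < d)
    (hi : ρ (Fin.last d) = i.castSucc) (h : color (π, ρ) ≠ color (π, ρ * adjSwap m)) :
    color (π * adjSwap i, ρ) ≠ color (π * adjSwap i, ρ * adjSwap m) ∨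
    Barrier (π, ρ) (π * adjSwap i, ρ) ∨
    Barrier (π, ρ * adjSwap m) (π * adjSwap i, ρ * adjSwap m) := by
  have hi' : (ρ * adjSwap m) (Fin.last d) = i.castSucc := by rw [apply_last_mul_adjSwap hm, hi]
  have ha := val_ne_of_apply_last hi
  have ha' := val_ne_of_apply_last hi'
  rcases color_mul_adjSwap_ne h with ⟨-, ⟨h₁, h₂⟩ | ⟨h₁, h₂⟩⟩ | ⟨-, h0, ⟨h₁, h₂⟩ | ⟨h₁, h₂⟩⟩
  · by_cases hκ : coreColor π = coreColor (π * adjSwap i)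
    · left
      simp only [color, h₁, h₂, if_true, one_ne_zero, if_false] at h ⊢
      rwa [tileColor_mul_adjSwap π ha', ← hκ]
    · exact Or.inr (Or.inl ⟨by simpa [color, h₁] using hκ, Or.inr ⟨h₁, h₁⟩⟩)
  · by_cases hκ : coreColor π = coreColor (π * adjSwap i)
    · left
      simp only [color, h₁, h₂, if_true, one_ne_zero, if_false] at h ⊢
      rwa [tileColor_mul_adjSwap π ha, ← hκ]
    · exact Or.inr (Or.inr ⟨by simpa [color, h₂] using hκ, Or.inr ⟨h₂, h₂⟩⟩)
  all_goals
    left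
    have had : (ρ 0).val < d := val_lt_of_posn_ne (by omega)
    have e₁ := tileColor_eq_outerColor_iff (d := d) had (posn_le π 0)
    have e₂ := tileColor_eq_outerColor_iff (d := d) had (posn_le (π * adjSwap i) 0)
    have e₃ := posn_mul_adjSwap π i 0
    have e₄ := i.2
    simp only [color, h₁, h₂, h0, if_pos, one_ne_zero, OfNat.ofNat_ne_zero,
      OfNat.ofNat_ne_one, if_false] at h ⊢
    intro hcon
    first
      | refine h (e₁.2 ?_)
        have := e₂.1 hcon
        split_ifs at e₃ <;> omega
      | refine h.symm (e₁.2 ?_)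
        have := e₂.1 hcon.symm
        split_ifs at e₃ <;> omega

/-- If the opposite pair of chambers lies in the layer, they belong to one tile and have one colour,
which cannot equal both of the different core colours. Otherwise the opposite pair is in the core
and has the same two colours. -/
theorem square_outer {π ρ : Equiv.Perm (Fin (d + 1))} {m i : Fin d} (hm : m.val + 1 < d)
    (hi : ρ (Fin.last d) = i.castSucc) (h : Barrier (π, ρ) (π * adjSwap i, ρ)) :
    color (π, ρ) ≠ color (π, ρ * adjSwap m) ∨
    color (π * adjSwap i, ρ) ≠ color (π * adjSwap i, ρ * adjSwap m) ∨
    Barrier (π, ρ * adjSwap m) (π * adjSwap i, ρ * adjSwap m) := by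
  have hj : posn ρ (Fin.last d) = 0 := by
    rcases h.2 with h' | h'
    · exact absurd (ChamberAdj.outer π ρ i hi).ne (by simpa using h')
    · exact h'.1
  have hκ : coreColor π ≠ coreColor (π * adjSwap i) := by simpa [color, hj] using h.1
  have hj' := posn_mul_adjSwap ρ m (Fin.last d)
  have hi' : (ρ * adjSwap m) (Fin.last d) = i.castSucc := by rw [apply_last_mul_adjSwap hm, hi]
  have ha' := val_ne_of_apply_last hi'
  by_cases hm0 : m.val = 0
  · have hj1 : posn (ρ * adjSwap m) (Fin.last d) = 1 := by
      rw [hj', if_pos (by omega)]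
      omega
    by_cases h₁ : coreColor π = tileColor d (posn π 0) ((ρ * adjSwap m) 0).val
    · right; left
      simp only [color, hj, hj1, if_true, one_ne_zero, if_false, tileColor_mul_adjSwap π ha', ← h₁]
      exact hκ.symm
    · left
      simpa [color, hj, hj1] using h₁
  · have hj0 : posn (ρ * adjSwap m) (Fin.last d) = 0 := by
      rw [hj', if_neg (by omega), if_neg (by omega), hj]
    right; right
    exact ⟨by simpa [color, hj0] using hκ, Or.inr ⟨hj0, hj0⟩⟩

end coloring

end FinSimplicialComplex

/-! ### Connectedness of the complement of the barrier -/

namespace FinSimplicialComplex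

open OrdFacet Relation

variable {d : ℕ}

theorem perm_apply_inv {α : Type*} (σ : Equiv.Perm α) (x : α) : σ (σ⁻¹ x) = x :=
  σ.apply_symm_apply x

section sorting

/-- Exchange two adjacent positions from `p` on, the second of which does not hold the last value. -/
def SortStep (p : ℕ) (ρ ρ' : Equiv.Perm (Fin (d + 1))) : Prop :=
  ∃ k : Fin d, p ≤ k.val ∧ ρ k.succ ≠ Fin.last d ∧ ρ' = ρ * adjSwap k

theorem SortStep.mono {p q : ℕ} (h : p ≤ q) {ρ ρ' : Equiv.Perm (Fin (d + 1))}
    (hs : SortStep q ρ ρ') : SortStep p ρ ρ' :=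
  hs.imp fun _ hk => ⟨h.trans hk.1, hk.2⟩

theorem exists_sort_to {p : ℕ} {v : Fin (d + 1)} (hv : v ≠ Fin.last d) (m : ℕ) :
    ∀ ρ : Equiv.Perm (Fin (d + 1)), posn ρ v = p + m →
      ∃ ρ', ReflTransGen (SortStep p) ρ ρ' ∧ posn ρ' v = p ∧
        ∀ i : Fin (d + 1), i.val < p → ρ' i = ρ i := by
  induction m with
  | zero => exact fun ρ h => ⟨ρ, ReflTransGen.refl, h, fun _ _ => rfl⟩
  | succ m ih =>
    intro ρ h
    have hle := posn_le ρ v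
    let k : Fin d := ⟨p + m, by omega⟩
    have hk : ρ k.succ = v := posn_eq_iff.1 (by rw [h, Fin.val_succ]; simp only [k]; omega)
    obtain ⟨ρ', h₁, h₂, h₃⟩ := ih (ρ * adjSwap k) (by
      rw [posn_mul_adjSwap, if_neg (by simp only [k]; omega), if_pos (by simp only [k]; omega)])
    refine ⟨ρ', ReflTransGen.head ⟨k, by simp only [k]; omega, hk ▸ hv, rfl⟩ h₁, h₂, fun i hi => ?_⟩
    rw [h₃ i hi, Equiv.Perm.mul_apply, adjSwap_apply_of_ne] <;> rw [Ne, Fin.ext_iff] <;>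
      simp [k] <;> omega

theorem eq_of_agree_castSucc {ρ ρ' : Equiv.Perm (Fin (d + 1))}
    (h : ∀ i : Fin (d + 1), i.val < d → ρ i = ρ' i) : ρ = ρ' := by
  have hlt : ∀ i : Fin (d + 1), i ≠ Fin.last d → i.val < d := fun i hi => by
    rw [Ne, Fin.ext_iff, Fin.val_last] at hi
    omega
  ext i
  by_cases hi : i = Fin.last d
  · have : ρ'⁻¹ (ρ i) = i := by
      by_contra hne
      have h₁ := h _ (hlt _ (fun h' => hne (h'.trans hi.symm)))
      rw [perm_apply_inv] at h₁
      exact hne (ρ.injective h₁)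
    rw [Equiv.Perm.inv_eq_iff_eq] at this
    rw [this]
  · rw [h i (hlt i hi)]

/-- Insertion sort of the positions from `p` on. The last value, which stands for the barycenter, is
never the one moved to the left; hence sorting never brings a chamber closer to the core. The final
hypothesis says that the target holds it before position `p` or at the very end. -/
theorem sort_of_agree (m : ℕ) : ∀ (p : ℕ), p + m = d → ∀ ρ ρ' : Equiv.Perm (Fin (d + 1)),
    (∀ i : Fin (d + 1), i.val < p → ρ i = ρ' i) →
    (∀ i : Fin (d + 1), p ≤ i.val → i.val < d → ρ' i ≠ Fin.last d) →
    ReflTransGen (SortStep p) ρ ρ' := by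
  induction m with
  | zero =>
    intro p hp ρ ρ' h _
    rw [eq_of_agree_castSucc (fun i hi => h i (by omega))]
  | succ m ih =>
    intro p hp ρ ρ' h hne
    let x : Fin (d + 1) := ⟨p, by omega⟩
    have hq : p ≤ posn ρ (ρ' x) := by
      by_contra hlt
      have h₁ := h (ρ⁻¹ (ρ' x)) (not_le.1 hlt)
      rw [perm_apply_inv] at h₁
      have h₂ := congrArg Fin.val (ρ'.injective h₁)
      change p = posn ρ (ρ' x) at h₂
      omega
    obtain ⟨ρ₁, h₁, h₂, h₃⟩ := exists_sort_to (p := p) (hne x le_rfl (by simp only [x]; omega))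
      (posn ρ (ρ' x) - p) ρ (by omega)
    have h₄ : ρ₁ x = ρ' x := posn_eq_iff.1 h₂
    refine h₁.trans (ReflTransGen.mono (fun _ _ => SortStep.mono (Nat.le_succ p)) _ _
      (ih (p + 1) (by omega) ρ₁ ρ' (fun i hi => ?_) (fun i hi => hne i (by omega))))
    rcases Nat.lt_succ_iff_lt_or_eq.1 hi with hlt | heq
    · rw [h₃ i hlt, h i hlt]
    · rw [show i = x from Fin.ext heq, h₄]

end sorting

/-- Adjacent chambers that are not separated by the barrier. -/
def OpenStep (P Q : Chamber d) : Prop := ∃ k, ChamberAdj P k Q ∧ ¬ Barrier P Q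

/-- Chambers that are connected without crossing the barrier. -/
abbrev Reach : Chamber d → Chamber d → Prop := ReflTransGen OpenStep

theorem Reach.symm {P Q : Chamber d} (h : Reach P Q) : Reach Q P := by
  have : Std.Symm (OpenStep (d := d)) :=
    ⟨fun _ _ ⟨k, hk, hb⟩ => ⟨k, hk.symm, fun hb' => hb hb'.symm⟩⟩
  exact ReflTransGen.stdSymm.symm _ _ h

theorem reach_inner {π ρ : Equiv.Perm (Fin (d + 1))} {k : Fin d}
    (h : color (π, ρ) = color (π, ρ * adjSwap k)) : Reach (π, ρ) (π, ρ * adjSwap k) :=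
  ReflTransGen.single ⟨_, ChamberAdj.inner π ρ k, fun hb => hb.1 h⟩

theorem reach_outer {π ρ : Equiv.Perm (Fin (d + 1))} {i : Fin d}
    (hi : ρ (Fin.last d) = i.castSucc)
    (h : posn ρ (Fin.last d) ≠ 0 ∨ coreColor π = coreColor (π * adjSwap i)) :
    Reach (π, ρ) (π * adjSwap i, ρ) := by
  refine ReflTransGen.single ⟨_, ChamberAdj.outer π ρ i hi, fun hb => ?_⟩
  have hj : posn ρ (Fin.last d) = 0 := by
    rcases hb.2 with h' | h'
    · exact absurd (ChamberAdj.outer π ρ i hi).ne (by simpa using h')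
    · exact h'.1
  exact hb.1 (by simpa [color, hj] using h)

theorem reach_of_sort_outer (π : Equiv.Perm (Fin (d + 1))) {ρ ρ' : Equiv.Perm (Fin (d + 1))}
    (h : ReflTransGen (SortStep 0) ρ ρ') (hj : 2 ≤ posn ρ (Fin.last d)) :
    Reach (π, ρ) (π, ρ') ∧ 2 ≤ posn ρ' (Fin.last d) := by
  induction h with
  | refl => exact ⟨ReflTransGen.refl, hj⟩
  | @tail ρ₁ ρ₂ _ hs ih =>
    obtain ⟨k, -, hk, rfl⟩ := hs
    have hk' : posn ρ₁ (Fin.last d) ≠ k.val + 1 := fun h' =>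
      hk (posn_eq_iff.1 (h'.trans (Fin.val_succ k).symm))
    have hle : posn ρ₁ (Fin.last d) ≤ posn (ρ₁ * adjSwap k) (Fin.last d) := by
      rw [posn_mul_adjSwap]
      split_ifs <;> omega
    refine ⟨ih.1.trans (reach_inner ?_), ih.2.trans hle⟩
    have := ih.2
    simp only [color]
    rw [if_neg (by omega), if_neg (by omega), if_neg (by omega), if_neg (by omega)]

theorem reach_of_sort_layer (π : Equiv.Perm (Fin (d + 1))) {ρ ρ' : Equiv.Perm (Fin (d + 1))} {p : ℕ}
    (h : ReflTransGen (SortStep p) ρ ρ') (hj : posn ρ (Fin.last d) < p) :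
    Reach (π, ρ) (π, ρ') ∧ posn ρ' (Fin.last d) = posn ρ (Fin.last d) := by
  induction h with
  | refl => exact ⟨ReflTransGen.refl, rfl⟩
  | @tail ρ₁ ρ₂ _ hs ih =>
    obtain ⟨k, hpk, hk, rfl⟩ := hs
    have heq : posn (ρ₁ * adjSwap k) (Fin.last d) = posn ρ₁ (Fin.last d) := by
      rw [posn_mul_adjSwap]
      split_ifs <;> omega
    refine ⟨ih.1.trans (reach_inner ?_), heq.trans ih.2⟩
    simp only [color]
    rw [heq, apply_zero_mul_adjSwap (by omega)]

/-- Outside the layer the colour depends on `π` only, so `ρ` can be sorted freely. To exchange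
positions `i` and `i + 1` of `π`, pass through an ordering `ρ` that ends with `i`. -/
theorem reach_outer_base (hd : 3 ≤ d) (π : Equiv.Perm (Fin (d + 1)))
    {ρ : Equiv.Perm (Fin (d + 1))} (hj : 2 ≤ posn ρ (Fin.last d)) : Reach (π, ρ) (1, 1) := by
  have hone : ∀ i : Fin (d + 1), 0 ≤ i.val → i.val < d → (1 : Equiv.Perm (Fin (d + 1))) i ≠ Fin.last d :=
    fun i _ hi h => by
      rw [Equiv.Perm.one_apply] at h
      rw [h, Fin.val_last] at hi
      omega
  have toOne : ∀ (π ρ : Equiv.Perm (Fin (d + 1))), 2 ≤ posn ρ (Fin.last d) → Reach (π, ρ) (π, 1) :=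
    fun π ρ hj => (reach_of_sort_outer π (sort_of_agree d 0 (by omega) ρ 1
      (fun i hi => absurd hi (Nat.not_lt_zero _)) hone) hj).1
  have step : ∀ (π : Equiv.Perm (Fin (d + 1))) (i : Fin d), Reach (π, 1) (π * adjSwap i, 1) := by
    intro π i
    let m : Fin d := ⟨d - 1, by omega⟩
    have hm : m.succ = Fin.last d := Fin.ext (by simp [m]; omega)
    -- This ordering ends with `i` and holds the barycenter just before, at position `d - 1`, which
    -- is at least 2 because `d ≥ 3`: the chamber is still outside the layer.
    let ρ : Equiv.Perm (Fin (d + 1)) := Equiv.swap i.castSucc m.castSucc * adjSwap m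
    have h₁ : ρ (Fin.last d) = i.castSucc := by
      simp only [ρ]
      rw [Equiv.Perm.mul_apply, ← hm, adjSwap_succ, Equiv.swap_apply_right]
    have h₂ : ρ m.castSucc = Fin.last d := by
      simp only [ρ]
      rw [Equiv.Perm.mul_apply, adjSwap_castSucc, hm, Equiv.swap_apply_of_ne_of_ne
        (Fin.castSucc_lt_last i).ne' (Fin.castSucc_lt_last m).ne']
    have h₃ : posn ρ (Fin.last d) = d - 1 := posn_eq_iff.2 h₂
    exact (toOne π ρ (by omega)).symm.trans
      ((reach_outer h₁ (Or.inl (by omega))).trans (toOne _ ρ (by omega)))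
  refine (toOne π ρ hj).trans ?_
  induction π using perm_induction_adjSwap with
  | h1 => exact ReflTransGen.refl
  | hs π k ih => exact (step π k).symm.trans ih

/-- Inside the core and inside the first layer one can pass freely from one simplex to another. -/
theorem reach_layer_mul_adjSwap (hd : 3 ≤ d) (π : Equiv.Perm (Fin (d + 1)))
    {ρ : Equiv.Perm (Fin (d + 1))} (hj : posn ρ (Fin.last d) ≤ 1) {i : Fin d}
    (hi : (ρ 0).val ≠ i.val)
    (h : posn ρ (Fin.last d) ≠ 0 ∨ coreColor π = coreColor (π * adjSwap i)) :
    Reach (π, ρ) (π * adjSwap i, ρ) := by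
  set j := posn ρ (Fin.last d) with hjdef
  let x : Fin (d + 1) := ⟨j, by omega⟩
  have hx : ρ x = Fin.last d := posn_eq_iff.1 hjdef.symm
  let q : Fin (d + 1) := ρ⁻¹ i.castSucc
  have hq : ρ q = i.castSucc := by simp [q]
  have hq0 : q.val ≠ 0 := fun h0 => hi (by
    rw [show (0 : Fin (d + 1)) = q from Fin.ext h0.symm, hq]; rfl)
  have hqx : q.val ≠ j := fun h0 => by
    rw [show q = x from Fin.ext h0, hx] at hq
    exact (Fin.castSucc_lt_last i).ne' hq
  -- The value `i` comes after the barycenter, so it can be brought to the end without touching the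
  -- positions up to the barycenter; this keeps the layer and the tile.
  let ρ' := ρ * Equiv.swap q (Fin.last d)
  have hlast : ρ' (Fin.last d) = i.castSucc := by simp [ρ', hq]
  have hagree : ∀ y : Fin (d + 1), y.val < j + 1 → ρ y = ρ' y := by
    intro y hy
    simp only [ρ']
    rw [Equiv.Perm.mul_apply, Equiv.swap_apply_of_ne_of_ne] <;> rw [Ne, Fin.ext_iff]
    · omega
    · rw [Fin.val_last]; omega
  have hx' : ρ' x = Fin.last d := (hagree x (Nat.lt_succ_self _)).symm.trans hx
  have hj' : posn ρ' (Fin.last d) = j := posn_eq_iff.2 hx'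
  have hsort := sort_of_agree (d - (j + 1)) (j + 1) (by omega) ρ ρ' hagree (fun y hy _ h' => by
    have := congrArg Fin.val (ρ'.injective (h'.trans hx'.symm))
    simp only [x] at this
    omega)
  have hr := fun π => (reach_of_sort_layer π hsort (by omega)).1
  exact (hr π).trans ((reach_outer hlast (by rwa [hj'])).trans (hr _).symm)

theorem coreColor_of_ne {π : Equiv.Perm (Fin (d + 1))} (h₀ : posn π 0 ≠ 0) (h₁ : posn π 0 ≠ d) :
    coreColor π = if Equiv.Perm.sign π * (-1) ^ posn π 0 = 1 then 1 else 2 := by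
  rw [coreColor, if_neg h₀, if_neg h₁]

/-- Moving the distinguished vertex does not change the colour of the core. -/
theorem coreColor_move {π : Equiv.Perm (Fin (d + 1))} {i : Fin d}
    (h : posn π 0 = i.val ∨ posn π 0 = i.val + 1)
    (h₀ : posn π 0 ≠ 0) (h₁ : posn π 0 ≠ d) (h₀' : posn (π * adjSwap i) 0 ≠ 0)
    (h₁' : posn (π * adjSwap i) 0 ≠ d) : coreColor (π * adjSwap i) = coreColor π := by
  have hp := posn_mul_adjSwap π i 0
  have key : Equiv.Perm.sign (π * adjSwap i) * (-1) ^ posn (π * adjSwap i) 0 =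
      Equiv.Perm.sign π * (-1) ^ posn π 0 := by
    rw [sign_mul_adjSwap]
    rcases h with h | h
    · rw [hp, if_pos h, h, pow_succ]
      simp
    · rw [if_neg (by omega), if_pos h] at hp
      rw [hp, h, pow_succ]
      simp
  rw [coreColor_of_ne h₀ h₁, coreColor_of_ne h₀' h₁', key]

/-- An exchange away from the distinguished vertex changes the colour of the core. -/
theorem coreColor_flip {π : Equiv.Perm (Fin (d + 1))} {i : Fin d}
    (h : posn π 0 ≠ i.val) (h' : posn π 0 ≠ i.val + 1) (h₀ : posn π 0 ≠ 0) (h₁ : posn π 0 ≠ d) :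
    posn (π * adjSwap i) 0 = posn π 0 ∧ coreColor (π * adjSwap i) ≠ coreColor π := by
  have hp : posn (π * adjSwap i) 0 = posn π 0 := by rw [posn_mul_adjSwap, if_neg h, if_neg h']
  refine ⟨hp, ?_⟩
  rw [coreColor_of_ne h₀ h₁, coreColor_of_ne (by omega) (by omega), sign_mul_adjSwap, hp]
  rcases Int.units_eq_one_or (Equiv.Perm.sign π * (-1) ^ posn π 0) with h | h
  · rw [neg_mul, h]
    decide
  · rw [neg_mul, h]
    decide

theorem exists_perm_core {d : ℕ} (hd : 3 ≤ d) {a : ℕ} (ha : a < d) :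
    ∃ ρ : Equiv.Perm (Fin (d + 1)), ρ 0 = Fin.last d ∧ (ρ ⟨1, by omega⟩).val = a := by
  let x : Fin (d + 1) := ⟨1, by omega⟩
  let y : Fin (d + 1) := ⟨a, by omega⟩
  let ρ₀ : Equiv.Perm (Fin (d + 1)) := Equiv.swap 0 (Fin.last d)
  have h0x : (0 : Fin (d + 1)) ≠ x := by rw [Ne, Fin.ext_iff]; simp [x]
  have h0y : (0 : Fin (d + 1)) ≠ ρ₀⁻¹ y := by
    rw [Ne, eq_comm, Equiv.Perm.inv_eq_iff_eq, Fin.ext_iff]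
    simp [ρ₀, y]
    omega
  refine ⟨ρ₀ * Equiv.swap x (ρ₀⁻¹ y), ?_, ?_⟩
  · rw [Equiv.Perm.mul_apply, Equiv.swap_apply_of_ne_of_ne h0x h0y]
    simp [ρ₀]
  · change ((ρ₀ * Equiv.swap x (ρ₀⁻¹ y)) x).val = a
    rw [Equiv.Perm.mul_apply, Equiv.swap_apply_left, perm_apply_inv]

/-- From a chamber of the core through an open tile to the outside. -/
theorem reach_core_of_tile (hd : 3 ≤ d) {π ρ : Equiv.Perm (Fin (d + 1))}
    (hj : posn ρ (Fin.last d) = 0) {a : ℕ} (ha : a < d)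
    (h₁ : coreColor π = tileColor d (posn π 0) a)
    (h₂ : tileColor d (posn π 0) a = outerColor d (posn π 0)) : Reach (π, ρ) (1, 1) := by
  obtain ⟨ρ', h0, h1⟩ := exists_perm_core hd ha
  have hρ0 : ρ 0 = Fin.last d := posn_eq_iff.1 hj
  have hj' : posn ρ' (Fin.last d) = 0 := posn_eq_iff.2 h0
  have hsort := sort_of_agree (d - 1) 1 (by omega) ρ ρ' (fun y hy => by
    have : y = 0 := Fin.ext (by simpa using hy)
    rw [this, hρ0, h0]) (fun y hy _ h' => by
    have := congrArg Fin.val (ρ'.injective (h'.trans h0.symm))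
    rw [Fin.val_zero] at this
    omega)
  let k₀ : Fin d := ⟨0, by omega⟩
  let k₁ : Fin d := ⟨1, by omega⟩
  have e₁ : posn (ρ' * adjSwap k₀) (Fin.last d) = 1 := by
    rw [posn_mul_adjSwap, if_pos (by simp [hj', k₀])]
  have e₂ : posn (ρ' * adjSwap k₀ * adjSwap k₁) (Fin.last d) = 2 := by
    rw [posn_mul_adjSwap, if_pos (by simp [e₁, k₁])]
  have e₃ : ((ρ' * adjSwap k₀) 0).val = a := by
    rw [Equiv.Perm.mul_apply, show (0 : Fin (d + 1)) = k₀.castSucc from rfl, adjSwap_castSucc, ← h1]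
    rfl
  refine (reach_of_sort_layer π hsort (by omega)).1.trans ((reach_inner (k := k₀) ?_).trans
    ((reach_inner (k := k₁) ?_).trans (reach_outer_base hd π (by omega))))
  · simp only [color, hj', e₁, if_true, one_ne_zero, if_false, e₃, h₁]
  · simp only [color, e₁, e₂, if_true, one_ne_zero, if_false, e₃, h₂, OfNat.ofNat_ne_zero,
      OfNat.ofNat_ne_one]

/-- Vertex 0 is moved down to position 0 without leaving room 1; there the tile `a = 0` is a door to
the outside. -/
theorem reach_core_one (hd : 3 ≤ d) {ρ : Equiv.Perm (Fin (d + 1))}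
    (hj : posn ρ (Fin.last d) = 0) (n : ℕ) : ∀ π : Equiv.Perm (Fin (d + 1)), posn π 0 = n →
      coreColor π = 1 → Reach (π, ρ) (1, 1) := by
  have hρ0 : ρ 0 = Fin.last d := posn_eq_iff.1 hj
  induction n with
  | zero =>
    intro π hn h
    exact reach_core_of_tile hd hj (a := 0) (by omega) (by simp [h, hn, tileColor])
      (by simp [hn, tileColor, outerColor])
  | succ n ih =>
    intro π hn h
    have hle := posn_le π 0
    have hnd : n + 1 ≠ d := by
      intro h'
      rw [coreColor, if_neg (by omega), if_pos (by omega)] at h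
      omega
    let i : Fin d := ⟨n, by omega⟩
    have hp : posn (π * adjSwap i) 0 = n := by
      rw [posn_mul_adjSwap, if_neg (by simp only [i]; omega), if_pos (by simp only [i]; omega)]
    have hc : coreColor (π * adjSwap i) = 1 := by
      by_cases h0 : n = 0
      · rw [coreColor, if_pos (by omega)]
      · rw [coreColor_move (Or.inr hn) (by omega) (by omega) (by omega) (by omega), h]
    refine (reach_layer_mul_adjSwap hd π (by omega) (i := i) ?_ (Or.inr (h.trans hc.symm))).trans
      (ih _ hp hc)
    rw [hρ0, Fin.val_last]
    exact i.2.ne'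

/-- Symmetric to room 1: vertex 0 is moved up to position `d`, where the tile `a = d - 1` is the
door. -/
theorem reach_core_two (hd : 3 ≤ d) {ρ : Equiv.Perm (Fin (d + 1))}
    (hj : posn ρ (Fin.last d) = 0) (n : ℕ) : ∀ π : Equiv.Perm (Fin (d + 1)), posn π 0 + n = d →
      coreColor π = 2 → Reach (π, ρ) (1, 1) := by
  have hρ0 : ρ 0 = Fin.last d := posn_eq_iff.1 hj
  induction n with
  | zero =>
    intro π hn h
    rw [add_zero] at hn
    exact reach_core_of_tile hd hj (a := d - 1) (by omega)
      (by rw [h, hn, tileColor, if_neg (by omega), if_pos (by omega)])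
      (by rw [hn, tileColor, if_neg (by omega), if_pos (by omega), outerColor, if_neg (by omega),
            if_pos rfl])
  | succ n ih =>
    intro π hn h
    have h0 : posn π 0 ≠ 0 := by
      intro h'
      rw [coreColor, if_pos h'] at h
      omega
    let i : Fin d := ⟨posn π 0, by omega⟩
    have hp : posn (π * adjSwap i) 0 = posn π 0 + 1 := by
      rw [posn_mul_adjSwap, if_pos rfl]
    have hc : coreColor (π * adjSwap i) = 2 := by
      by_cases h1 : n = 0
      · rw [coreColor, if_neg (by omega), if_pos (by omega)]
      · rw [coreColor_move (Or.inl rfl) (by omega) (by omega) (by omega) (by omega), h]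
    refine (reach_layer_mul_adjSwap hd π (by omega) (i := i) ?_ (Or.inr (h.trans hc.symm))).trans
      (ih _ (by omega) hc)
    rw [hρ0, Fin.val_last]
    exact i.2.ne'

theorem reach_core (hd : 3 ≤ d) (π : Equiv.Perm (Fin (d + 1))) {ρ : Equiv.Perm (Fin (d + 1))}
    (hj : posn ρ (Fin.last d) = 0) : Reach (π, ρ) (1, 1) := by
  rcases coreColor_eq_one_or π with h | h
  · exact reach_core_one hd hj _ π rfl h
  · exact reach_core_two hd hj (d - posn π 0) π (by have := posn_le π 0; omega) h

theorem reach_tile_of_eq (hd : 3 ≤ d) {π ρ : Equiv.Perm (Fin (d + 1))}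
    (hj : posn ρ (Fin.last d) = 1) (h : coreColor π = tileColor d (posn π 0) (ρ 0).val) :
    Reach (π, ρ) (1, 1) := by
  let k₀ : Fin d := ⟨0, by omega⟩
  have e₁ : posn (ρ * adjSwap k₀) (Fin.last d) = 0 := by
    rw [posn_mul_adjSwap, if_neg (by simp [hj, k₀]), if_pos (by simp [hj, k₀])]
  refine (reach_inner (k := k₀) ?_).trans (reach_core hd π e₁)
  simp only [color, hj, e₁, if_true, one_ne_zero, if_false, h]

/-- In the first layer one can flip the colour of the core below. -/
theorem reach_tile_flip (hd : 3 ≤ d) {π ρ : Equiv.Perm (Fin (d + 1))}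
    (hj : posn ρ (Fin.last d) = 1) (h₀ : posn π 0 ≠ 0) (h₁ : posn π 0 ≠ d) {i : Fin d}
    (hi : (ρ 0).val ≠ i.val) (h : posn π 0 ≠ i.val) (h' : posn π 0 ≠ i.val + 1) :
    Reach (π, ρ) (1, 1) := by
  by_cases hc : coreColor π = tileColor d (posn π 0) (ρ 0).val
  · exact reach_tile_of_eq hd hj hc
  · obtain ⟨hp, hf⟩ := coreColor_flip h h' h₀ h₁
    refine (reach_layer_mul_adjSwap hd π hj.le hi (Or.inl (by omega))).trans
      (reach_tile_of_eq hd hj ?_)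
    rw [tileColor_mul_adjSwap π hi]
    have e₁ := coreColor_eq_one_or π
    have e₂ := coreColor_eq_one_or (π * adjSwap i)
    have e₃ := tileColor_eq_one_or (d := d) (posn π 0) (ρ 0).val
    omega

/-- Within a tile at a face containing vertex 0, this vertex can be moved up to position `a`, which
is neither 0 nor `d`. There the sign decides the room below, and an exchange away from vertex 0
switches it. -/
theorem reach_tile_le (hd : 3 ≤ d) {ρ : Equiv.Perm (Fin (d + 1))}
    (hj : posn ρ (Fin.last d) = 1) (ha : (ρ 0).val ≠ 0) (n : ℕ) :
    ∀ π : Equiv.Perm (Fin (d + 1)), posn π 0 + n = (ρ 0).val → Reach (π, ρ) (1, 1) := by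
  have had : (ρ 0).val < d := val_lt_of_posn_ne (by omega)
  induction n with
  | zero =>
    intro π hn
    -- The exchange must avoid the positions `a - 1` and `a`; a third one exists among the `d ≥ 3`
    -- adjacent transpositions.
    by_cases ha1 : (ρ 0).val = 1
    · refine reach_tile_flip hd hj (by omega) (by omega) (i := ⟨d - 1, by omega⟩) ?_ ?_ ?_ <;>
        dsimp only <;> omega
    · refine reach_tile_flip hd hj (by omega) (by omega) (i := ⟨0, by omega⟩) ?_ ?_ ?_ <;>
        dsimp only <;> omega
  | succ n ih =>
    intro π hn
    let i : Fin d := ⟨posn π 0, by omega⟩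
    have hp : posn (π * adjSwap i) 0 = posn π 0 + 1 := by
      rw [posn_mul_adjSwap, if_pos rfl]
    exact (reach_layer_mul_adjSwap hd π hj.le (i := i) (by simp only [i]; omega)
      (Or.inl (by omega))).trans (ih _ (by omega))

/-- Here vertex 0 is outside the face of the tile and is moved down to position `a + 1 < d`; the
flip must avoid the exchanges `a` and `a + 1`. -/
theorem reach_tile_gt (hd : 3 ≤ d) {ρ : Equiv.Perm (Fin (d + 1))}
    (hj : posn ρ (Fin.last d) = 1) (ha : (ρ 0).val + 1 ≠ d) (n : ℕ) :
    ∀ π : Equiv.Perm (Fin (d + 1)), posn π 0 = (ρ 0).val + 1 + n → Reach (π, ρ) (1, 1) := by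
  have had : (ρ 0).val < d := val_lt_of_posn_ne (by omega)
  induction n with
  | zero =>
    intro π hn
    by_cases ha0 : (ρ 0).val = 0
    · refine reach_tile_flip hd hj (by omega) (by omega) (i := ⟨d - 1, by omega⟩) ?_ ?_ ?_ <;>
        dsimp only <;> omega
    · refine reach_tile_flip hd hj (by omega) (by omega) (i := ⟨0, by omega⟩) ?_ ?_ ?_ <;>
        dsimp only <;> omega
  | succ n ih =>
    intro π hn
    have := posn_le π 0
    let i : Fin d := ⟨posn π 0 - 1, by omega⟩
    have hp : posn (π * adjSwap i) 0 = posn π 0 - 1 := by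
      rw [posn_mul_adjSwap, if_neg (by simp only [i]; omega), if_pos (by simp only [i]; omega)]
    exact (reach_layer_mul_adjSwap hd π hj.le (i := i) (by simp only [i]; omega)
      (Or.inl (by omega))).trans (ih _ (by omega))

theorem reach_base (hd : 3 ≤ d) (P : Chamber d) : Reach P (1, 1) := by
  obtain ⟨π, ρ⟩ := P
  have hle := posn_le π 0
  by_cases h0 : posn ρ (Fin.last d) = 0
  · exact reach_core hd π h0
  by_cases h1 : posn ρ (Fin.last d) = 1
  · have had : (ρ 0).val < d := val_lt_of_posn_ne h0
    by_cases hh : posn π 0 ≤ (ρ 0).val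
    · by_cases ha : (ρ 0).val = 0
      · have hp : posn π 0 = 0 := by omega
        exact reach_tile_of_eq hd h1 (by simp [coreColor, tileColor, hp, ha])
      · exact reach_tile_le hd h1 ha _ π (Nat.add_sub_cancel' hh)
    · by_cases ha : (ρ 0).val + 1 = d
      · have hp : posn π 0 = d := by omega
        refine reach_tile_of_eq hd h1 ?_
        rw [coreColor, if_neg (by omega), if_pos hp, tileColor, if_neg hh, if_pos ha]
      · exact reach_tile_gt hd h1 ha _ π (Nat.add_sub_cancel' (by omega)).symm
  · exact reach_outer_base hd π (by omega)

/-- Witness: for `π = 1` the core has colour 1, while the tile `a = 1` contains vertex 0 and has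
colour 2. -/
theorem exists_barrier (hd : 3 ≤ d) : ∃ (P : Chamber d) (k : Fin (d + 1)) (P' : Chamber d),
    ChamberAdj P k P' ∧ Barrier P P' := by
  obtain ⟨ρ, h0, h1⟩ := exists_perm_core hd (a := 1) (by omega)
  let k₀ : Fin d := ⟨0, by omega⟩
  have hj : posn ρ (Fin.last d) = 0 := posn_eq_iff.2 h0
  have e₁ : posn (ρ * adjSwap k₀) (Fin.last d) = 1 := by
    rw [posn_mul_adjSwap, if_pos (by simp [hj, k₀])]
  have e₃ : ((ρ * adjSwap k₀) 0).val = 1 := by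
    rw [Equiv.Perm.mul_apply, show (0 : Fin (d + 1)) = k₀.castSucc from rfl, adjSwap_castSucc]
    exact h1
  have hp : posn (1 : Equiv.Perm (Fin (d + 1))) 0 = 0 := rfl
  refine ⟨(1, ρ), _, _, ChamberAdj.inner 1 ρ k₀, ?_, Or.inl rfl⟩
  simp only [color, hj, e₁, if_true, one_ne_zero, if_false, e₃, coreColor, hp, tileColor]
  simp

end FinSimplicialComplex

/-! ### The trap in the second subdivision of a facet -/

namespace FinSimplicialComplex

open OrdFacet Relation

variable {K : FinSimplicialComplex.{u}} {d : ℕ}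

theorem OrdFacet.initial_perm_of_preserves (f : OrdFacet K d) {g : Equiv.Perm (Fin (d + 1))} {n : ℕ}
    (hg : ∀ i, (g i).val < n ↔ i.val < n) : (f.perm g).initial n = f.initial n := by
  ext v
  rw [mem_initial, mem_initial]
  constructor
  · rintro ⟨i, hi, h⟩
    exact ⟨g i, (hg i).2 hi, h⟩
  · rintro ⟨i, hi, h⟩
    exact ⟨g⁻¹ i, (hg _).1 (by rwa [perm_apply_inv]), by rwa [perm_apply, perm_apply_inv]⟩

theorem OrdFacet.initial_perm_ne (f : OrdFacet K d) {g : Equiv.Perm (Fin (d + 1))} {n : ℕ}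
    {i : Fin (d + 1)} (hi : i.val < n) (hgi : ¬ (g i).val < n) :
    (f.perm g).initial n ≠ f.initial n := fun h =>
  hgi (apply_mem_initial.1 (h ▸ mem_initial.2 ⟨i, hi, rfl⟩ : f (g i) ∈ f.initial n))

/-- The second level of the ordered facet indexed by a chamber. -/
def preBary (f : OrdFacet K d) (P : Chamber d) : OrdFacet K.sd d := (f.perm P.1).flag.perm P.2

/-- The facet of the second barycentric subdivision of a facet indexed by a chamber. -/
def bary (f : OrdFacet K d) (P : Chamber d) : OrdFacet K.sd.sd d := (preBary f P).flag

theorem bary_injective {f : OrdFacet K d} {P Q : Chamber d}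
    (h : (bary f P).face = (bary f Q).face) : P = Q := by
  have h₁ : preBary f P = preBary f Q := flag_injective h
  have h₂ : (f.perm P.1).flag.face = (f.perm Q.1).flag.face := by
    have := congrArg OrdFacet.face h₁
    rwa [preBary, preBary, perm_face, perm_face] at this
  have h₃ : f.perm P.1 = f.perm Q.1 := flag_injective h₂
  have h₄ : P.1 = Q.1 := Equiv.ext fun i => f.inj (congrArg (fun g : OrdFacet K d => g i) h₃)
  refine Prod.ext h₄ (Equiv.ext fun i => (f.perm P.1).flag.inj ?_)
  have := congrArg (fun g : OrdFacet K.sd d => g i) h₁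
  rw [preBary, preBary, h₄] at this
  rw [h₄]
  exact this

theorem preBary_outer (f : OrdFacet K d) {π ρ : Equiv.Perm (Fin (d + 1))} {i : Fin d}
    (hi : ρ (Fin.last d) = i.castSucc) (y : Fin (d + 1)) (hy : y ≠ Fin.last d) :
    preBary f (π * adjSwap i, ρ) y = preBary f (π, ρ) y := by
  refine flag_apply_eq_iff.2 ⟨rfl, initial_perm_adjSwap (f.perm π) fun h => hy ?_⟩
  refine ρ.injective (Eq.trans (Fin.ext ?_) hi.symm)
  change (ρ y).val + 1 = i.val + 1 at h
  rw [Fin.val_castSucc]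
  omega

theorem ChamberAdj.wall_eq (f : OrdFacet K d) {P P' : Chamber d} {k : Fin (d + 1)}
    (h : ChamberAdj P k P') : (bary f P).wall k = (bary f P').wall k := by
  cases h with
  | inner π ρ k => exact (flag_wall_castSucc_perm (preBary f (π, ρ)) k).symm
  | outer π ρ i hi => exact (flag_wall_last_eq (preBary_outer f hi)).symm

/-- An outer wall lies over the wall of the first subdivision that omits the member `i < d` of the
flag. That wall contains the barycenter of the facet, so no other facet of `K` touches it. -/
theorem ChamberAdj.thin (hK : K.DimLE d) (f : OrdFacet K d) {P P' : Chamber d} {k : Fin (d + 1)}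
    (h : ChamberAdj P k P') {c : Finset K.sd.sd.V} (hc : c ∈ K.sd.sd.complex.faces)
    (hcard : c.card = d + 1) (hs : (bary f P).wall k ⊆ c) :
    c = (bary f P).face ∨ c = (bary f P').face := by
  cases h with
  | inner π ρ k => exact eq_or_eq_of_wall_castSucc_subset hK.sd (preBary f (π, ρ)) k hc hcard hs
  | outer π ρ i hi =>
    obtain ⟨g, rfl, hg⟩ := exists_agree_of_wall_last_subset hK.sd (preBary f (π, ρ)) hc hcard hs
    have hw : (f.perm π).flag.wall i.castSucc ⊆ g.face := by
      rw [← hi, ← perm_wall]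
      exact wall_eq_of_agree hg ▸ wall_subset_face g _
    rcases eq_or_eq_of_wall_castSucc_subset hK (f.perm π) i g.face_mem g.card_face hw with h | h
    · left
      rw [eq_of_agree_of_face_eq hg (h.trans (perm_face _ _).symm)]
      rfl
    · right
      rw [eq_of_agree_of_face_eq (g := preBary f (π * adjSwap i, ρ))
        (fun y hy => (hg y hy).trans (preBary_outer f hi y hy).symm) (h.trans (perm_face _ _).symm)]
      rfl

/-- The hypothesis `ht` expresses that the new wall through the ridge is a different one: it omits
the other vertex, or it omits the same one while the vertex at `l` has changed. -/
theorem wall_ne_and_subset {g g' : OrdFacet K d} {k l t : Fin (d + 1)} (hkl : k ≠ l)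
    {r : Finset K.sd.V} (hr : ∀ v, v ∈ r ↔ ∃ i, i ≠ k ∧ i ≠ l ∧ g.flag i = v)
    (hagree : ∀ i, i ≠ k → i ≠ l → g'.flag i = g.flag i)
    (ht : t = l ∨ t = k ∧ g'.flag l ≠ g.flag l) :
    g'.flag.wall t ≠ g.flag.wall k ∧ r ⊆ g'.flag.wall t := by
  constructor
  · intro h
    obtain ⟨i, hi, hi'⟩ := mem_wall.1 (h ▸ apply_mem_wall.2 hkl.symm : g.flag l ∈ g'.flag.wall t)
    have hil := (flag_apply_eq_iff.1 hi').1
    subst hil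
    rcases ht with rfl | ⟨-, hne⟩
    · exact hi rfl
    · exact hne hi'
  · intro v hv
    obtain ⟨i, hk, hl, rfl⟩ := (hr v).1 hv
    refine mem_wall.2 ⟨i, ?_, hagree i hk hl⟩
    rcases ht with rfl | ⟨rfl, -⟩ <;> assumption

theorem bary_inner_eq (f : OrdFacet K d) (π ρ : Equiv.Perm (Fin (d + 1))) (k : Fin d)
    {y : Fin (d + 1)} (hy : y ≠ k.castSucc) : bary f (π, ρ * adjSwap k) y = bary f (π, ρ) y := by
  refine flag_apply_eq_iff.2 ⟨rfl, initial_perm_adjSwap (preBary f (π, ρ)) fun h => hy ?_⟩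
  exact Fin.ext (by rw [Fin.val_castSucc]; omega)

theorem bary_inner_ne (f : OrdFacet K d) (π ρ : Equiv.Perm (Fin (d + 1))) (k : Fin d) :
    bary f (π, ρ * adjSwap k) k.castSucc ≠ bary f (π, ρ) k.castSucc := fun h =>
  flag_perm_adjSwap_apply_ne (preBary f (π, ρ)) k (flag_apply_eq_iff.1 h).2

theorem bary_outer_eq (f : OrdFacet K d) {π ρ : Equiv.Perm (Fin (d + 1))} {i : Fin d}
    (hi : ρ (Fin.last d) = i.castSucc) {y : Fin (d + 1)} (hy : y ≠ Fin.last d) :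
    bary f (π * adjSwap i, ρ) y = bary f (π, ρ) y := by
  refine flag_apply_eq_iff.2 ⟨rfl, initial_eq_of_agree fun z hz => preBary_outer f hi z fun h => ?_⟩
  rw [h, Fin.val_last] at hz
  rw [Ne, Fin.ext_iff, Fin.val_last] at hy
  omega

theorem bary_outer_ne (f : OrdFacet K d) {π ρ : Equiv.Perm (Fin (d + 1))} {i : Fin d}
    (hi : ρ (Fin.last d) = i.castSucc) :
    bary f (π * adjSwap i, ρ) (Fin.last d) ≠ bary f (π, ρ) (Fin.last d) := fun h =>
  (ChamberAdj.outer π ρ i hi).ne (bary_injective (f := f) (by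
    have h₁ : ∀ y, bary f (π * adjSwap i, ρ) y = bary f (π, ρ) y := fun y => by
      by_cases hy : y = Fin.last d
      · rw [hy, h]
      · exact bary_outer_eq f hi hy
    rw [ext_apply h₁]))

theorem preBary_apply_eq_iff (f : OrdFacet K d) {P Q : Chamber d} {y z : Fin (d + 1)} :
    preBary f P y = preBary f Q z ↔ P.2 y = Q.2 z ∧
      (f.perm P.1).initial ((P.2 y).val + 1) = (f.perm Q.1).initial ((P.2 y).val + 1) :=
  flag_apply_eq_iff

theorem exists_barrier_inner_inner (f : OrdFacet K d) {π ρ : Equiv.Perm (Fin (d + 1))} {k l : Fin d}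
    (hb : color (π, ρ) ≠ color (π, ρ * adjSwap k)) (hkl : k ≠ l) :
    ∃ Q t Q', ChamberAdj Q t Q' ∧ Barrier Q Q' ∧
      (∀ y, y ≠ k.castSucc → y ≠ l.castSucc → bary f Q y = bary f (π, ρ) y) ∧
      (t = l.castSucc ∨ t = k.castSucc ∧ bary f Q l.castSucc ≠ bary f (π, ρ) l.castSucc) := by
  obtain ⟨g, t, hg, hc, ht⟩ := exists_change (fun ρ => color (π, ρ)) ρ hkl hb
  refine ⟨(π, ρ * g), t.castSucc, (π, ρ * g * adjSwap t), ChamberAdj.inner _ _ _,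
    ⟨hc, Or.inl rfl⟩, fun y hk hl => ?_,
    ht.imp (congrArg Fin.castSucc) fun h => ⟨congrArg Fin.castSucc h.1, ?_⟩⟩
  · refine flag_apply_eq_iff.2 ⟨rfl, initial_perm_of_preserves (preBary f (π, ρ)) (hg _ ?_ ?_)⟩
    · rw [Ne, Fin.ext_iff, Fin.val_castSucc] at hk
      omega
    · rw [Ne, Fin.ext_iff, Fin.val_castSucc] at hl
      omega
  · obtain ⟨-, i, hi, hgi⟩ := h
    exact fun h' => initial_perm_ne (preBary f (π, ρ)) hi hgi (flag_apply_eq_iff.1 h').2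

/-- Barrier walls of this kind have the barycenter at position at most `2 < d`, so `ρ` does not end
with it. Hence the last wall is interior to the facet, and the square argument applies. -/
theorem exists_barrier_inner_outer (hd : 3 ≤ d) (f : OrdFacet K d)
    {π ρ : Equiv.Perm (Fin (d + 1))} {k : Fin d}
    (hb : color (π, ρ) ≠ color (π, ρ * adjSwap k)) :
    ∃ Q t Q', ChamberAdj Q t Q' ∧ Barrier Q Q' ∧
      (∀ y, y ≠ k.castSucc → y ≠ Fin.last d → bary f Q y = bary f (π, ρ) y) ∧
      (t = Fin.last d ∨ t = k.castSucc ∧ bary f Q (Fin.last d) ≠ bary f (π, ρ) (Fin.last d)) := by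
  have hcases := color_mul_adjSwap_ne hb
  have hkd : k.val + 1 < d := by omega
  have hlast : ρ (Fin.last d) ≠ Fin.last d := fun h => by
    have := posn_eq_iff.2 h
    rw [Fin.val_last] at this
    omega
  obtain ⟨i, hi⟩ := Fin.exists_castSucc_eq.2 hlast
  have hi' : (ρ * adjSwap k) (Fin.last d) = i.castSucc := by rw [apply_last_mul_adjSwap hkd, hi]
  rcases square_inner hkd hi.symm hb with h | h | h
  · exact ⟨(π * adjSwap i, ρ), _, _, ChamberAdj.inner _ _ k, ⟨h, Or.inl rfl⟩,
      fun y _ hl => bary_outer_eq f hi.symm hl, Or.inr ⟨rfl, bary_outer_ne f hi.symm⟩⟩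
  · exact ⟨(π, ρ), _, _, ChamberAdj.outer _ _ i hi.symm, h, fun _ _ _ => rfl, Or.inl rfl⟩
  · exact ⟨(π, ρ * adjSwap k), _, _, ChamberAdj.outer _ _ i hi', h,
      fun y hk _ => bary_inner_eq f _ _ k hk, Or.inl rfl⟩

/-- Either the ridge is surrounded by a square, or it omits the last two sets of the flag. In the
latter case the chambers around it all lie in the core and follow the cycle of permutations
generated by the exchanges `i` and `m`, and `exists_change` applies to `coreColor`. -/
theorem exists_barrier_outer_inner (hd : 3 ≤ d) (f : OrdFacet K d)
    {π ρ : Equiv.Perm (Fin (d + 1))} {i l : Fin d} (hi : ρ (Fin.last d) = i.castSucc)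
    (hb : Barrier (π, ρ) (π * adjSwap i, ρ)) :
    ∃ Q t Q', ChamberAdj Q t Q' ∧ Barrier Q Q' ∧
      (∀ y, y ≠ Fin.last d → y ≠ l.castSucc → bary f Q y = bary f (π, ρ) y) ∧
      (t = l.castSucc ∨ t = Fin.last d ∧ bary f Q l.castSucc ≠ bary f (π, ρ) l.castSucc) := by
  by_cases hld : l.val + 1 < d
  · have hi' : (ρ * adjSwap l) (Fin.last d) = i.castSucc := by rw [apply_last_mul_adjSwap hld, hi]
    rcases square_outer hld hi hb with h | h | h
    · exact ⟨(π, ρ), _, _, ChamberAdj.inner _ _ l, ⟨h, Or.inl rfl⟩, fun _ _ _ => rfl, Or.inl rfl⟩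
    · exact ⟨(π * adjSwap i, ρ), _, _, ChamberAdj.inner _ _ l, ⟨h, Or.inl rfl⟩,
        fun y hk _ => bary_outer_eq f hi hk, Or.inl rfl⟩
    · exact ⟨(π, ρ * adjSwap l), _, _, ChamberAdj.outer _ _ i hi', h,
        fun y _ hl => bary_inner_eq f _ _ l hl, Or.inr ⟨rfl, bary_inner_ne f _ _ l⟩⟩
  · have hl : l.succ = Fin.last d := Fin.ext (by rw [Fin.val_succ, Fin.val_last]; omega)
    have hj : posn ρ (Fin.last d) = 0 := by
      rcases hb.2 with h' | h'
      · exact absurd (ChamberAdj.outer π ρ i hi).ne (by simpa using h')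
      · exact h'.1
    have hκ : coreColor π ≠ coreColor (π * adjSwap i) := by simpa [color, hj] using hb.1
    have hne : ρ l.castSucc ≠ Fin.last d := fun h => by
      have := posn_eq_iff.2 h
      rw [Fin.val_castSucc] at this
      omega
    obtain ⟨m, hm⟩ := Fin.exists_castSucc_eq.2 hne
    have him : i ≠ m := fun h => by
      have h' : ρ (Fin.last d) = ρ l.castSucc := by rw [hi, ← hm, h]
      exact (Fin.castSucc_lt_last l).ne' (ρ.injective h')
    obtain ⟨g, t, hg, hc, ht⟩ := exists_change coreColor π him hκ
    have hj' : posn (ρ * adjSwap l) (Fin.last d) = 0 := by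
      rw [posn_mul_adjSwap, if_neg (by omega), if_neg (by omega), hj]
    have hpre : ∀ y : Fin (d + 1), y ≠ Fin.last d → y ≠ l.castSucc →
        preBary f (π * g, ρ) y = preBary f (π, ρ) y := by
      intro y h₁ h₂
      refine (preBary_apply_eq_iff f).2 ⟨rfl, initial_perm_of_preserves (f.perm π) (hg _ ?_ ?_)⟩
      · intro h
        exact h₁ (ρ.injective (Fin.ext (by rw [hi, Fin.val_castSucc]; dsimp only at h; omega)))
      · intro h
        exact h₂ (ρ.injective (Fin.ext (by rw [← hm, Fin.val_castSucc]; dsimp only at h; omega)))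
    have hagree : ∀ y : Fin (d + 1), y ≠ Fin.last d → y ≠ l.castSucc →
        bary f (π * g, ρ) y = bary f (π, ρ) y := by
      intro y h₁ h₂
      rw [Ne, Fin.ext_iff] at h₁ h₂
      rw [Fin.val_last] at h₁
      rw [Fin.val_castSucc] at h₂
      refine flag_apply_eq_iff.2 ⟨rfl, initial_eq_of_agree fun z hz => hpre z ?_ ?_⟩
      · rw [Ne, Fin.ext_iff, Fin.val_last]; omega
      · rw [Ne, Fin.ext_iff, Fin.val_castSucc]; omega
    have hnot : ∀ Q : Chamber d, ∀ y : Fin (d + 1), y.val < d →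
        bary f Q l.castSucc = bary f (π, ρ) l.castSucc →
        ∃ z : Fin (d + 1), z.val < d ∧ preBary f (π, ρ) z = preBary f Q y := by
      intro Q y hy h
      have h₁ := (flag_apply_eq_iff.1 h).2
      have h₂ : preBary f Q y ∈ (preBary f Q).initial (l.castSucc.val + 1) :=
        apply_mem_initial.2 (by rw [Fin.val_castSucc]; omega)
      rw [h₁] at h₂
      obtain ⟨z, hz, hz'⟩ := mem_initial.1 h₂
      rw [Fin.val_castSucc] at hz
      exact ⟨z, by omega, hz'⟩
    -- The wall of the exchange `m` is the last wall of a chamber whose ordering ends with `m`,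
    -- hence `ρ * adjSwap l`; for the exchange `i` the ordering `ρ` itself serves.
    rcases ht with rfl | ⟨rfl, x, hx, hgx⟩
    · have hlast : (ρ * adjSwap l) (Fin.last d) = t.castSucc := by
        rw [Equiv.Perm.mul_apply, ← hl, adjSwap_succ, hm]
      refine ⟨(π * g, ρ * adjSwap l), _, _, ChamberAdj.outer _ _ t hlast,
        ⟨by simpa only [color, hj', if_true] using hc, Or.inr ⟨hj', hj'⟩⟩,
        fun y h₁ h₂ => (bary_inner_eq f _ _ l h₂).trans (hagree y h₁ h₂),
        Or.inr ⟨rfl, fun h => ?_⟩⟩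
      obtain ⟨z, hz, hz'⟩ := hnot _ l.castSucc (by rw [Fin.val_castSucc]; omega) h
      have h₁ := ((preBary_apply_eq_iff f).1 hz').1
      dsimp only at h₁
      rw [Equiv.Perm.mul_apply, adjSwap_castSucc, hl] at h₁
      rw [ρ.injective h₁, Fin.val_last] at hz
      omega
    · refine ⟨(π * g, ρ), _, _, ChamberAdj.outer _ _ t hi,
        ⟨by simpa only [color, hj, if_true] using hc, Or.inr ⟨hj, hj⟩⟩, hagree,
        Or.inr ⟨rfl, fun h => ?_⟩⟩
      obtain ⟨z, hz, hz'⟩ := hnot _ l.castSucc (by rw [Fin.val_castSucc]; omega) h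
      have h₁ := (preBary_apply_eq_iff f).1 hz'.symm
      refine initial_perm_ne (f.perm π) (n := m.val + 1) hx hgx ?_
      have h₂ := h₁.2
      dsimp only at h₂
      rwa [← hm, Fin.val_castSucc] at h₂

theorem exists_barrier_ridge (hd : 3 ≤ d) (f : OrdFacet K d) {P P' : Chamber d}
    {k l : Fin (d + 1)} (h : ChamberAdj P k P') (hb : Barrier P P') (hlk : l ≠ k) :
    ∃ Q t Q', ChamberAdj Q t Q' ∧ Barrier Q Q' ∧
      (∀ y, y ≠ k → y ≠ l → bary f Q y = bary f P y) ∧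
      (t = l ∨ t = k ∧ bary f Q l ≠ bary f P l) := by
  cases h with
  | inner π ρ k =>
    induction l using Fin.lastCases with
    | last => exact exists_barrier_inner_outer hd f hb.1
    | cast l => exact exists_barrier_inner_inner f hb.1 fun h => hlk (h ▸ rfl)
  | outer π ρ i hi =>
    obtain ⟨l, rfl⟩ := Fin.exists_castSucc_eq.2 hlk
    exact exists_barrier_outer_inner hd f hi hb

/-- The facets of the second subdivision of a facet. -/
def baseD (f : OrdFacet K d) : Set (Finset K.sd.sd.V) := {c | ∃ P, (bary f P).face = c}

/-- The walls that belong to the barrier. -/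
def baseH (f : OrdFacet K d) : Set (Finset K.sd.sd.V) :=
  {c | ∃ P k P', ChamberAdj P k P' ∧ Barrier P P' ∧ (bary f P).wall k = c}

/-- The interior walls that do not belong to the barrier. -/
def baseA (f : OrdFacet K d) : Set (Finset K.sd.sd.V) :=
  {c | ∃ P k P', ChamberAdj P k P' ∧ ¬ Barrier P P' ∧ (bary f P).wall k = c}

theorem base_thin (hK : K.DimLE d) (f : OrdFacet K d) {P P' : Chamber d} {k : Fin (d + 1)}
    (h : ChamberAdj P k P') : ((bary f P).wall k).card = d ∧ ∃ F ∈ baseD f, ∃ F' ∈ baseD f,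
      F ≠ F' ∧ (bary f P).wall k ⊆ F ∧ (bary f P).wall k ⊆ F' ∧
      ∀ G ∈ K.sd.sd.complex.faces, G.card = d + 1 → (bary f P).wall k ⊆ G → G = F ∨ G = F' :=
  ⟨card_wall _ _, _, ⟨P, rfl⟩, _, ⟨P', rfl⟩, fun h' => h.ne (bary_injective h'),
    wall_subset_face _ _, h.wall_eq f ▸ wall_subset_face _ _,
    fun _ hc hcard hs => h.thin hK f hc hcard hs⟩

theorem Reach.crosses {f : OrdFacet K d} {P Q : Chamber d} (h : Reach P Q) :
    ReflTransGen (Crosses (baseD f) (baseA f)) (bary f P).face (bary f Q).face := by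
  induction h with
  | refl => exact ReflTransGen.refl
  | @tail Q R _ hs ih =>
    obtain ⟨k, hk, hb⟩ := hs
    exact ih.tail ⟨⟨Q, rfl⟩, ⟨R, rfl⟩, _, ⟨Q, k, R, hk, hb, rfl⟩, wall_subset_face _ _,
      hk.wall_eq f ▸ wall_subset_face _ _⟩

theorem isTrap_base (hK : K.DimLE d) (hd : 3 ≤ d) (f : OrdFacet K d) :
    IsTrap d K.sd.sd (baseD f) (baseH f) (baseA f) where
  mem_D := by
    rintro _ ⟨P, rfl⟩
    exact ⟨(bary f P).face_mem, (bary f P).card_face⟩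
  thin := by
    rintro _ (⟨P, k, P', h, -, rfl⟩ | ⟨P, k, P', h, -, rfl⟩) <;> exact base_thin hK f h
  conn := by
    rintro _ ⟨P, rfl⟩ _ ⟨Q, rfl⟩
    exact Reach.crosses ((reach_base hd P).trans (reach_base hd Q).symm)
  ridge := by
    rintro _ ⟨P, k, P', h, hb, rfl⟩ r hr hc
    obtain ⟨l, hlk, hmem⟩ := exists_ne_of_subset_wall hr hc
    obtain ⟨Q, t, Q', hQ, hbQ, hagree, ht⟩ := exists_barrier_ridge hd f h hb hlk
    have := wall_ne_and_subset hlk.symm hmem hagree ht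
    exact ⟨_, ⟨Q, t, Q', hQ, hbQ, rfl⟩, this.1, this.2⟩
  disj := by
    rintro _ ⟨P, k, P', h, hb, rfl⟩ ⟨Q, l, Q', hQ, hbQ, heq⟩
    have key : ∀ R, (bary f P).wall k ⊆ (bary f R).face → R = P ∨ R = P' := fun R hR =>
      (h.thin hK f (bary f R).face_mem (bary f R).card_face hR).imp
        (fun h => bary_injective h) (fun h => bary_injective h)
    have h₁ := key Q (heq ▸ wall_subset_face _ _)
    have h₂ := key Q' (heq ▸ hQ.wall_eq f ▸ wall_subset_face _ _)
    have hne := hQ.ne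
    rcases h₁ with rfl | rfl <;> rcases h₂ with rfl | rfl
    · exact hne rfl
    · exact hbQ hb
    · exact hbQ hb.symm
    · exact hne rfl
  nonempty := by
    obtain ⟨P, k, P', h, hb⟩ := exists_barrier hd
    exact ⟨_, P, k, P', h, hb, rfl⟩

end FinSimplicialComplex

/-! ### Runs of the algorithm on a complex with a trap -/

namespace DiscreteMorse

open FinSimplicialComplex Relation
open scoped ENNReal

theorem _root_.PMF.le_tsum_mul {α : Type*} (p : PMF α) {f : α → ℝ≥0∞} {c : ℝ≥0∞}
    (h : ∀ a, c ≤ f a) : c ≤ ∑' a, p a * f a := by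
  calc c = ∑' a, p a * c := by rw [ENNReal.tsum_mul_right, p.tsum_coe, one_mul]
    _ ≤ ∑' a, p a * f a := ENNReal.tsum_le_tsum fun a => mul_le_mul_right (h a) _

theorem _root_.Relation.ReflTransGen.exists_step {α : Type*} {r : α → α → Prop} {p : α → Prop}
    {a b : α} (h : ReflTransGen r a b) (ha : p a) (hb : ¬ p b) : ∃ x y, r x y ∧ p x ∧ ¬ p y := by
  induction h with
  | refl => exact absurd ha hb
  | @tail x y _ hxy ih =>
    by_cases hx : p x
    · exact ⟨x, y, hxy, hx, hb⟩
    · exact ih hx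

section basic

variable {V : Type u} {S : Finset (Finset V)} {σ τ : Finset V}

theorem mem_topFaces : τ ∈ topFaces S ↔ τ ∈ S ∧ τ.card = S.sup Finset.card := by
  simp [topFaces]

theorem mem_freeFaces : σ ∈ freeFaces S ↔
    σ ∈ S ∧ σ.card + 1 = S.sup Finset.card ∧ ∃! τ, τ ∈ S ∧ σ ⊂ τ := by
  simp [freeFaces]

theorem mem_collapse : τ ∈ collapse S σ ↔ τ ∈ S ∧ ¬ σ ⊆ τ := by
  simp [collapse]

open Classical in
theorem run_of_free (sel : Selector V) (hS : S.Nonempty) (hF : (freeFaces S).Nonempty) :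
    run sel S = (sel (freeFaces S) hF).bind fun σ => run sel (collapse S σ.1) := by
  rw [run, dif_pos hS, dif_pos hF]

open Classical in
theorem run_of_not_free (sel : Selector V) (hS : S.Nonempty) (hF : ¬ (freeFaces S).Nonempty) :
    run sel S = (sel (topFaces S) (topFaces_nonempty hS)).bind fun τ =>
        (run sel (S.erase τ.1)).map (insert τ.1) := by
  rw [run, dif_pos hS, dif_neg hF]

theorem run_empty (sel : Selector V) : run sel ∅ = PMF.pure ∅ := by
  rw [run, dif_neg (by simp)]

/-- The critical faces are among the given faces. -/
theorem subset_of_mem_support_run (sel : Selector V) (n : ℕ) :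
    ∀ S : Finset (Finset V), S.card = n → ∀ C ∈ (run sel S).support, C ⊆ S := by
  classical
  induction n using Nat.strong_induction_on with
  | _ n ih =>
    intro S hn C hC
    by_cases hS : S.Nonempty
    · by_cases hF : (freeFaces S).Nonempty
      · rw [run_of_free sel hS hF, PMF.mem_support_bind_iff] at hC
        obtain ⟨σ, -, hC⟩ := hC
        have hlt := collapse_card_lt (mem_freeFaces.1 σ.2).1
        exact (ih _ (hn ▸ hlt) _ rfl C hC).trans fun τ hτ => (mem_collapse.1 hτ).1
      · rw [run_of_not_free sel hS hF, PMF.mem_support_bind_iff] at hC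
        obtain ⟨τ, -, hC⟩ := hC
        rw [PMF.mem_support_map_iff] at hC
        obtain ⟨C', hC', rfl⟩ := hC
        have hτ := (mem_topFaces.1 τ.2).1
        have hlt := Finset.card_erase_lt_of_mem hτ
        exact Finset.insert_subset hτ ((ih _ (hn ▸ hlt) _ rfl C' (by convert hC')).trans
          (Finset.erase_subset _ _))
    · rw [Finset.not_nonempty_iff_eq_empty] at hS
      rw [hS, run_empty, PMF.mem_support_pure_iff] at hC
      simp [hC]

end basic

/-- The sets of faces that contain a member of `H`. -/
def hits {V : Type u} (H : Set (Finset V)) : Set (Finset (Finset V)) := {C | ∃ h ∈ H, h ∈ C}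

/-- The possible states of the algorithm in which the barrier `H` is still intact. -/
structure Intact (K : FinSimplicialComplex.{u}) (H : Set (Finset K.V))
    (S : Finset (Finset K.V)) : Prop where
  faces : ∀ σ ∈ S, σ ∈ K.complex.faces
  lower : ∀ σ ∈ S, ∀ τ, τ ⊆ σ → τ.Nonempty → τ ∈ S
  barrier : ∀ h ∈ H, h ∈ S

section trap

variable {K : FinSimplicialComplex.{u}} {d : ℕ} {D H A : Set (Finset K.V)}
  {S : Finset (Finset K.V)}

theorem Intact.collapse (hS : Intact K H S) {σ : Finset K.V} (hσ : ∀ h ∈ H, ¬ σ ⊆ h) :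
    Intact K H (collapse S σ) where
  faces τ hτ := hS.faces τ (mem_collapse.1 hτ).1
  lower τ hτ ρ hρ hne := mem_collapse.2 ⟨hS.lower τ (mem_collapse.1 hτ).1 ρ hρ hne,
    fun h => (mem_collapse.1 hτ).2 (h.trans hρ)⟩
  barrier h hh := mem_collapse.2 ⟨hS.barrier h hh, hσ h hh⟩

open Classical in
theorem Intact.erase (hS : Intact K H S) {τ : Finset K.V} (hτ : τ ∈ topFaces S) (hτH : τ ∉ H) :
    Intact K H (S.erase τ) where
  faces σ hσ := hS.faces σ (Finset.mem_of_mem_erase hσ)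
  lower σ hσ ρ hρ hne := by
    obtain ⟨hστ, hσS⟩ := Finset.mem_erase.1 hσ
    refine Finset.mem_erase.2 ⟨?_, hS.lower σ hσS ρ hρ hne⟩
    rintro rfl
    refine hστ (Finset.eq_of_subset_of_card_le hρ ?_).symm
    rw [(mem_topFaces.1 hτ).2]
    exact Finset.le_sup (f := Finset.card) hσS
  barrier h hh := Finset.mem_erase.2 ⟨fun h' => hτH (h' ▸ hh), hS.barrier h hh⟩

theorem Intact.sup_le (hS : Intact K H S) (hK : K.DimLE d) : S.sup Finset.card ≤ d + 1 :=
  Finset.sup_le fun σ hσ => hK σ (hS.faces σ hσ)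

theorem Intact.eq_or_eq_of_ssubset (hS : Intact K H S) (hK : K.DimLE d) {h F F' : Finset K.V}
    (hcard : h.card = d)
    (hG : ∀ G ∈ K.complex.faces, G.card = d + 1 → h ⊆ G → G = F ∨ G = F') {τ : Finset K.V}
    (hτ : τ ∈ S) (hhτ : h ⊂ τ) : τ = F ∨ τ = F' := by
  have h₁ := Finset.card_lt_card hhτ
  have h₂ := hK τ (hS.faces τ hτ)
  exact hG τ (hS.faces τ hτ) (by omega) hhτ.1

theorem ssubset_of_card {V : Type u} {σ τ : Finset V} {n : ℕ} (h : σ ⊆ τ) (h₁ : σ.card = n)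
    (h₂ : τ.card = n + 1) : σ ⊂ τ :=
  Finset.ssubset_iff_subset_ne.2 ⟨h, fun h' => by rw [h'] at h₁; omega⟩

/-- As long as a face of the barrier is free, there is a free passage. -/
theorem Intact.exists_free (hS : Intact K H S) (hK : K.DimLE d) (hT : IsTrap d K D H A)
    (hd : d ≠ 0) (hsup : S.sup Finset.card = d + 1) {h : Finset K.V} (hh : h ∈ H)
    (hf : h ∈ freeFaces S) : ∃ a ∈ A, a ∈ freeFaces S := by
  obtain ⟨-, -, τ, ⟨hτS, hhτ⟩, huniq⟩ := mem_freeFaces.1 hf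
  obtain ⟨hcard, F, hF, F', hF', hne, hhF, hhF', hG⟩ := hT.thin h (Or.inl hh)
  have hex : ∃ F ∈ D, ∃ F' ∈ D, F ∈ S ∧ F' ∉ S := by
    rcases hS.eq_or_eq_of_ssubset hK hcard hG hτS hhτ with rfl | rfl
    · exact ⟨τ, hF, F', hF', hτS, fun h' => hne (huniq F'
        ⟨h', ssubset_of_card hhF' hcard (hT.mem_D _ hF').2⟩).symm⟩
    · exact ⟨τ, hF', F, hF, hτS, fun h' => hne (huniq F
        ⟨h', ssubset_of_card hhF hcard (hT.mem_D _ hF).2⟩)⟩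
  obtain ⟨G, hGD, G', hGD', hGS, hGS'⟩ := hex
  obtain ⟨X, Y, ⟨hX, hY, a, ha, haX, haY⟩, hXS, hYS⟩ :=
    (hT.conn G hGD G' hGD').exists_step (p := fun F => F ∈ S) hGS hGS'
  obtain ⟨hacard, -⟩ := hT.thin a (Or.inr ha)
  obtain ⟨Z, -, -, -, hZ⟩ := hT.exists_other (Or.inr ha) hX haX
  have hYZ : Y = Z := (hZ Y (hT.mem_D _ hY).1 (hT.mem_D _ hY).2 haY).resolve_left
    fun h' => hYS (h' ▸ hXS)
  refine ⟨a, ha, mem_freeFaces.2 ⟨hS.lower X hXS a haX (Finset.card_pos.1 (by omega)),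
    by rw [hacard, hsup], X, ⟨hXS, ssubset_of_card haX hacard (hT.mem_D _ hX).2⟩, ?_⟩⟩
  rintro ρ ⟨hρS, haρ⟩
  exact (hS.eq_or_eq_of_ssubset hK hacard hZ hρS haρ).resolve_right
    fun h' => hYS (hYZ ▸ h' ▸ hρS)

/-- When the facets are gone, collapses do not touch the barrier. -/
theorem Intact.not_subset_of_free (hS : Intact K H S) (hK : K.DimLE d) (hT : IsTrap d K D H A)
    (hsup : S.sup Finset.card ≠ d + 1) {σ : Finset K.V} (hσ : σ ∈ freeFaces S) :
    ∀ h ∈ H, ¬ σ ⊆ h := by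
  intro h hh hσh
  obtain ⟨-, hcard, τ, -, huniq⟩ := mem_freeFaces.1 hσ
  have h₁ := (hT.thin h (Or.inl hh)).1
  have h₂ : h.card ≤ S.sup Finset.card := Finset.le_sup (f := Finset.card) (hS.barrier h hh)
  have h₃ := hS.sup_le hK
  obtain ⟨h', hh', hne, hσh'⟩ := hT.ridge h hh σ hσh (by omega)
  have h₄ := (hT.thin h' (Or.inl hh')).1
  refine hne ((huniq h' ⟨hS.barrier h' hh', ?_⟩).trans (huniq h ⟨hS.barrier h hh, ?_⟩).symm)
  · exact Finset.ssubset_iff_subset_ne.2 ⟨hσh', fun h => by rw [h] at hcard; omega⟩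
  · exact Finset.ssubset_iff_subset_ne.2 ⟨hσh, fun h => by rw [h] at hcard; omega⟩

open Classical in
theorem collapse_filter_lt (hK : K.DimLE d) (hS : Intact K H S) (hT : IsTrap d K D H A)
    {a : Finset K.V} (ha : a ∈ A) (hf : a ∈ freeFaces S) :
    ((collapse S a).filter (· ∈ D)).card < (S.filter (· ∈ D)).card := by
  obtain ⟨-, -, τ, ⟨hτS, haτ⟩, -⟩ := mem_freeFaces.1 hf
  obtain ⟨hcard, F, hF, F', hF', -, -, -, hG⟩ := hT.thin a (Or.inr ha)
  have hτD : τ ∈ D := by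
    rcases hS.eq_or_eq_of_ssubset hK hcard hG hτS haτ with rfl | rfl <;> assumption
  refine Finset.card_lt_card (Finset.ssubset_iff_of_subset ?_ |>.2 ⟨τ, ?_, ?_⟩)
  · exact Finset.filter_subset_filter _ fun τ hτ => (mem_collapse.1 hτ).1
  · exact Finset.mem_filter.2 ⟨hτS, hτD⟩
  · exact fun h => (mem_collapse.1 (Finset.mem_filter.1 h).1).2 haτ.1

open Classical in
/-- Among free faces one of which is in `A`, the rule avoids `H`, in the sense that it has a good
chance to select a member of `A`. -/
def Avoids {V : Type u} (sel : Selector V) (H A : Set (Finset V)) (q : ℝ≥0∞) : Prop :=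
  ∀ F hF, (∃ a ∈ A, a ∈ F) →
    q ≤ ∑' σ, sel F hF σ * (if σ.1 ∈ H then 0 else if σ.1 ∈ A then 1 else q)

open Classical in
/-- With positive probability, the algorithm finds a critical face in the barrier. -/
theorem pow_le_run_hits (hK : K.DimLE d) (hd : d ≠ 0) (hT : IsTrap d K D H A)
    {sel : Selector K.V} {q : ℝ≥0∞} (hq : q ≤ 1) (hsel : Avoids sel H A q) (n : ℕ) :
    ∀ S : Finset (Finset K.V), S.card = n → Intact K H S →
      q ^ (S.filter (· ∈ D)).card ≤ (run sel S).toOuterMeasure (hits H) := by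
  induction n using Nat.strong_induction_on with
  | _ n ih =>
    intro S hn hS
    obtain ⟨h₀, hh₀⟩ := hT.nonempty
    have hne : S.Nonempty := ⟨h₀, hS.barrier h₀ hh₀⟩
    by_cases hF : (freeFaces S).Nonempty
    · rw [run_of_free sel hne hF, PMF.toOuterMeasure_bind_apply]
      have hlt : ∀ σ ∈ freeFaces S, (collapse S σ).card < n := fun σ hσ =>
        hn ▸ collapse_card_lt (mem_freeFaces.1 hσ).1
      have hfilter : ∀ σ, ((collapse S σ).filter (· ∈ D)).card ≤ (S.filter (· ∈ D)).card :=
        fun σ => Finset.card_le_card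
          (Finset.filter_subset_filter _ fun τ hτ => (mem_collapse.1 hτ).1)
      have hstep : ∀ σ ∈ freeFaces S, (∀ h ∈ H, ¬ σ ⊆ h) →
          q ^ ((collapse S σ).filter (· ∈ D)).card ≤
            (run sel (collapse S σ)).toOuterMeasure (hits H) := fun σ hσ hσH =>
        ih _ (hlt σ hσ) _ rfl (hS.collapse hσH)
      -- If no free face lies in a member of `H`, every selection leaves the barrier intact and does
      -- not increase the number of facets of `D`.
      by_cases hfree : ∀ σ ∈ freeFaces S, ∀ h ∈ H, ¬ σ ⊆ h
      · exact PMF.le_tsum_mul _ fun σ =>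
          (pow_le_pow_right_of_le_one' hq (hfilter σ)).trans (hstep σ σ.2 (hfree σ σ.2))
      · push Not at hfree
        obtain ⟨σ₀, hσ₀, h₁, hh₁, hσh⟩ := hfree
        have hsup : S.sup Finset.card = d + 1 := by
          by_contra hsup
          exact hS.not_subset_of_free hK hT hsup hσ₀ h₁ hh₁ hσh
        have heq : ∀ σ ∈ freeFaces S, ∀ h ∈ H, σ ⊆ h → σ = h := fun σ hσ h hh hσh =>
          Finset.eq_of_subset_of_card_le hσh (by
            have := (mem_freeFaces.1 hσ).2.1
            rw [(hT.thin h (Or.inl hh)).1]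
            omega)
        have hfree₁ : h₁ ∈ freeFaces S := heq σ₀ hσ₀ h₁ hh₁ hσh ▸ hσ₀
        obtain ⟨a, ha, haF⟩ := hS.exists_free hK hT hd hsup hh₁ hfree₁
        have hpos : 0 < (S.filter (· ∈ D)).card :=
          (Nat.zero_le _).trans_lt (collapse_filter_lt hK hS hT ha haF)
        -- The exponent counts the remaining facets of `D`. Selecting a member of `A` removes one of
        -- them and leaves the bound `q ^ m`; another harmless face may leave `q ^ (m + 1)`. These
        -- are `q ^ m` times the weights in `Avoids`.
        obtain ⟨m, hm⟩ := Nat.exists_eq_succ_of_ne_zero hpos.ne'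
        rw [hm, pow_succ]
        calc q ^ m * q ≤ q ^ m * ∑' σ, sel (freeFaces S) hF σ *
              (if σ.1 ∈ H then 0 else if σ.1 ∈ A then 1 else q) :=
              mul_le_mul_right (hsel _ hF ⟨a, ha, haF⟩) _
          _ = ∑' σ, sel (freeFaces S) hF σ *
              (q ^ m * (if σ.1 ∈ H then 0 else if σ.1 ∈ A then 1 else q)) := by
              rw [← ENNReal.tsum_mul_left]
              exact tsum_congr fun σ => mul_left_comm _ _ _
          _ ≤ _ := by
              refine ENNReal.tsum_le_tsum fun σ => mul_le_mul_right ?_ _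
              by_cases hσH : σ.1 ∈ H
              · simp [hσH]
              · have hσ' := hstep σ σ.2 fun h hh hs => hσH (heq σ σ.2 h hh hs ▸ hh)
                rw [if_neg hσH]
                by_cases hσA : σ.1 ∈ A
                · rw [if_pos hσA, mul_one]
                  refine (pow_le_pow_right_of_le_one' hq ?_).trans hσ'
                  have := collapse_filter_lt hK hS hT hσA σ.2
                  omega
                · rw [if_neg hσA, ← pow_succ]
                  refine (pow_le_pow_right_of_le_one' hq ?_).trans hσ'
                  have := hfilter σ
                  omega
    · rw [run_of_not_free sel hne hF, PMF.toOuterMeasure_bind_apply]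
      refine PMF.le_tsum_mul _ fun τ => ?_
      rw [PMF.toOuterMeasure_map_apply]
      -- A member of `H` selected as a top face is critical, so the event has occurred; any other
      -- top face is deleted without harm to the barrier.
      by_cases hτH : τ.1 ∈ H
      · have : (insert τ.1 ⁻¹' hits H : Set (Finset (Finset K.V))) = Set.univ :=
          Set.eq_univ_of_forall fun C => ⟨τ.1, hτH, Finset.mem_insert_self _ _⟩
        rw [this, (PMF.toOuterMeasure_apply_eq_one_iff _ _).2 (Set.subset_univ _)]
        exact pow_le_one' hq _
      · refine le_trans ?_ ((ih _ (hn ▸ Finset.card_erase_lt_of_mem (mem_topFaces.1 τ.2).1) _ rfl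
          (hS.erase τ.2 hτH)).trans (MeasureTheory.OuterMeasure.mono _ ?_))
        · exact pow_le_pow_right_of_le_one' hq
            (Finset.card_le_card (Finset.filter_subset_filter _ (Finset.erase_subset _ _)))
        · exact fun C ⟨h, hh, hC⟩ => ⟨h, hh, Finset.mem_insert_of_mem hC⟩

theorem intact_faceFinset (hT : IsTrap d K D H A) (hd : d ≠ 0) : Intact K H K.faceFinset where
  faces σ hσ := mem_faceFinset.1 hσ
  lower σ hσ τ hτ hne := mem_faceFinset.2 (mem_faces_of_subset (mem_faceFinset.1 hσ) hτ hne)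
  barrier h hh := by
    obtain ⟨hcard, F, hF, -, -, -, hhF, -⟩ := hT.thin h (Or.inl hh)
    exact mem_faceFinset.2 (mem_faces_of_subset (hT.mem_D F hF).1 hhF
      (Finset.card_pos.1 (by omega)))

end trap

end DiscreteMorse

/-! ### Selection rules and random labellings -/

namespace DiscreteMorse

open FinSimplicialComplex
open scoped ENNReal

section selectors

variable {V : Type u} {H A : Set (Finset V)}

open Classical in
-- Among the selections in `H ∪ A`, one in `A` has probability at least `1 / (N + 1)`, as there are
-- at most `N` members of `H` against at least one of `A`; the remaining selections carry the weight
-- `q` itself.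
theorem avoids_selectUniform (hdisj : ∀ h ∈ H, h ∉ A) {N : ℕ}
    (hN : ∀ F : Finset (Finset V), (F.filter (· ∈ H)).card ≤ N) :
    Avoids selectUniform H A ((N + 1 : ℕ) : ℝ≥0∞)⁻¹ := by
  intro F hF ⟨a, ha, haF⟩
  set q : ℝ≥0∞ := ((N + 1 : ℕ) : ℝ≥0∞)⁻¹ with hq
  have hNq : q + N * q = 1 := by
    have : ((N + 1 : ℕ) : ℝ≥0∞) * q = 1 :=
      ENNReal.mul_inv_cancel (by simp) (ENNReal.natCast_ne_top _)
    rw [← this]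
    push_cast
    ring
  have hqt : q ≠ ∞ := by
    rw [hq, ENNReal.inv_ne_top]
    simp
  set w : Finset V → ℝ≥0∞ := fun σ => if σ ∈ H then 0 else if σ ∈ A then 1 else q with hw
  -- Compare term by term: each member of `H` lacks `q`, and the surplus `N * q` at the face `a`
  -- makes up for all of them.
  have hle : (F.card : ℝ≥0∞) * q ≤ ∑ σ ∈ F, w σ := by
    have h₁ : (F.card : ℝ≥0∞) * q + N * q ≤ ∑ σ ∈ F, w σ + N * q := by
      calc (F.card : ℝ≥0∞) * q + N * q = ∑ σ ∈ F, (q + if σ = a then N * q else 0) := by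
            rw [Finset.sum_add_distrib, Finset.sum_const, nsmul_eq_mul, Finset.sum_ite_eq',
              if_pos haF]
        _ ≤ ∑ σ ∈ F, (w σ + if σ ∈ H then q else 0) := by
            refine Finset.sum_le_sum fun σ _ => ?_
            by_cases hσH : σ ∈ H
            · have : σ ≠ a := fun h => hdisj σ hσH (h ▸ ha)
              simp [hw, hσH, this]
            · by_cases hσa : σ = a
              · subst hσa
                simp [hw, hσH, ha, hNq]
              · by_cases hσA : σ ∈ A
                · simp only [hw, hσH, hσA, hσa, if_true, if_false, add_zero]
                  exact hNq ▸ le_self_add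
                · simp [hw, hσH, hσA, hσa]
        _ = ∑ σ ∈ F, w σ + (F.filter (· ∈ H)).card * q := by
            rw [Finset.sum_add_distrib, ← Finset.sum_filter, Finset.sum_const, nsmul_eq_mul]
        _ ≤ _ := by
            gcongr
            exact_mod_cast hN F
    exact (ENNReal.add_le_add_iff_right (ENNReal.mul_ne_top (ENNReal.natCast_ne_top _) hqt)).1 h₁
  have := hF.to_subtype
  have hcard : (F.card : ℝ≥0∞) ≠ 0 := by simpa using hF.ne_empty
  calc q = (F.card : ℝ≥0∞)⁻¹ * (F.card * q) := by
        rw [← mul_assoc, ENNReal.inv_mul_cancel hcard (ENNReal.natCast_ne_top _), one_mul]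
    _ ≤ (F.card : ℝ≥0∞)⁻¹ * ∑ σ ∈ F, w σ := by gcongr
    _ = ∑' σ, selectUniform F hF σ * w σ := by
        rw [tsum_fintype, ← Finset.sum_coe_sort F, Finset.mul_sum]
        refine Finset.sum_congr rfl fun σ _ => ?_
        simp [selectUniform, PMF.uniformOfFintype_apply]

open Classical in
theorem tsum_pure_mul {α : Type*} (x : α) (f : α → ℝ≥0∞) : ∑' a, PMF.pure x a * f a = f x := by
  rw [tsum_eq_single x]
  · simp
  · intro b hb
    simp [PMF.pure_apply, hb]

theorem avoids_selectLexFirst {n : ℕ} {label : V ≃ Fin n}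
    (h : ∀ a ∈ A, ∀ b ∈ H, labelList label a < labelList label b) :
    Avoids (selectLexFirst label) H A 1 := by
  intro F hF ⟨a, ha, haF⟩
  have hex := F.exists_min_image (labelList label) hF
  change 1 ≤ ∑' σ, PMF.pure (⟨hex.choose, hex.choose_spec.1⟩ : {σ // σ ∈ F}) σ * _
  rw [tsum_pure_mul, if_neg]
  · simp
  · exact fun hH => (h a ha _ hH).not_ge (hex.choose_spec.2 a haF)

theorem avoids_selectLexLast {n : ℕ} {label : V ≃ Fin n}
    (h : ∀ a ∈ A, ∀ b ∈ H, labelList label b < labelList label a) :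
    Avoids (selectLexLast label) H A 1 := by
  intro F hF ⟨a, ha, haF⟩
  have hex := F.exists_max_image (labelList label) hF
  change 1 ≤ ∑' σ, PMF.pure (⟨hex.choose, hex.choose_spec.1⟩ : {σ // σ ∈ F}) σ * _
  rw [tsum_pure_mul, if_neg]
  · simp
  · exact fun hH => (h a ha _ hH).not_ge (hex.choose_spec.2 a haF)

theorem mem_labelList {n : ℕ} {label : V ≃ Fin n} {σ : Finset V} {x : Fin n} :
    x ∈ labelList label σ ↔ ∃ v ∈ σ, label v = x := by
  rw [labelList, Finset.mem_sort, Finset.mem_map]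
  rfl

/-- A face with a vertex whose label is smaller than all labels of another face comes first. -/
theorem labelList_lt {n : ℕ} {label : V ≃ Fin n} {σ τ : Finset V} {b : V} (hb : b ∈ σ)
    (hτ : τ.Nonempty) (h : ∀ v ∈ τ, label b < label v) :
    labelList label σ < labelList label τ := by
  have hsort : (labelList label σ).Pairwise (· ≤ ·) := Finset.pairwise_sort _ _
  have hbσ : label b ∈ labelList label σ := mem_labelList.2 ⟨b, hb, rfl⟩
  obtain ⟨v₀, hv₀⟩ := hτ
  have hvτ : label v₀ ∈ labelList label τ := mem_labelList.2 ⟨v₀, hv₀, rfl⟩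
  have hmem : ∀ x ∈ labelList label τ, ∃ v ∈ τ, label v = x := fun x => mem_labelList.1
  generalize labelList label σ = l₁ at *
  generalize labelList label τ = l₂ at *
  cases l₁ with
  | nil => simp at hbσ
  | cons x xs =>
    cases l₂ with
    | nil => simp at hvτ
    | cons y ys =>
      refine List.Lex.rel ?_
      obtain ⟨v, hv, rfl⟩ := hmem y (by simp)
      refine lt_of_le_of_lt ?_ (h v hv)
      rcases List.mem_cons.1 hbσ with h' | h'
      · exact h'.ge
      · exact (List.pairwise_cons.1 hsort).1 _ h'

/-- The labellings that put the vertices of `W` in `B` before the other vertices of `W`. -/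
def firstLabels {n : ℕ} (W : Finset V) (B : Set V) : Set (V ≃ Fin n) :=
  {label | ∀ b ∈ W, b ∈ B → ∀ w ∈ W, w ∉ B → label b < label w}

open Classical in
-- A rearrangement of the labels on `W` that minimises the sum of the labels on `B` works: any
-- inversion could be swapped away with a smaller sum.
theorem exists_perm_mem_firstLabels {n : ℕ} (W : Finset V) (B : Set V) (label : V ≃ Fin n) :
    ∃ g : Equiv.Perm {v // v ∈ W},
      (Equiv.Perm.ofSubtype g).trans label ∈ firstLabels W B := by
  obtain ⟨g, hg⟩ := Finite.exists_min fun g : Equiv.Perm {v // v ∈ W} =>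
    ∑ b : {v // v ∈ W}, if b.1 ∈ B then (label (g b).1).val else 0
  refine ⟨g, fun b hbW hbB w hwW hwB => ?_⟩
  rw [Equiv.trans_apply, Equiv.trans_apply, Equiv.Perm.ofSubtype_apply_of_mem g hbW,
    Equiv.Perm.ofSubtype_apply_of_mem g hwW]
  have hne : (⟨b, hbW⟩ : {v // v ∈ W}) ≠ ⟨w, hwW⟩ := fun h => hwB (by
    have := congrArg Subtype.val h
    dsimp only at this
    exact this ▸ hbB)
  by_contra hlt
  have hlt' : label (g ⟨w, hwW⟩).1 < label (g ⟨b, hbW⟩).1 :=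
    lt_of_le_of_ne (not_lt.1 hlt) fun h =>
      hne (g.injective (Subtype.ext (label.injective h))).symm
  refine (hg (g * Equiv.swap ⟨b, hbW⟩ ⟨w, hwW⟩)).not_gt (Finset.sum_lt_sum (fun x _ => ?_)
    ⟨⟨b, hbW⟩, Finset.mem_univ _, ?_⟩)
  · by_cases hxB : x.1 ∈ B
    · rw [if_pos hxB, if_pos hxB, Equiv.Perm.mul_apply]
      by_cases hxb : x = ⟨b, hbW⟩
      · rw [hxb, Equiv.swap_apply_left]
        exact hlt'.le
      · rw [Equiv.swap_apply_of_ne_of_ne hxb (fun h => hwB (by rwa [h] at hxB))]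
    · rw [if_neg hxB, if_neg hxB]
  · rw [if_pos hbB, if_pos hbB, Equiv.Perm.mul_apply, Equiv.swap_apply_left]
    exact hlt'

end selectors

theorem inv_factorial_le_firstLabels (K : FinSimplicialComplex.{u}) (W : Finset K.V) (B : Set K.V) :
    ((W.card.factorial : ℕ) : ℝ≥0∞)⁻¹ ≤ (randomLabelling K).toOuterMeasure (firstLabels W B) := by
  classical
  have : Nonempty (K.V ≃ Fin (Nat.card K.V)) := ⟨Finite.equivFin K.V⟩
  let _ := Fintype.ofFinite (K.V ≃ Fin (Nat.card K.V))
  change _ ≤ (PMF.uniformOfFintype (K.V ≃ Fin (Nat.card K.V))).toOuterMeasure (firstLabels W B)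
  rw [PMF.toOuterMeasure_uniformOfFintype_apply]
  -- Every labelling arises from a favourable one by a permutation of `W`, so the favourable ones
  -- make up at least the fraction `1 / |W|!`.
  have hsurj : Function.Surjective fun x : Equiv.Perm {v // v ∈ W} ×
      (firstLabels W B : Set (K.V ≃ Fin (Nat.card K.V))) =>
      (Equiv.Perm.ofSubtype x.1).symm.trans x.2.1 := fun label => by
    obtain ⟨g, hg⟩ := exists_perm_mem_firstLabels W B label
    refine ⟨(g, ⟨_, hg⟩), ?_⟩
    ext v
    simp
  have hcard := Fintype.card_le_of_surjective _ hsurj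
  rw [Fintype.card_prod, Fintype.card_perm, Fintype.card_coe] at hcard
  rw [ENNReal.le_div_iff_mul_le (Or.inl (by simp [Fintype.card_ne_zero]))
    (Or.inl (ENNReal.natCast_ne_top _)), mul_comm, ← div_eq_mul_inv]
  refine ENNReal.div_le_of_le_mul ?_
  rw [mul_comm]
  exact_mod_cast hcard

theorem le_bind_toOuterMeasure {α β : Type*} (p : PMF α) (f : α → PMF β) (s : Set α) (t : Set β)
    (h : ∀ a ∈ s, 1 ≤ (f a).toOuterMeasure t) :
    p.toOuterMeasure s ≤ (p.bind f).toOuterMeasure t := by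
  classical
  rw [PMF.toOuterMeasure_apply, PMF.toOuterMeasure_bind_apply]
  refine ENNReal.tsum_le_tsum fun a => ?_
  by_cases ha : a ∈ s
  · rw [Set.indicator_of_mem ha]
    calc p a = p a * 1 := (mul_one _).symm
      _ ≤ _ := mul_le_mul_right (h a ha) _
  · rw [Set.indicator_of_notMem ha]
    exact zero_le

/-! ### The expected number of critical faces -/

section expectation

variable {K : FinSimplicialComplex.{u}}

theorem expectedCritical_eq (s : Strategy) [Fintype (Finset (Finset K.V))] :
    expectedCritical s K = ∑ C, (criticalFaces K s C).toReal * C.card := by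
  let _ : MeasurableSpace (Finset (Finset K.V)) := ⊤
  have hm : (criticalCount s K).toMeasure =
      (criticalFaces K s).toMeasure.map Finset.card :=
    (PMF.toMeasure_map _ _ measurable_from_top).symm
  rw [expectedCritical, hm, MeasureTheory.integral_map measurable_from_top.aemeasurable
    (Measurable.of_discrete.aestronglyMeasurable), PMF.integral_eq_sum]
  rfl

theorem sum_toReal_eq_one {α : Type*} [Fintype α] (p : PMF α) : ∑ a, (p a).toReal = 1 := by
  have h : ∑ a, p a = 1 := by rw [← p.tsum_coe, tsum_fintype]
  rw [← ENNReal.toReal_sum fun a _ => p.apply_ne_top a, h, ENNReal.toReal_one]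

theorem subset_of_mem_support_criticalFaces (s : Strategy) :
    ∀ C ∈ (criticalFaces K s).support, C ⊆ K.faceFinset := by
  intro C hC
  cases s with
  | random => exact subset_of_mem_support_run _ _ _ rfl C hC
  | randomLexFirst =>
    obtain ⟨label, -, hC⟩ := (PMF.mem_support_bind_iff _ _ _).1 hC
    exact subset_of_mem_support_run _ _ _ rfl C hC
  | randomLexLast =>
    obtain ⟨label, -, hC⟩ := (PMF.mem_support_bind_iff _ _ _).1 hC
    exact subset_of_mem_support_run _ _ _ rfl C hC

theorem expectedCritical_le (s : Strategy) : expectedCritical s K ≤ K.faceFinset.card := by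
  classical
  let _ := Fintype.ofFinite (Finset (Finset K.V))
  rw [expectedCritical_eq]
  calc ∑ C, (criticalFaces K s C).toReal * C.card
      ≤ ∑ C, (criticalFaces K s C).toReal * K.faceFinset.card := by
        refine Finset.sum_le_sum fun C _ => ?_
        by_cases hC : C ∈ (criticalFaces K s).support
        · have := Finset.card_le_card (subset_of_mem_support_criticalFaces s C hC)
          gcongr
        · rw [(PMF.apply_eq_zero_iff _ _).2 hC]
          simp
    _ = K.faceFinset.card := by rw [← Finset.sum_mul, sum_toReal_eq_one, one_mul]

/-- Disjoint families of faces contribute independently to the expected number of critical faces. -/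
theorem sum_hits_le_expectedCritical (s : Strategy) {ι : Type*} (I : Finset ι)
    (H : ι → Set (Finset K.V)) (hH : ∀ i ∈ I, ∀ j ∈ I, ∀ h ∈ H i, h ∈ H j → i = j) {p : ℝ}
    (hp : ∀ i ∈ I, p ≤ ((criticalFaces K s).toOuterMeasure (hits (H i))).toReal) :
    I.card * p ≤ expectedCritical s K := by
  classical
  let _ := Fintype.ofFinite (Finset (Finset K.V))
  rw [expectedCritical_eq]
  -- Choosing a critical face in each family that is hit is injective, because the families are
  -- disjoint.
  have hcount : ∀ C : Finset (Finset K.V), (I.filter fun i => C ∈ hits (H i)).card ≤ C.card := by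
    intro C
    have hex : ∀ i, ∃ h, C ∈ hits (H i) → h ∈ H i ∧ h ∈ C := fun i => by
      by_cases hi : C ∈ hits (H i)
      · obtain ⟨h, hh, hC⟩ := hi
        exact ⟨h, fun _ => ⟨hh, hC⟩⟩
      · exact ⟨∅, fun h => absurd h hi⟩
    choose f hf using hex
    refine Finset.card_le_card_of_injOn f (fun i hi => (hf i (Finset.mem_filter.1 hi).2).2) ?_
    intro i hi j hj hij
    have hi' := Finset.mem_filter.1 (Finset.mem_coe.1 hi)
    have hj' := Finset.mem_filter.1 (Finset.mem_coe.1 hj)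
    exact hH i hi'.1 j hj'.1 _ (hf i hi'.2).1 (hij ▸ (hf j hj'.2).1)
  calc (I.card : ℝ) * p = ∑ i ∈ I, p := by rw [Finset.sum_const, nsmul_eq_mul]
    _ ≤ ∑ i ∈ I, ∑ C, (criticalFaces K s C).toReal * (if C ∈ hits (H i) then 1 else 0) := by
        refine Finset.sum_le_sum fun i hi => (hp i hi).trans_eq ?_
        rw [PMF.toOuterMeasure_apply_fintype, ENNReal.toReal_sum]
        · refine Finset.sum_congr rfl fun C _ => ?_
          by_cases hC : C ∈ hits (H i) <;> simp [hC]
        · intro C _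
          by_cases hC : C ∈ hits (H i)
          · simpa [hC] using PMF.apply_ne_top _ _
          · simp [hC]
    _ = ∑ C, (criticalFaces K s C).toReal * ((I.filter fun i => C ∈ hits (H i)).card : ℝ) := by
        rw [Finset.sum_comm]
        refine Finset.sum_congr rfl fun C _ => ?_
        rw [← Finset.mul_sum, Finset.sum_boole]
    _ ≤ _ := by
        refine Finset.sum_le_sum fun C _ => ?_
        have := hcount C
        gcongr

end expectation

end DiscreteMorse

/-! ### Counting faces, and the traps in the fourth subdivision -/

namespace FinSimplicialComplex

open OrdFacet

variable {K : FinSimplicialComplex.{u}} {d : ℕ}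

/-- The faces with `d + 1` vertices. -/
def facets (K : FinSimplicialComplex.{u}) (d : ℕ) : Set (Finset K.V) :=
  {σ | σ ∈ K.complex.faces ∧ σ.card = d + 1}

theorem exists_ordFacet (σ : facets K d) : ∃ g : OrdFacet K d, g.face = σ.1 :=
  exists_face_eq σ.2.1 σ.2.2

/-- For `d ≥ 1` each facet has two orderings that differ by an exchange, and distinct orderings give
distinct flags. -/
theorem two_mul_card_facets_le (hd : d ≠ 0) :
    2 * Nat.card (facets K d) ≤ Nat.card (facets K.sd d) := by
  choose g hg using exists_ordFacet (K := K) (d := d)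
  let k : Fin d := ⟨0, Nat.pos_of_ne_zero hd⟩
  let o : facets K d × Bool → OrdFacet K d := fun x => bif x.2 then g x.1 else (g x.1).perm (adjSwap k)
  have ho : ∀ x, (o x).face = x.1.1 := by
    rintro ⟨σ, _ | _⟩
    · exact (perm_face _ _).trans (hg σ)
    · exact hg σ
  have hinj : Function.Injective fun x => (⟨(o x).flag.face, (o x).flag.face_mem,
      (o x).flag.card_face⟩ : facets K.sd d) := by
    intro x y hxy
    have h : o x = o y := flag_injective (congrArg Subtype.val hxy)
    have h₁ : x.1 = y.1 := Subtype.ext (by rw [← ho x, ← ho y, h])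
    obtain ⟨σ, a⟩ := x
    obtain ⟨τ, b⟩ := y
    dsimp only at h₁
    subst h₁
    have hne := perm_adjSwap_ne (g σ) k
    cases a <;> cases b
    · rfl
    · exact absurd h hne
    · exact absurd h.symm hne
    · rfl
  have := Nat.card_le_card_of_injective _ hinj
  rwa [Nat.card_prod, Nat.card_eq_fintype_card (α := Bool), Fintype.card_bool, mul_comm] at this

theorem pow_two_le_card_facets (hd : d ≠ 0) (hK : (facets K d).Nonempty) (n : ℕ) :
    2 ^ n ≤ Nat.card (facets (FinSimplicialComplex.sd^[n] K) d) := by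
  induction n with
  | zero =>
    have : Nonempty (facets K d) := hK.to_subtype
    exact Nat.card_pos (α := facets K d)
  | succ n ih =>
    rw [Function.iterate_succ_apply', pow_succ']
    exact (Nat.mul_le_mul_left 2 ih).trans (two_mul_card_facets_le hd)

/-- A chain is a set of subsets of its largest member, which has at most `2 ^ (d + 1)` subsets. -/
theorem card_faceFinset_sd_le (hK : K.DimLE d) :
    K.sd.faceFinset.card ≤ K.faceFinset.card * 2 ^ 2 ^ (d + 1) := by
  classical
  have := Fintype.ofFinite K.sd.V
  have hsub : K.sd.faceFinset ⊆ K.faceFinset.biUnion fun F =>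
      (Finset.univ.filter fun x : K.sd.V => x.1 ⊆ F).powerset := by
    intro c hc
    have hc' := mem_faceFinset.1 hc
    obtain ⟨t, ht, hmax⟩ := c.exists_max_image (fun x => x.1.card) (nonempty_of_mem_faces hc')
    refine Finset.mem_biUnion.2 ⟨t.1, mem_faceFinset.2 t.2, Finset.mem_powerset.2 fun x hx =>
      Finset.mem_filter.2 ⟨Finset.mem_univ _, ?_⟩⟩
    rcases hc'.2 x hx t ht with h | h
    · exact h
    · exact (Finset.eq_of_subset_of_card_le h (hmax x hx)).ge
  refine (Finset.card_le_card hsub).trans (Finset.card_biUnion_le_card_mul _ _ _ fun F hF => ?_)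
  rw [Finset.card_powerset]
  refine Nat.pow_le_pow_right two_pos ?_
  calc (Finset.univ.filter fun x : K.sd.V => x.1 ⊆ F).card ≤ F.powerset.card :=
        Finset.card_le_card_of_injOn Subtype.val
          (fun x hx => Finset.mem_powerset.2 (Finset.mem_filter.1 hx).2)
          (Subtype.val_injective.injOn)
    _ ≤ 2 ^ (d + 1) := by
        rw [Finset.card_powerset]
        exact Nat.pow_le_pow_right two_pos (hK F (mem_faceFinset.1 hF))

theorem DimLE.iterate_sd (hK : K.DimLE d) (n : ℕ) : DimLE d (FinSimplicialComplex.sd^[n] K) := by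
  induction n with
  | zero => exact hK
  | succ n ih =>
    rw [Function.iterate_succ_apply']
    exact ih.sd

theorem card_faceFinset_iterate_sd_le (hK : K.DimLE d) (n : ℕ) :
    (FinSimplicialComplex.sd^[n] K).faceFinset.card ≤
      K.faceFinset.card * (2 ^ 2 ^ (d + 1)) ^ n := by
  induction n with
  | zero => simp
  | succ n ih =>
    rw [Function.iterate_succ_apply', pow_succ, ← mul_assoc]
    exact (card_faceFinset_sd_le (hK.iterate_sd n)).trans (Nat.mul_le_mul_right _ ih)

theorem dimLE_of_dim_eq (hK : K.dim = d) : K.DimLE d := by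
  intro σ hσ
  have h : σ.card ≤ K.faceFinset.sup Finset.card := Finset.le_sup (mem_faceFinset.2 hσ)
  rw [dim] at hK
  omega

theorem facets_nonempty_of_dim_eq (hK : K.dim = d) : (facets K d).Nonempty := by
  rw [dim] at hK
  have hne : K.faceFinset.Nonempty := by
    by_contra h
    rw [Finset.not_nonempty_iff_eq_empty.1 h] at hK
    simp at hK
  obtain ⟨σ, hσ, hcard⟩ := Finset.exists_mem_eq_sup _ hne Finset.card
  exact ⟨σ, mem_faceFinset.1 hσ, by omega⟩

section lift

variable {D H A B : Set (Finset K.V)}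

theorem card_liftD_le (hD : D ⊆ facets K d) :
    Nat.card (liftD d D) ≤ Nat.card D * (d + 1).factorial := by
  choose g hg using exists_ordFacet (K := K) (d := d)
  have hsurj : Function.Surjective fun x : D × Equiv.Perm (Fin (d + 1)) =>
      (⟨((g ⟨x.1.1, hD x.1.2⟩).perm x.2).flag.face, _, by
        rw [perm_face, hg]
        exact x.1.2, rfl⟩ : liftD d D) := by
    rintro ⟨_, f, hf, rfl⟩
    obtain ⟨π, hπ⟩ := exists_perm_eq (hg ⟨f.face, hD hf⟩)
    exact ⟨(⟨_, hf⟩, π), Subtype.ext (congrArg (fun g : OrdFacet K d => g.flag.face) hπ)⟩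
  have := Nat.card_le_card_of_surjective _ hsurj
  rwa [Nat.card_prod, Nat.card_perm, Nat.card_fin] at this

theorem OrdFacet.wall_last_mem_flag (hd : d ≠ 0) (g : OrdFacet K d) :
    ∃ v ∈ g.flag.wall (Fin.last d), v.1 = g.wall (Fin.last d) := by
  refine ⟨g.flag ⟨d - 1, by omega⟩, apply_mem_wall.2 ?_, ?_⟩
  · rw [Ne, Fin.ext_iff, Fin.val_last]
    dsimp only
    omega
  · rw [flag_apply_val, wall_last]
    dsimp only
    rw [Nat.sub_add_cancel (by omega)]

theorem OrdFacet.flag_apply_of_val_add_one_eq (g : OrdFacet K d) {i : Fin (d + 1)}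
    (hi : i.val + 1 = d) : (g.flag i).1 = g.wall (Fin.last d) := by
  rw [flag_apply_val, wall_last, hi]

/-- Serves `randomLexFirst`: barycenters of facets and of members of `A` occur in every passage of
the subdivision and, by `IsTrap.notMem_of_mem_liftH`, in no barrier face. Giving them the small
labels puts all passages first. -/
theorem exists_mem_of_mem_liftA (hd : d ≠ 0) {a : Finset K.sd.V} (ha : a ∈ liftA d D A B) :
    ∃ v ∈ a, v ∈ {x : K.sd.V | x.1.card = d + 1 ∨ x.1 ∈ A} := by
  rcases ha with ⟨g, k, -, -, rfl⟩ | ⟨g, -, hw, rfl⟩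
  · exact ⟨_, apply_mem_wall.2 (Fin.castSucc_lt_last k).ne', Or.inl (card_flag_apply _ _)⟩
  · obtain ⟨v, hv, hvw⟩ := g.wall_last_mem_flag hd
    exact ⟨v, hv, Or.inr (hvw ▸ hw)⟩

theorem IsTrap.notMem_of_mem_liftH (hT : IsTrap d K D H A) {h : Finset K.sd.V}
    (hh : h ∈ liftH d D H) {v : K.sd.V} (hv : v ∈ h) :
    v ∉ {x : K.sd.V | x.1.card = d + 1 ∨ x.1 ∈ A} := by
  obtain ⟨g, -, hw, rfl⟩ := hh
  obtain ⟨i, hi, rfl⟩ := mem_wall.1 hv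
  have hcard := card_flag_apply g i
  rintro (h | h)
  · refine hi (Fin.ext ?_)
    rw [Fin.val_last]
    omega
  · have := (hT.thin _ (Or.inr h)).1
    rw [g.flag_apply_of_val_add_one_eq (by omega)] at h
    exact hT.disj _ hw h

/-- Serves `randomLexLast`: barycenters of members of `H` occur in every barrier face and, by
`IsTrap.notMem_of_mem_liftA`, in no passage. Giving them the small labels puts all passages last. -/
theorem exists_mem_of_mem_liftH (hd : d ≠ 0) {h : Finset K.sd.V} (hh : h ∈ liftH d D H) :
    ∃ v ∈ h, v ∈ {x : K.sd.V | x.1 ∈ H} := by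
  obtain ⟨g, -, hw, rfl⟩ := hh
  obtain ⟨v, hv, hvw⟩ := g.wall_last_mem_flag hd
  exact ⟨v, hv, show v.1 ∈ H from hvw.symm ▸ hw⟩

theorem IsTrap.notMem_of_mem_liftA (hT : IsTrap d K D H A) {a : Finset K.sd.V}
    (ha : a ∈ liftA d D A H) {v : K.sd.V} (hv : v ∈ a) : v ∉ {x : K.sd.V | x.1 ∈ H} := by
  intro (hvH : v.1 ∈ H)
  have hcard := (hT.thin _ (Or.inl hvH)).1
  rcases ha with ⟨g, k, -, hk, rfl⟩ | ⟨g, -, hw, rfl⟩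
  all_goals
    obtain ⟨i, hi, rfl⟩ := mem_wall.1 hv
    rw [card_flag_apply] at hcard
    rw [g.flag_apply_of_val_add_one_eq hcard] at hvH
  · rcases hk with hk | hk
    · exact hk hvH
    · exact hi (Fin.ext (by rw [Fin.val_castSucc]; omega))
  · exact hT.disj _ hvH hw

end lift

section trap

variable {f f' : OrdFacet K d}

theorem card_baseD_le (f : OrdFacet K d) : Nat.card (baseD f) ≤ Nat.card (Chamber d) :=
  Nat.card_le_card_of_surjective (fun P => (⟨_, P, rfl⟩ : baseD f))
    (by rintro ⟨_, P, rfl⟩; exact ⟨P, rfl⟩)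

theorem face_eq_of_mem_baseD {c : Finset K.sd.sd.V} (h : c ∈ baseD f) (h' : c ∈ baseD f') :
    f.face = f'.face := by
  obtain ⟨P, rfl⟩ := h
  obtain ⟨P', hP'⟩ := h'
  have h₁ : preBary f' P' = preBary f P := flag_injective hP'
  have h₂ := congrArg OrdFacet.face h₁
  rw [preBary, preBary, perm_face, perm_face] at h₂
  have h₃ := congrArg OrdFacet.face (flag_injective h₂)
  rwa [perm_face, perm_face, eq_comm] at h₃

theorem exists_mem_of_mem_liftD {D D' : Set (Finset K.V)} {c : Finset K.sd.V}
    (h : c ∈ liftD d D) (h' : c ∈ liftD d D') : ∃ F ∈ D, F ∈ D' := by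
  obtain ⟨g, hg, rfl⟩ := h
  obtain ⟨g', hg', hgg⟩ := h'
  exact ⟨_, hg, flag_injective hgg ▸ hg'⟩

/-- The only two facets around a barrier face belong to its own trap, so a barrier face common to
two traps forces a common facet. Thus barriers inside different facets are disjoint. -/
theorem IsTrap.exists_mem_of_mem {D D' H H' A A' : Set (Finset K.V)} (hT : IsTrap d K D H A)
    (hT' : IsTrap d K D' H' A') {h : Finset K.V} (hh : h ∈ H) (hh' : h ∈ H') :
    ∃ F ∈ D, F ∈ D' := by
  obtain ⟨-, F, hF, F', hF', -, -, -, hG⟩ := hT.thin h (Or.inl hh)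
  obtain ⟨-, F₁, hF₁, -, -, -, hs, -⟩ := hT'.thin h (Or.inl hh')
  rcases hG F₁ (hT'.mem_D _ hF₁).1 (hT'.mem_D _ hF₁).2 hs with rfl | rfl
  · exact ⟨_, hF, hF₁⟩
  · exact ⟨_, hF', hF₁⟩

/-- The trap in the third subdivision of a facet. -/
theorem isTrap_lift_base (hK : K.DimLE d) (hd : 3 ≤ d) (f : OrdFacet K d) :
    IsTrap d K.sd.sd.sd (liftD d (baseD f)) (liftH d (baseD f) (baseH f))
      (liftA d (baseD f) (baseA f) ∅) :=
  (isTrap_base hK hd f).lift hK.sd.sd (by omega) (by simp)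

/-- The trap in the fourth subdivision of a facet. -/
theorem isTrap_lift_lift_base (hK : K.DimLE d) (hd : 3 ≤ d) (f : OrdFacet K d) :
    IsTrap d K.sd.sd.sd.sd (liftD d (liftD d (baseD f)))
      (liftH d (liftD d (baseD f)) (liftH d (baseD f) (baseH f)))
      (liftA d (liftD d (baseD f)) (liftA d (baseD f) (baseA f) ∅)
        (liftH d (baseD f) (baseH f))) :=
  (isTrap_lift_base hK hd f).lift hK.sd.sd.sd (by omega)
    fun _ hF _ hb _ hb' => liftH_unique hF hb hb'

theorem card_liftD_liftD_baseD_le (hK : K.DimLE d) (hd : 3 ≤ d) (f : OrdFacet K d) :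
    Nat.card (liftD d (liftD d (baseD f))) ≤
      Nat.card (Chamber d) * (d + 1).factorial * (d + 1).factorial :=
  (card_liftD_le (isTrap_lift_base hK hd f).mem_D).trans (Nat.mul_le_mul_right _
    ((card_liftD_le (isTrap_base hK hd f).mem_D).trans
      (Nat.mul_le_mul_right _ (card_baseD_le f))))

theorem face_eq_of_mem_liftH_liftH (hK : K.DimLE d) (hd : 3 ≤ d) {h : Finset K.sd.sd.sd.sd.V}
    (hh : h ∈ liftH d (liftD d (baseD f)) (liftH d (baseD f) (baseH f)))
    (hh' : h ∈ liftH d (liftD d (baseD f')) (liftH d (baseD f') (baseH f'))) :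
    f.face = f'.face := by
  obtain ⟨F, hF, hF'⟩ := (isTrap_lift_lift_base hK hd f).exists_mem_of_mem
    (isTrap_lift_lift_base hK hd f') hh hh'
  obtain ⟨F, hF, hF'⟩ := exists_mem_of_mem_liftD hF hF'
  obtain ⟨F, hF, hF'⟩ := exists_mem_of_mem_liftD hF hF'
  exact face_eq_of_mem_baseD hF hF'

end trap

end FinSimplicialComplex

/-! ### Uniform lower bounds for the three strategies -/

namespace DiscreteMorse

open FinSimplicialComplex
open scoped ENNReal

section hits

variable {K : FinSimplicialComplex.{u}} {d N : ℕ} {D H A : Set (Finset K.V)}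

open Classical in
/-- The set of vertices of the facets of a trap. -/
theorem exists_vertices (hT : IsTrap d K D H A) (hN : Nat.card D ≤ N) :
    ∃ W : Finset K.V, W.card ≤ N * (d + 1) ∧ ∀ h, h ∈ H ∨ h ∈ A → h ⊆ W := by
  refine ⟨D.toFinite.toFinset.biUnion id, ?_, fun h hh => ?_⟩
  · refine (Finset.card_biUnion_le_card_mul _ _ (d + 1) fun F hF => ?_).trans ?_
    · exact (hT.mem_D F (D.toFinite.mem_toFinset.1 hF)).2.le
    · rw [← Set.ncard_eq_toFinset_card, ← Nat.card_coe_set_eq]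
      exact Nat.mul_le_mul_right _ hN
  · obtain ⟨-, F, hF, -, -, -, hs, -⟩ := hT.thin h hh
    exact hs.trans (Finset.subset_biUnion_of_mem id (D.toFinite.mem_toFinset.2 hF))

open Classical in
theorem pow_card_le_run_hits (hK : K.DimLE d) (hd : d ≠ 0) (hT : IsTrap d K D H A)
    (hN : Nat.card D ≤ N) {sel : Selector K.V} {q : ℝ≥0∞} (hq : q ≤ 1)
    (hsel : Avoids sel H A q) : q ^ N ≤ (run sel K.faceFinset).toOuterMeasure (hits H) := by
  refine (pow_le_pow_right_of_le_one' hq ?_).trans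
    (pow_le_run_hits hK hd hT hq hsel _ _ rfl (intact_faceFinset hT hd))
  refine le_trans ?_ hN
  rw [Nat.card_coe_set_eq, Set.ncard_eq_toFinset_card]
  exact Finset.card_le_card fun F hF => D.toFinite.mem_toFinset.2 (Finset.mem_filter.1 hF).2

theorem le_criticalFaces_random (hK : K.DimLE d) (hd : d ≠ 0) (hT : IsTrap d K D H A)
    (hN : Nat.card D ≤ N) : (((2 ^ (N * (d + 1)) + 1 : ℕ) : ℝ≥0∞)⁻¹) ^ N ≤
      (criticalFaces K .random).toOuterMeasure (hits H) := by
  classical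
  obtain ⟨W, hW, hsub⟩ := exists_vertices hT hN
  refine pow_card_le_run_hits hK hd hT hN (ENNReal.inv_le_one.2 ?_)
    (avoids_selectUniform hT.disj fun F => ?_)
  · exact_mod_cast Nat.le_add_left 1 _
  · calc (F.filter (· ∈ H)).card ≤ W.powerset.card := Finset.card_le_card fun h hh =>
          Finset.mem_powerset.2 (hsub h (Or.inl (Finset.mem_filter.1 hh).2))
      _ ≤ _ := by
          rw [Finset.card_powerset]
          exact Nat.pow_le_pow_right two_pos hW

theorem le_criticalFaces_of_labels (hK : K.DimLE d) (hd : d ≠ 0) (hT : IsTrap d K D H A)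
    (hN : Nat.card D ≤ N) {W : Finset K.V} (hW : W.card ≤ N * (d + 1)) (B : Set K.V)
    {sel : (K.V ≃ Fin (Nat.card K.V)) → Selector K.V}
    (hsel : ∀ label ∈ firstLabels W B, Avoids (sel label) H A 1) :
    (((N * (d + 1)).factorial : ℕ) : ℝ≥0∞)⁻¹ ≤
      ((randomLabelling K).bind fun label => run (sel label) K.faceFinset).toOuterMeasure
        (hits H) := by
  calc (((N * (d + 1)).factorial : ℕ) : ℝ≥0∞)⁻¹ ≤ ((W.card.factorial : ℕ) : ℝ≥0∞)⁻¹ := by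
        rw [ENNReal.inv_le_inv]
        exact_mod_cast Nat.factorial_le hW
    _ ≤ (randomLabelling K).toOuterMeasure (firstLabels W B) := inv_factorial_le_firstLabels K W B
    _ ≤ _ := le_bind_toOuterMeasure _ _ _ _ fun label hl =>
        (one_pow N).ge.trans (pow_card_le_run_hits hK hd hT hN le_rfl (hsel label hl))

theorem labelList_lt_of_mem_firstLabels {n : ℕ} {W : Finset K.V} {B : Set K.V}
    {label : K.V ≃ Fin n} (hl : label ∈ firstLabels W B) {σ τ : Finset K.V} (hσ : σ ⊆ W)
    (hτ : τ ⊆ W) (hτn : τ.Nonempty) (hσB : ∃ v ∈ σ, v ∈ B) (hτB : ∀ v ∈ τ, v ∉ B) :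
    labelList label σ < labelList label τ := by
  obtain ⟨b, hb, hbB⟩ := hσB
  exact labelList_lt hb hτn fun v hv => hl b (hσ hb) hbB v (hτ hv) (hτB v hv)

theorem IsTrap.nonempty_of_mem (hd : d ≠ 0) (hT : IsTrap d K D H A) {h : Finset K.V}
    (hh : h ∈ H ∨ h ∈ A) : h.Nonempty :=
  Finset.card_pos.1 (by have := (hT.thin h hh).1; omega)

theorem le_criticalFaces_lexFirst (hK : K.DimLE d) (hd : d ≠ 0) (hT : IsTrap d K D H A)
    (hN : Nat.card D ≤ N) (B : Set K.V) (hA : ∀ a ∈ A, ∃ v ∈ a, v ∈ B)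
    (hH : ∀ h ∈ H, ∀ v ∈ h, v ∉ B) : (((N * (d + 1)).factorial : ℕ) : ℝ≥0∞)⁻¹ ≤
      (criticalFaces K .randomLexFirst).toOuterMeasure (hits H) := by
  obtain ⟨W, hW, hsub⟩ := exists_vertices hT hN
  exact le_criticalFaces_of_labels hK hd hT hN hW B fun label hl =>
    avoids_selectLexFirst fun a ha h hh => labelList_lt_of_mem_firstLabels hl (hsub a (Or.inr ha))
      (hsub h (Or.inl hh)) (IsTrap.nonempty_of_mem hd hT (Or.inl hh)) (hA a ha) (hH h hh)

theorem le_criticalFaces_lexLast (hK : K.DimLE d) (hd : d ≠ 0) (hT : IsTrap d K D H A)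
    (hN : Nat.card D ≤ N) (B : Set K.V) (hH : ∀ h ∈ H, ∃ v ∈ h, v ∈ B)
    (hA : ∀ a ∈ A, ∀ v ∈ a, v ∉ B) : (((N * (d + 1)).factorial : ℕ) : ℝ≥0∞)⁻¹ ≤
      (criticalFaces K .randomLexLast).toOuterMeasure (hits H) := by
  obtain ⟨W, hW, hsub⟩ := exists_vertices hT hN
  exact le_criticalFaces_of_labels hK hd hT hN hW B fun label hl =>
    avoids_selectLexLast fun a ha h hh => labelList_lt_of_mem_firstLabels hl (hsub h (Or.inl hh))
      (hsub a (Or.inr ha)) (IsTrap.nonempty_of_mem hd hT (Or.inr ha)) (hH h hh) (hA a ha)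

end hits

/-- The point is the order of quantifiers: the probability depends on the strategy, `d` and the size
bound `N` only, so it stays the same along all subdivisions. -/
theorem exists_le_criticalFaces_lift (s : Strategy) {d : ℕ} (hd : d ≠ 0) (N : ℕ) :
    ∃ p : ℝ, 0 < p ∧ ∀ (K : FinSimplicialComplex.{u}) (D H A : Set (Finset K.V)), K.DimLE d →
      IsTrap d K D H A → IsTrap d K.sd (liftD d D) (liftH d D H) (liftA d D A H) →
      Nat.card (liftD d D) ≤ N →
      p ≤ ((criticalFaces K.sd s).toOuterMeasure (hits (liftH d D H))).toReal := by
  have key : ∃ q : ℝ≥0∞, q ≠ 0 ∧ q ≠ ∞ ∧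
      ∀ (K : FinSimplicialComplex.{u}) (D H A : Set (Finset K.V)), K.DimLE d →
      IsTrap d K D H A → IsTrap d K.sd (liftD d D) (liftH d D H) (liftA d D A H) →
      Nat.card (liftD d D) ≤ N →
      q ≤ (criticalFaces K.sd s).toOuterMeasure (hits (liftH d D H)) := by
    have hf : (((N * (d + 1)).factorial : ℕ) : ℝ≥0∞)⁻¹ ≠ 0 :=
      ENNReal.inv_ne_zero.2 (ENNReal.natCast_ne_top _)
    have hf' : (((N * (d + 1)).factorial : ℕ) : ℝ≥0∞)⁻¹ ≠ ∞ :=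
      ENNReal.inv_ne_top.2 (Nat.cast_ne_zero.2 (Nat.factorial_ne_zero _))
    cases s with
    | random =>
      refine ⟨(((2 ^ (N * (d + 1)) + 1 : ℕ) : ℝ≥0∞)⁻¹) ^ N, ?_, ?_,
        fun K D H A hK _ hT hN => le_criticalFaces_random hK.sd hd hT hN⟩
      · exact pow_ne_zero _ (ENNReal.inv_ne_zero.2 (ENNReal.natCast_ne_top _))
      · exact ENNReal.pow_ne_top (ENNReal.inv_ne_top.2 (Nat.cast_ne_zero.2 (Nat.succ_ne_zero _)))
    | randomLexFirst =>
      exact ⟨_, hf, hf', fun K D H A hK hT₀ hT hN => le_criticalFaces_lexFirst hK.sd hd hT hN _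
        (fun a ha => exists_mem_of_mem_liftA hd ha) (fun h hh v hv => hT₀.notMem_of_mem_liftH hh hv)⟩
    | randomLexLast =>
      exact ⟨_, hf, hf', fun K D H A hK hT₀ hT hN => le_criticalFaces_lexLast hK.sd hd hT hN _
        (fun h hh => exists_mem_of_mem_liftH hd hh) (fun a ha v hv => hT₀.notMem_of_mem_liftA ha hv)⟩
  obtain ⟨q, hq, hq', h⟩ := key
  refine ⟨q.toReal, ENNReal.toReal_pos hq hq', fun K D H A hK hT₀ hT hN => ?_⟩
  refine ENNReal.toReal_mono ?_ (h K D H A hK hT₀ hT hN)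
  refine ne_top_of_le_ne_top ENNReal.one_ne_top ?_
  exact ((criticalFaces K.sd s).toOuterMeasure.mono (Set.subset_univ _)).trans_eq
    ((PMF.toOuterMeasure_apply_eq_one_iff _ _).2 (Set.subset_univ _))

theorem exists_mul_card_facets_le (s : Strategy) {d : ℕ} (hd : 3 ≤ d) :
    ∃ p : ℝ, 0 < p ∧ ∀ K : FinSimplicialComplex.{u}, K.DimLE d →
      Nat.card (facets K d) * p ≤ expectedCritical s K.sd.sd.sd.sd := by
  classical
  obtain ⟨p, hp, h⟩ := exists_le_criticalFaces_lift.{u} s (d := d) (by omega)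
    (Nat.card (Chamber d) * (d + 1).factorial * (d + 1).factorial)
  refine ⟨p, hp, fun K hK => ?_⟩
  choose g hg using exists_ordFacet (K := K) (d := d)
  have := Fintype.ofFinite (facets K d)
  rw [Nat.card_eq_fintype_card]
  refine sum_hits_le_expectedCritical s Finset.univ
    (fun σ => liftH d (liftD d (baseD (g σ))) (liftH d (baseD (g σ)) (baseH (g σ)))) ?_
    fun σ _ => h _ _ _ _ hK.sd.sd.sd (isTrap_lift_base hK hd (g σ))
      (isTrap_lift_lift_base hK hd (g σ)) (card_liftD_liftD_baseD_le hK hd (g σ))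
  intro σ _ τ _ c hc hc'
  exact Subtype.ext (by rw [← hg σ, ← hg τ, face_eq_of_mem_liftH_liftH hK hd hc hc'])

end DiscreteMorse

/-! ### Exponential bounds and the conclusion -/

theorem eventually_log_bounds {E : ℕ → ℝ} {p a b : ℝ} (hp : 0 < p) (ha : 1 ≤ a) (hb : 1 ≤ b)
    (hlow : ∀ n, 2 ^ n * p ≤ E (n + 4)) (hup : ∀ n, E n ≤ a * b ^ n) :
    ∃ c C : ℝ, 0 < c ∧ 0 < C ∧ ∀ᶠ n : ℕ in Filter.atTop,
      c * n ≤ Real.log (E n) ∧ Real.log (E n) ≤ C * n := by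
  have hlog := Real.log_pos one_lt_two
  refine ⟨Real.log 2 / 2, Real.log a + Real.log b + 1, by positivity,
    by have := Real.log_nonneg ha; have := Real.log_nonneg hb; positivity, ?_⟩
  -- The threshold is `log 2 / 2 * n ≥ 4 * log 2 - log p` solved for `n`: half of the growth rate
  -- `log 2` pays for the four subdivisions spent on the trap and for the factor `p`.
  have hlim := (tendsto_natCast_atTop_atTop (R := ℝ)).eventually_ge_atTop
    (2 / Real.log 2 * (4 * Real.log 2 - Real.log p))
  filter_upwards [hlim, Filter.eventually_ge_atTop 4] with n hn hn4
  obtain ⟨m, rfl⟩ := Nat.exists_eq_add_of_le' hn4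
  have hpos : 0 < 2 ^ m * p := by positivity
  have hE := hpos.trans_le (hlow m)
  constructor
  · refine le_trans ?_ (Real.log_le_log hpos (hlow m))
    rw [Real.log_mul (by positivity) hp.ne', Real.log_pow]
    have h₁ : Real.log 2 / 2 * (2 / Real.log 2 * (4 * Real.log 2 - Real.log p)) =
        4 * Real.log 2 - Real.log p := by field_simp
    have h₂ := mul_le_mul_of_nonneg_left hn (by positivity : 0 ≤ Real.log 2 / 2)
    rw [h₁] at h₂
    push_cast at h₂ ⊢
    linarith
  · refine (Real.log_le_log hE (hup _)).trans ?_
    rw [Real.log_mul (by positivity) (by positivity), Real.log_pow]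
    have h₁ : (1 : ℝ) ≤ (m + 4 : ℕ) := by exact_mod_cast Nat.le_add_left 1 _
    have h₂ := mul_le_mul_of_nonneg_left h₁ (Real.log_nonneg ha)
    linarith

theorem corollary5p4 (d : ℕ) (hd : 3 ≤ d) (K : FinSimplicialComplex.{u}) (hK : K.dim = d)
    (s : DiscreteMorse.Strategy) :
    ∃ c C : ℝ, 0 < c ∧ 0 < C ∧ ∀ᶠ ℓ : ℕ in Filter.atTop,
      c * ℓ ≤ Real.log (DiscreteMorse.expectedCritical s (FinSimplicialComplex.sd^[ℓ] K)) ∧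
      Real.log (DiscreteMorse.expectedCritical s (FinSimplicialComplex.sd^[ℓ] K)) ≤ C * ℓ := by
  have hdim := FinSimplicialComplex.dimLE_of_dim_eq hK
  have hne := FinSimplicialComplex.facets_nonempty_of_dim_eq hK
  obtain ⟨p, hp, h⟩ := DiscreteMorse.exists_mul_card_facets_le.{u} s hd
  refine eventually_log_bounds hp (a := K.faceFinset.card) (b := (2 ^ 2 ^ (d + 1) : ℕ)) ?_ ?_
    (fun n => ?_) fun n => ?_
  · obtain ⟨σ, hσ, -⟩ := hne
    exact_mod_cast Finset.card_pos.2 ⟨σ, FinSimplicialComplex.mem_faceFinset.2 hσ⟩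
  · exact_mod_cast Nat.one_le_two_pow
  · have h₁ := h _ (hdim.iterate_sd n)
    rw [show n + 4 = n + 1 + 1 + 1 + 1 from rfl]
    simp only [Function.iterate_succ_apply']
    refine le_trans ?_ h₁
    have := FinSimplicialComplex.pow_two_le_card_facets (by omega) hne n
    gcongr
    exact_mod_cast this
  · refine (DiscreteMorse.expectedCritical_le s).trans ?_
    exact_mod_cast FinSimplicialComplex.card_faceFinset_iterate_sd_le hdim n
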